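/- Let $N\ge 2$ and consider a fixed-gain amplify-and-forward link with $N$ hops, channel coefficients $h_1,\dots,h_N$ and fixed gains $A_0,\dots,A_{N-1}$. Assume that the amplified channel powers $X_n=A_{n-1}^2|h_n|^2$ are independent and that $X_n$ has the Rician power density $$f_{X_n}(x)=\frac{K_n+1}{\theta_n}\,e^{-K_n-(K_n+1)x/\theta_n}\,I_0\!\left(\sqrt{\frac{4K_n(K_n+1)x}{\theta_n}}\right),\qquad x\ge 0,$$ with $K_n\ge 0$, $\theta_n>0$. Let $\rho_n>0$ and let $\gamma_{th}>0$. The end-to-end SNR and the outage probability are $$\mathsf{SNR}=\frac{\prod_{n=1}^N X_n}{\sum_{n=1}^N\rho_n\prod_{j=n+1}^N X_j}\,\bar\gamma ,\qquad P_o=P_o(\bar\gamma)=P(\mathsf{SNR}<\gamma_{th}).$$ Below, $f\sim g$ means asymptotic equivalence as $\bar\gamma\to\infty$ (ratio tending to $1$), and $o(\cdot)$ refers to $\bar\gamma\to\infty$. Let $L_1,\dots,L_{N-1}\ge 1$ be integers. For $\ell=(\ell_1,\dots,\ell_{N-1})$ with $0\le\ell_n\le L_n-1$ put $\lambda_n=\sum_{k=1}^n\ell_k$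 ($\lambda_0=0$). For $1\le r\le N$ let $\mathcal L_r$ be the set of these $\ell$ with $\lambda_{r-1}=0$ and, if $r\le N-1$, $\lambda_r>0$. Put $M[f;s]=\int_0^\infty x^{s-1}f(x)\,dx$, $$I_L(\bar\gamma)=1-\sum_{\ell}(-1)^{\lambda_{N-1}}\prod_{n=1}^{N-1}\frac1{\ell_n!}\Big(\frac{\rho_n}{\rho_N}\Big)^{\ell_n}\cdot\frac1{2\pi i}\int_{-\kappa_\ell-i\infty}^{-\kappa_\ell+i\infty}\Big(\frac{\rho_N\gamma_{th}}{\bar\gamma}\Big)^{s}\frac{\Gamma(\lambda_{N-1}-s)}{\Gamma(1-s)}\prod_{n=1}^N M[f_{X_n};1+\lambda_{n-1}-s]\,ds$$ with arbitrary $\kappa_\ell>\lambda_{N-1}$, and $$S_L(\bar\gamma)=a\sum_{r=1}^{N}\sum_{\ell\in\mathcal L_r}(-1)^{\lambda_{N-1}}\zeta_\ell\sum_{l=0}^{r-1}\frac{\varrho^{(r-1-l)}(1)}{(r-1-l)!\,l!}\sum_{p=0}^{l}\binom lp(-1)^p(\log a)^{l-p}\,\frac{(\log\bar\gamma)^p}{\bar\gamma},$$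 where $a=\rho_N\gamma_{th}\prod_{n=1}^N\frac{K_n+1}{\theta_n}$, $$\zeta_\ell=e^{-K_N}\prod_{n=1}^{N-1}\frac{e^{-K_n}}{\ell_n!}\Big(\frac{\rho_n}{\rho_N}\Big)^{\ell_n}\Big(\frac{\theta_{n+1}}{K_{n+1}+1}\Big)^{\lambda_n},$$ $$\varrho(s)=(s-1)^r\,\frac{\Gamma(\lambda_{N-1}-s)}{\Gamma(1-s)}\prod_{n=1}^{N}\Gamma(1+\lambda_{n-1}-s)\;{}_1F_1(1+\lambda_{n-1}-s,1;K_n)$$ (which depends on $r$ and $\ell$), and $\varrho^{(k)}(1)=\lim_{s\to1}\varrho^{(k)}(s)$ is the derivative after removing the removable singularity at $s=1$. Then the contour integrals converge absolutely for every $\bar\gamma>0$ and: 1. $P_o\sim I_L$, and $I_L=S_L+o(\bar\gamma^{-1})$. Thus $P_o\sim S_L+o(\bar\gamma^{-1})$, where the $o(\bar\gamma^{-1})$ term is $I_L-S_L$; also $P_o\sim S_L$. 2. If $L_n\ge 2$ for all $n$, then moreover $P_o=S_L+o\big((\log\bar\gamma)^{N-2}/\bar\gamma\big)$; for $N=2$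 the error is $o(\bar\gamma^{-1})$. 3. To leading order, $$P_o\sim\frac{\rho_N\gamma_{th}}{(N-1)!}\prod_{n=1}^N\frac{K_n+1}{\theta_n e^{K_n}}\;\frac{(\log\bar\gamma)^{N-1}}{\bar\gamma}.$$ -/

import Mathlib

open MeasureTheory ProbabilityTheory Filter Topology Asymptotics

noncomputable section

namespace MultihopRelay

/-! ### The Rician channel power law -/

/-- The modified Bessel function of the first kind of order zero. -/
def besselI0 (x : ℝ) : ℝ := ∑' k : ℕ, (x / 2) ^ (2 * k) / ((k.factorial : ℝ)) ^ 2

/-- Probability density of the power of a Rician channel with `K`-factor `K` and scale `θ`. -/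
def ricianPDF (K θ x : ℝ) : ℝ :=
  if 0 ≤ x then
    θ⁻¹ * (K + 1) * Real.exp (-(K + θ⁻¹ * (K + 1) * x)) *
      besselI0 (Real.sqrt (4 * K * (K + 1) * x / θ))
  else 0

/-- The law on `ℝ` with density `ricianPDF K θ`. -/
def ricianLaw (K θ : ℝ) : Measure ℝ :=
  volume.withDensity fun x => ENNReal.ofReal (ricianPDF K θ x)

/-! ### The fixed-gain amplify-and-forward link

There are `M` relays and `M + 1` hops, and hops are numbered from `0` to `M`. So hop `n : Fin (M + 1)`
is the `(n + 1)`-st hop, and `A n` is the gain applied by the node that transmits over it. -/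

/-- The amplified channel power of each hop: squared gain times squared channel modulus. -/
def channelPower {M : ℕ} {Ω : Type*} (A : Fin (M + 1) → ℝ) (h : Fin (M + 1) → Ω → ℂ)
    (n : Fin (M + 1)) (ω : Ω) : ℝ :=
  A n ^ 2 * ‖h n ω‖ ^ 2

/-- The instantaneous end-to-end signal-to-noise ratio when the noise variance at the receiver of
hop `n` is `ρ n / γ`. -/
def snr {M : ℕ} {Ω : Type*} (A : Fin (M + 1) → ℝ) (h : Fin (M + 1) → Ω → ℂ)
    (ρ : Fin (M + 1) → ℝ) (γ : ℝ) (ω : Ω) : ℝ :=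
  (∏ n, channelPower A h n ω) /
    (∑ n, ρ n * ∏ j ∈ Finset.Ioi n, channelPower A h j ω) * γ

/-- The outage probability: the probability that the end-to-end SNR is below the threshold `γth`. -/
def outageProb {M : ℕ} {Ω : Type*} [MeasurableSpace Ω] (μ : Measure Ω)
    (A : Fin (M + 1) → ℝ) (h : Fin (M + 1) → Ω → ℂ) (ρ : Fin (M + 1) → ℝ) (γth γ : ℝ) : ℝ :=
  μ.real {ω | snr A h ρ γ ω < γth}

/-! ### Multi-indices -/

/-- `lam ℓ n` is the sum of the first `n` entries of the tuple `ℓ`. -/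
def lam {M : ℕ} (ℓ : Fin M → ℕ) (n : ℕ) : ℕ :=
  ∑ k ∈ Finset.univ.filter (fun k : Fin M => (k : ℕ) < n), ℓ k

/-- The tuples `ℓ` with `0 ≤ ℓ k ≤ L k - 1` for every `k`. -/
def box {M : ℕ} (L : Fin M → ℕ) : Finset (Fin M → ℕ) :=
  Fintype.piFinset fun k => Finset.range (L k)

/-- The tuples in the box whose first `r - 1` entries vanish and whose `r`-th entry (if there is
one) does not, in terms of the partial sums. -/
def indexSet {M : ℕ} (L : Fin M → ℕ) (r : ℕ) : Finset (Fin M → ℕ) :=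
  (box L).filter fun ℓ => lam ℓ (r - 1) = 0 ∧ (r ≤ M → 0 < lam ℓ r)

/-! ### The contour-integral expression of the outage probability -/

/-- The integrand, with `M[f; s]` the Mellin transform `mellin f s`. -/
def contourIntegrand {M : ℕ} (K θ ρ : Fin (M + 1) → ℝ) (γth : ℝ) (ℓ : Fin M → ℕ) (γ : ℝ)
    (s : ℂ) : ℂ :=
  ((ρ (Fin.last M) * γth / γ : ℝ) : ℂ) ^ s *
    (Complex.Gamma ((lam ℓ M : ℂ) - s) / Complex.Gamma (1 - s)) *
    ∏ n : Fin (M + 1),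
      mellin (fun x => (ricianPDF (K n) (θ n) x : ℂ)) (1 + (lam ℓ n : ℂ) - s)

/-- `(1 / (2 π i)) ∫ F(s) ds` along the upward vertical line with real part `c`. -/
def verticalIntegral (F : ℂ → ℂ) (c : ℝ) : ℂ :=
  (1 / (2 * Real.pi) : ℂ) * ∫ t : ℝ, F (c + t * Complex.I)

/-- The contour-integral approximation of order `L` of the outage probability; the contour for the
index `ℓ` is the line with real part `-κ ℓ`. -/
def contourOutage {M : ℕ} (K θ ρ : Fin (M + 1) → ℝ) (γth : ℝ) (L : Fin M → ℕ)
    (κ : (Fin M → ℕ) → ℝ) (γ : ℝ) : ℂ :=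
  1 - ∑ ℓ ∈ box L, (-1) ^ lam ℓ M *
    (∏ k : Fin M, (1 / ((ℓ k).factorial : ℂ)) *
      ((ρ k.castSucc / ρ (Fin.last M) : ℝ) : ℂ) ^ ℓ k) *
    verticalIntegral (contourIntegrand K θ ρ γth ℓ γ) (-κ ℓ)

/-! ### The high-SNR expansion -/

/-- The confluent hypergeometric function `₁F₁(a, b; x)`. -/
def kummer (a b x : ℝ) : ℝ :=
  ∑' k : ℕ, (ascPochhammer ℝ k).eval a / (ascPochhammer ℝ k).eval b * x ^ k / (k.factorial : ℝ)

/-- The function `ϱ`; it has a removable singularity at `s = 1`. -/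
def varrho {M : ℕ} (K : Fin (M + 1) → ℝ) (ℓ : Fin M → ℕ) (r : ℕ) (s : ℝ) : ℝ :=
  (s - 1) ^ r * (Real.Gamma ((lam ℓ M : ℝ) - s) / Real.Gamma (1 - s)) *
    ∏ n : Fin (M + 1),
      (Real.Gamma (1 + (lam ℓ n : ℝ) - s) * kummer (1 + (lam ℓ n : ℝ) - s) 1 (K n))

/-- The `k`-th derivative at `1` of `ϱ`, its removable singularity there being removed, that is, the
limit of the `k`-th derivative at `s` as `s → 1`, `s ≠ 1`. -/
def varrhoDeriv {M : ℕ} (K : Fin (M + 1) → ℝ) (ℓ : Fin M → ℕ) (r k : ℕ) : ℝ :=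
  limUnder (𝓝[≠] (1 : ℝ)) (iteratedDeriv k (varrho K ℓ r))

/-- The coefficient `ζ_ℓ`. -/
def zetaCoeff {M : ℕ} (K θ ρ : Fin (M + 1) → ℝ) (ℓ : Fin M → ℕ) : ℝ :=
  Real.exp (-K (Fin.last M)) *
    ∏ k : Fin M, Real.exp (-K k.castSucc) / ((ℓ k).factorial : ℝ) *
      (ρ k.castSucc / ρ (Fin.last M)) ^ ℓ k *
      (θ k.succ / (K k.succ + 1)) ^ lam ℓ ((k : ℕ) + 1)

/-- The constant `ρ_N γ_th ∏ (K_n + 1) / ∏ θ_n`. -/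
def baseConst {M : ℕ} (K θ ρ : Fin (M + 1) → ℝ) (γth : ℝ) : ℝ :=
  ρ (Fin.last M) * γth * (∏ n, (K n + 1)) / ∏ n, θ n

/-- The expansion of the outage probability in the functions `(log γ) ^ p / γ`. -/
def riceExpansion {M : ℕ} (K θ ρ : Fin (M + 1) → ℝ) (γth : ℝ) (L : Fin M → ℕ) (γ : ℝ) : ℝ :=
  baseConst K θ ρ γth *
    ∑ r ∈ Finset.Icc 1 (M + 1), ∑ ℓ ∈ indexSet L r,
      (-1) ^ lam ℓ M * zetaCoeff K θ ρ ℓ *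
        ∑ l ∈ Finset.range r,
          varrhoDeriv K ℓ r (r - 1 - l) / (((r - 1 - l).factorial : ℝ) * (l.factorial : ℝ)) *
            ∑ p ∈ Finset.range (l + 1),
              (l.choose p : ℝ) * (-1) ^ p * Real.log (baseConst K θ ρ γth) ^ (l - p) *
                (Real.log γ ^ p / γ)

/-- The leading-order term of the outage probability. -/
def riceLeading {M : ℕ} (K θ ρ : Fin (M + 1) → ℝ) (γth γ : ℝ) : ℝ :=
  ρ (Fin.last M) * γth / (M.factorial : ℝ) *
    (∏ n, (K n + 1) / (θ n * Real.exp (K n))) * (Real.log γ ^ M / γ)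

end MultihopRelay

end

open MeasureTheory ProbabilityTheory Filter Topology Asymptotics

noncomputable section

namespace MultihopRelay

/-! ### Bounds for the Gamma function -/

/-! The outage probability and the contour expression are treated separately and then compared.

The contour side. The Mellin transform of a Rician power density is, up to elementary factors, `Γ(s)
₁F₁(s, 1; K)` (`mellin_ricianPDF`), so the integrand continues meromorphically past the line `Re s =
1`. It decays on vertical lines faster than any power, and the contours may be moved right to `Re s
= 3/2`. Only the poles at 0 and 1 are crossed. The one at 0 occurs only for `ℓ = 0`, where its
residue cancels the leading `1`. The one at 1 has order at most the number `r` of vanishing partial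
sums `λ_0, …, λ_{N-1}`, which is the `r` with `ℓ ∈ 𝓛_r`. By the Leibniz rule its residue is the
summand of `S_L` (`iteratedDeriv_cpow_mul_varrhoC`). What remains on `Re s = 3/2` is `O(γ^{-3/2})`,
hence `I_L = S_L + o(1/γ)`.

The probability side. With `ε = γ_th/γ`, the outage event is `X_1 < ε ∑_n ρ_n / (X_2 ⋯ X_n)`.
Conditioning on the later hops gives `P_o = E F(ε ∑_n …)` with `F` the distribution function of
`X_1`. As the density of `X_1` is continuous and positive at 0, `F` is nearly additive near 0
(`exists_abs_ricianCDF_sum_sub_le`). Since `E F` of a single noise term is `P(X_1 ⋯ X_n < ρ_n ε)`,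
of order `(log γ)^{n-1}/γ`, only `n = N` and `n = N-1` matter, and `P_o = P(X_1 ⋯ X_N < ρ_N ε) +
P(X_1 ⋯ X_{N-1} < ρ_{N-1} ε) + o((log γ)^{N-2}/γ)` (`isLittleO_measureReal_snr_lt_sub`). By Mellin
inversion the first probability is exactly the contour expression with all `L_n = 1`
(`measureReal_prod_lt_eq_contourOutage`), and so is the second for the first `N-1` hops; the contour
analysis expands both.

The comparison. The index `ℓ = 0` alone yields the power `(log γ)^{N-1}`, which gives the leading
order of `P_o`, `I_L` and `S_L` at once. At the power `(log γ)^{N-2}` the only new index is `(0, …,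
0, 1)`: larger last entries are killed by the zero of `Γ(λ - s)/Γ(1 - s)` at `s = 1`. Its
contribution equals the leading term of the product of the first `N-1` hops
(`riceLeading_castSucc`), which is the second probability above. This gives the refined error when
all `L_n ≥ 2`. -/

lemma norm_Gamma_le {s : ℂ} (hs : 0 < s.re) : ‖Complex.Gamma s‖ ≤ Real.Gamma s.re := by
  rw [Complex.Gamma_eq_integral hs, Complex.GammaIntegral, Real.Gamma_eq_integral hs]
  refine (norm_integral_le_integral_norm _).trans (le_of_eq ?_)
  refine setIntegral_congr_fun measurableSet_Ioi fun x hx => ?_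
  simp only [norm_mul]
  rw [Complex.norm_of_nonneg (Real.exp_pos _).le, Complex.norm_cpow_eq_rpow_re_of_pos hx]
  simp

/-- Apply `Γ(s + 1) = s Γ(s)` `m` times, each time with `|s| ≥ |Im s|`. As `m` is free, this is
decay of any polynomial order, enough to move contours without Stirling's formula. -/
lemma norm_Gamma_le_div_pow (m : ℕ) {s : ℂ} (hs : 0 < s.re + m) (him : s.im ≠ 0) :
    ‖Complex.Gamma s‖ ≤ Real.Gamma (s.re + m) / |s.im| ^ m := by
  induction m generalizing s with
  | zero => simpa using norm_Gamma_le (s := s) (by simpa using hs)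
  | succ m ih =>
    have h0 : s ≠ 0 := fun h => him (by simp [h])
    have h1 := ih (s := s + 1) (by simpa [add_assoc, add_comm, add_left_comm] using hs)
      (by simpa using him)
    rw [Complex.Gamma_add_one s h0, norm_mul] at h1
    have h2 : |s.im| ≤ ‖s‖ := Complex.abs_im_le_norm s
    have h3 : 0 < |s.im| := abs_pos.mpr him
    have h4 : |s.im| * ‖Complex.Gamma s‖ ≤ Real.Gamma (s.re + 1 + m) / |s.im| ^ m := by
      refine (mul_le_mul_of_nonneg_right h2 (norm_nonneg _)).trans ?_
      simpa using h1
    rw [le_div_iff₀ (by positivity)] at h4 ⊢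
    calc _ = |s.im| * ‖Complex.Gamma s‖ * |s.im| ^ m := by ring
      _ ≤ _ := h4
      _ = _ := by push_cast; ring_nf

/-! ### The Kummer function with complex first argument -/

/-- The function `₁F₁(s, 1; K)`. -/
def kummerC (K : ℝ) (s : ℂ) : ℂ :=
  ∑' k : ℕ, (ascPochhammer ℂ k).eval s * ((K : ℂ) ^ k / ((k.factorial : ℂ)) ^ 2)

/-- The ratio of consecutive terms is `K (R + k) / (k + 1)²`, which tends to 0. The recursion on `a`
is shared by `Γ(σ + k)` and by the rising factorial of `R`. -/
lemma summable_pow_div_factorial_sq_mul_of_ratio {K : ℝ} (hK : 0 ≤ K) (R : ℝ) {a : ℕ → ℝ}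
    (ha : ∀ k, 0 < a k) (hrec : ∀ k : ℕ, a (k + 1) = (R + k) * a k) :
    Summable fun k : ℕ => K ^ k / ((k.factorial : ℝ)) ^ 2 * a k := by
  -- The ratio test needs nonzero terms, so `K = 0`, with a single nonzero term, is set apart.
  rcases hK.eq_or_lt with rfl | hK
  · refine summable_of_ne_finset_zero (s := {0}) fun k hk => ?_
    simp at hk
    simp [hk]
  refine summable_of_ratio_test_tendsto_lt_one (l := 0) one_pos
    (Eventually.of_forall fun k => ne_of_gt ?_) ?_
  · have := ha k
    positivity
  have h1 : ∀ k : ℕ, ‖K ^ (k + 1) / (((k + 1).factorial : ℝ)) ^ 2 * a (k + 1)‖ /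
      ‖K ^ k / ((k.factorial : ℝ)) ^ 2 * a k‖ =
      K * (((k : ℝ) + R) / ((k : ℝ) + 1)) * (1 / ((k : ℝ) + 1)) := by
    intro k
    have hak := ha k
    have hak' := ha (k + 1)
    rw [Real.norm_of_nonneg (by positivity), Real.norm_of_nonneg (by positivity), hrec,
      Nat.factorial_succ]
    push_cast
    field_simp
    ring
  simp_rw [h1]
  have h2 : Tendsto (fun k : ℕ => ((k : ℝ) + R) / ((k : ℝ) + 1)) atTop (𝓝 1) := by
    have h3 : Tendsto (fun k : ℕ => 1 + (R - 1) * (1 / ((k : ℝ) + 1))) atTop (𝓝 (1 + (R - 1) * 0)) :=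
      (tendsto_one_div_add_atTop_nhds_zero_nat.const_mul _).const_add _
    simp only [mul_zero, add_zero] at h3
    refine h3.congr fun k => ?_
    field_simp
    ring
  simpa using (h2.const_mul K).mul tendsto_one_div_add_atTop_nhds_zero_nat

lemma summable_Gamma_mul {K : ℝ} (hK : 0 ≤ K) {σ : ℝ} (hσ : 0 < σ) :
    Summable fun k : ℕ => K ^ k / ((k.factorial : ℝ)) ^ 2 * Real.Gamma (σ + k) := by
  refine summable_pow_div_factorial_sq_mul_of_ratio hK σ (fun k => Real.Gamma_pos_of_pos (by positivity))
    fun k => ?_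
  rw [← Real.Gamma_add_one (by positivity)]
  push_cast
  ring_nf

lemma norm_ascPochhammer_eval_le (k : ℕ) {s : ℂ} {R : ℝ} (hs : ‖s‖ ≤ R) :
    ‖(ascPochhammer ℂ k).eval s‖ ≤ (ascPochhammer ℝ k).eval R := by
  induction k with
  | zero => simp
  | succ k ih =>
    rw [ascPochhammer_succ_eval, ascPochhammer_succ_eval, norm_mul]
    have : ‖s + k‖ ≤ R + k := (norm_add_le _ _).trans (by simpa using hs)
    exact mul_le_mul ih this (norm_nonneg _) ((norm_nonneg _).trans ih)

lemma summable_ascPochhammer {K : ℝ} (hK : 0 ≤ K) {R : ℝ} (hR : 0 < R) :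
    Summable fun k : ℕ => K ^ k / ((k.factorial : ℝ)) ^ 2 * (ascPochhammer ℝ k).eval R := by
  refine summable_pow_div_factorial_sq_mul_of_ratio hK R (fun k => ascPochhammer_pos _ _ hR)
    fun k => ?_
  rw [ascPochhammer_succ_eval, mul_comm]

lemma norm_kummerC_term_le {K : ℝ} (hK : 0 ≤ K) (k : ℕ) {s : ℂ} {R : ℝ} (hs : ‖s‖ ≤ R) :
    ‖(ascPochhammer ℂ k).eval s * ((K : ℂ) ^ k / ((k.factorial : ℂ)) ^ 2)‖ ≤
      K ^ k / ((k.factorial : ℝ)) ^ 2 * (ascPochhammer ℝ k).eval R := by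
  rw [norm_mul, mul_comm, norm_div, norm_pow, norm_pow, Complex.norm_of_nonneg hK,
    Complex.norm_natCast]
  exact mul_le_mul_of_nonneg_left (norm_ascPochhammer_eval_le k hs) (by positivity)

/-- On a disc of radius `R` about 0 the terms are dominated by their values at the real point `R`,
so the series of polynomials converges uniformly there. -/
lemma differentiable_kummerC {K : ℝ} (hK : 0 ≤ K) : Differentiable ℂ (kummerC K) := by
  intro s
  have h : DifferentiableOn ℂ (kummerC K) (Metric.ball 0 (‖s‖ + 1)) := by
    refine Complex.differentiableOn_tsum_of_summable_norm
      (summable_ascPochhammer hK (R := ‖s‖ + 1) (by positivity)) (fun k => ?_) Metric.isOpen_ball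
      fun k w hw => norm_kummerC_term_le hK k ?_
    · exact ((Polynomial.differentiable _).mul_const _).differentiableOn
    · simpa using (Metric.mem_ball.mp hw).le
  exact h.differentiableAt (Metric.isOpen_ball.mem_nhds (by simp))

lemma kummerC_zero (K : ℝ) : kummerC K 0 = 1 := by
  rw [kummerC, tsum_eq_single 0]
  · simp
  · intro k hk
    rw [ascPochhammer_ne_zero_eval_zero _ hk, zero_mul]

lemma kummerC_one (K : ℝ) : kummerC K 1 = Complex.exp K := by
  rw [kummerC, Complex.exp_eq_exp_ℂ, NormedSpace.exp_eq_tsum_div]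
  refine tsum_congr fun k => ?_
  rw [ascPochhammer_eval_one]
  have : (k.factorial : ℂ) ≠ 0 := Nat.cast_ne_zero.mpr k.factorial_ne_zero
  field_simp

lemma ofReal_kummer (K a : ℝ) : ((kummer a 1 K : ℝ) : ℂ) = kummerC K a := by
  rw [kummer, kummerC, Complex.ofReal_tsum]
  refine tsum_congr fun k => ?_
  have h : (((ascPochhammer ℝ k).eval a : ℝ) : ℂ) = (ascPochhammer ℂ k).eval (a : ℂ) := by
    rw [← Complex.ofRealHom_eq_coe, ← Complex.ofRealHom_eq_coe, ← Polynomial.eval_map_apply,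
      ascPochhammer_map]
  rw [ascPochhammer_eval_one]
  push_cast
  rw [h]
  ring

/-- `Γ(s) ₁F₁(s, 1; K)`, the Mellin transform of a Rician power density up to normalization. -/
def gammaKummer (K : ℝ) (s : ℂ) : ℂ := Complex.Gamma s * kummerC K s

/-- Off the poles `Γ(s)` times the rising factorial of `s` is `Γ(s + k)`. The resulting series of
shifted Gammas can be estimated term by term. -/
lemma hasSum_gammaKummer {K : ℝ} (hK : 0 ≤ K) {s : ℂ} (hs : ∀ k : ℕ, s ≠ -k) :
    HasSum (fun k : ℕ => (K : ℂ) ^ k / ((k.factorial : ℂ)) ^ 2 * Complex.Gamma (s + k))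
      (gammaKummer K s) := by
  have h1 : Summable fun k : ℕ =>
      (ascPochhammer ℂ k).eval s * ((K : ℂ) ^ k / ((k.factorial : ℂ)) ^ 2) :=
    Summable.of_norm_bounded (summable_ascPochhammer hK (R := ‖s‖ + 1) (by positivity))
      fun k => norm_kummerC_term_le hK k (by linarith)
  have h2 := h1.hasSum.mul_left (Complex.Gamma s)
  rw [gammaKummer, kummerC]
  convert! h2 using 2 with k
  rw [← Complex.Gamma_add_nat_div_Gamma_eq s hs]
  have := Complex.Gamma_ne_zero hs
  field_simp

lemma differentiableAt_gammaKummer {K : ℝ} (hK : 0 ≤ K) {s : ℂ} (hs : 0 < s.re) :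
    DifferentiableAt ℂ (gammaKummer K) s := by
  refine DifferentiableAt.mul (Complex.differentiableAt_Gamma s fun k h => ?_)
    (differentiable_kummerC hK s)
  have : (0 : ℝ) ≤ k := k.cast_nonneg
  rw [h] at hs
  simp at hs
  linarith

lemma exists_norm_gammaKummer_le {K : ℝ} (hK : 0 ≤ K) (σ₁ σ₂ : ℝ) (m : ℕ) :
    ∃ C : ℝ, 0 ≤ C ∧ ∀ s : ℂ, σ₁ ≤ s.re → s.re ≤ σ₂ → 1 ≤ |s.im| →
      ‖gammaKummer K s‖ ≤ C / |s.im| ^ m := by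
  -- Extra shifts bring the real parts into `[2, ∞)`, where `Γ` is increasing and so bounded by its
  -- value at the right edge of the strip. Since `|Im s| ≥ 1`, the surplus decay may be thrown away.
  obtain ⟨m', hm'⟩ := exists_nat_ge (2 - σ₁)
  set p := m + m' with hp
  have hp2 : 2 ≤ σ₁ + p := by
    have : (0 : ℝ) ≤ m := m.cast_nonneg
    rw [hp]; push_cast; linarith
  by_cases h12 : σ₁ ≤ σ₂
  swap
  · exact ⟨0, le_rfl, fun s h1 h2 => absurd (h1.trans h2) h12⟩
  have hsum := summable_Gamma_mul hK (σ := σ₂ + p) (by linarith)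
  refine ⟨∑' k : ℕ, K ^ k / ((k.factorial : ℝ)) ^ 2 * Real.Gamma (σ₂ + p + k),
    tsum_nonneg fun k : ℕ => ?_, fun s h1 h2 h3 => ?_⟩
  · exact mul_nonneg (by positivity) (Real.Gamma_nonneg_of_nonneg (by
      have : (0 : ℝ) ≤ k := k.cast_nonneg
      linarith))
  have him : s.im ≠ 0 := fun h => by rw [h] at h3; norm_num at h3
  have hne : ∀ k : ℕ, s ≠ -k := fun k h => him (by simp [h])
  rw [← (hasSum_gammaKummer hK hne).tsum_eq]
  have hpos : 0 < |s.im| := by linarith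
  have hb : ∀ k : ℕ, ‖(K : ℂ) ^ k / ((k.factorial : ℂ)) ^ 2 * Complex.Gamma (s + k)‖ ≤
      K ^ k / ((k.factorial : ℝ)) ^ 2 * Real.Gamma (σ₂ + p + k) / |s.im| ^ m := by
    intro k
    have hk0 : (0 : ℝ) ≤ k := k.cast_nonneg
    rw [norm_mul, norm_div, norm_pow, norm_pow, Complex.norm_of_nonneg hK, Complex.norm_natCast,
      mul_div_assoc]
    refine mul_le_mul_of_nonneg_left ?_ (by positivity)
    have h4 := norm_Gamma_le_div_pow p (s := s + k) (by simp; linarith) (by simpa using him)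
    refine h4.trans ?_
    have h5 : Real.Gamma ((s + k).re + p) ≤ Real.Gamma (σ₂ + p + k) :=
      Real.Gamma_strictMonoOn_Ici.monotoneOn (by simp; linarith) (by simp; linarith)
        (by simp; linarith)
    have h6 : |s.im| ^ m ≤ |(s + k).im| ^ p := by
      simpa using pow_le_pow_right₀ h3 (by omega : m ≤ p)
    exact div_le_div₀ (Real.Gamma_nonneg_of_nonneg (by linarith)) h5 (by positivity) h6
  rw [← tsum_div_const]
  exact tsum_of_norm_bounded (hsum.div_const _).hasSum hb

/-! ### The Mellin transform of the Rician density -/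

lemma ricianPDF_nonneg {K θ : ℝ} (hK : 0 ≤ K) (hθ : 0 < θ) (x : ℝ) : 0 ≤ ricianPDF K θ x := by
  unfold ricianPDF
  split_ifs
  · refine mul_nonneg (by positivity) (tsum_nonneg fun k => ?_)
    positivity
  · exact le_rfl

lemma hasSum_besselI0 (y : ℝ) :
    HasSum (fun k : ℕ => (y / 2) ^ (2 * k) / ((k.factorial : ℝ)) ^ 2) (besselI0 y) := by
  refine Summable.hasSum ?_
  refine Summable.of_nonneg_of_le (fun k => ?_) (fun k => ?_)
    (Real.summable_pow_div_factorial ((y / 2) ^ 2))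
  · rw [pow_mul]; positivity
  rw [pow_mul]
  have h1 : (1 : ℝ) ≤ k.factorial := by exact_mod_cast k.factorial_pos
  refine div_le_div_of_nonneg_left (by positivity) (by positivity) ?_
  nlinarith

/-- The Bessel series exhibits the law as a Poisson(`K`) mixture of Gamma laws of shape `k + 1` and
rate `(K + 1)/θ`. -/
lemma hasSum_ricianPDF {K θ x : ℝ} (hK : 0 ≤ K) (hθ : 0 < θ) (hx : 0 ≤ x) :
    HasSum (fun k : ℕ => Real.exp (-K) * ((K + 1) / θ) * (K ^ k / ((k.factorial : ℝ)) ^ 2) *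
      ((K + 1) / θ * x) ^ k * Real.exp (-((K + 1) / θ * x))) (ricianPDF K θ x) := by
  have h := (hasSum_besselI0 (Real.sqrt (4 * K * (K + 1) * x / θ))).mul_left
    (θ⁻¹ * (K + 1) * Real.exp (-(K + θ⁻¹ * (K + 1) * x)))
  rw [ricianPDF, if_pos hx]
  convert! h using 2 with k
  rw [pow_mul, div_pow, Real.sq_sqrt (by positivity), neg_add, Real.exp_add,
    show 4 * K * (K + 1) * x / θ / 2 ^ 2 = K * ((K + 1) / θ * x) by ring, mul_pow K,
    show θ⁻¹ * (K + 1) = (K + 1) / θ by ring]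
  ring

lemma continuous_besselI0 : Continuous besselI0 := by
  refine continuous_iff_continuousAt.mpr fun y => ?_
  have h : ContinuousOn besselI0 (Metric.ball 0 (|y| + 1)) := by
    refine continuousOn_tsum (fun k => by fun_prop)
      (hasSum_besselI0 (|y| + 1)).summable fun k x hx => ?_
    rw [Real.norm_of_nonneg (by rw [pow_mul]; positivity), pow_mul, pow_mul]
    have h1 : |x| ≤ |y| + 1 := by simpa using (Metric.mem_ball.mp hx).le
    have h2 : (x / 2) ^ 2 ≤ ((|y| + 1) / 2) ^ 2 := by nlinarith [abs_nonneg x, sq_abs x]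
    gcongr
  exact h.continuousAt (Metric.isOpen_ball.mem_nhds (by simp))

lemma continuousOn_ricianPDF (K θ : ℝ) : ContinuousOn (ricianPDF K θ) (Set.Ici 0) := by
  have h : ContinuousOn (fun x => θ⁻¹ * (K + 1) * Real.exp (-(K + θ⁻¹ * (K + 1) * x)) *
      besselI0 (Real.sqrt (4 * K * (K + 1) * x / θ))) (Set.Ici 0) := by
    refine Continuous.continuousOn (Continuous.mul (by fun_prop) (continuous_besselI0.comp ?_))
    fun_prop
  exact h.congr fun x hx => by rw [ricianPDF, if_pos (Set.mem_Ici.mp hx)]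

lemma measurable_ricianPDF (K θ : ℝ) : Measurable (ricianPDF K θ) := by
  refine Measurable.ite measurableSet_Ici ?_ measurable_const
  refine Measurable.mul (by fun_prop) (continuous_besselI0.measurable.comp ?_)
  fun_prop

lemma gammaKummer_ofReal_ne_zero {K : ℝ} (hK : 0 ≤ K) {σ : ℝ} (hσ : 0 < σ) :
    gammaKummer K σ ≠ 0 := by
  have h := hasSum_gammaKummer hK (s := σ) (fun k hk => by
    have h1 := congrArg Complex.re hk
    have : (0 : ℝ) ≤ k := k.cast_nonneg
    simp at h1
    linarith)
  have hr := (summable_Gamma_mul hK hσ).hasSum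
  have hpos : 0 < ∑' k : ℕ, K ^ k / ((k.factorial : ℝ)) ^ 2 * Real.Gamma (σ + k) := by
    refine (summable_Gamma_mul hK hσ).tsum_pos (fun k => ?_) 0 ?_
    · have := Real.Gamma_pos_of_pos (s := σ + k) (by positivity)
      positivity
    · simpa using Real.Gamma_pos_of_pos hσ
  have h2 := Complex.hasSum_ofReal.mpr hr
  have h3 := h2.unique (by
    convert! h using 2 with k
    push_cast
    rw [← Complex.Gamma_ofReal]
    push_cast
    rfl)
  rw [← h3]
  exact_mod_cast hpos.ne'

/-- Integrate the Gamma mixture term by term: each term gives a shifted Gamma value, and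
`hasSum_gammaKummer` sums them. The interchange is justified by the same computation at `Re s`. -/
lemma mellin_ricianPDF {K θ : ℝ} (hK : 0 ≤ K) (hθ : 0 < θ) {s : ℂ} (hs : 0 < s.re) :
    mellin (fun x => (ricianPDF K θ x : ℂ)) s =
      Complex.exp (-K) * (((K + 1) / θ : ℝ) : ℂ) ^ (1 - s) * gammaKummer K s := by
  set b : ℝ := (K + 1) / θ with hb
  have hb0 : 0 < b := by positivity
  set c : ℕ → ℝ := fun k => Real.exp (-K) * b ^ (k + 1) * (K ^ k / ((k.factorial : ℝ)) ^ 2) with hc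
  have hc0 : ∀ k, 0 ≤ c k := fun k => by positivity
  set F : ℕ → ℝ → ℂ := fun k x =>
    (c k : ℂ) * ((x : ℂ) ^ ((s + k) - 1) * Complex.exp (-(b * x))) with hF
  have hre : ∀ k : ℕ, 0 < (s + k).re := fun k => by simp; positivity
  have hval : ∀ k, ∫ x in Set.Ioi (0 : ℝ), F k x =
      Complex.exp (-K) * (b : ℂ) ^ (1 - s) *
        ((K : ℂ) ^ k / ((k.factorial : ℂ)) ^ 2 * Complex.Gamma (s + k)) := by
    intro k
    have hbne : (b : ℂ) ≠ 0 := by exact_mod_cast hb0.ne'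
    rw [integral_const_mul, Complex.integral_cpow_mul_exp_neg_mul_Ioi (hre k) hb0]
    have h1 : (1 / (b : ℂ)) ^ (s + k) = (b : ℂ) ^ (1 - s) * ((b : ℂ) ^ (k + 1))⁻¹ := by
      rw [one_div, Complex.inv_cpow _ _ (by
        rw [Complex.arg_ofReal_of_nonneg hb0.le]; exact Real.pi_pos.ne), ← Complex.cpow_neg,
        ← Complex.cpow_natCast, ← Complex.cpow_neg, ← Complex.cpow_add _ _ hbne]
      congr 1
      push_cast
      ring
    have h2 : (b : ℂ) ^ (k + 1) ≠ 0 := pow_ne_zero _ hbne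
    rw [h1]
    simp only [hc]
    push_cast
    field_simp
  have hnorm : ∀ k, ∀ x ∈ Set.Ioi (0 : ℝ),
      ‖F k x‖ = c k * (x ^ ((s.re + k) - 1) * Real.exp (-(b * x))) := by
    intro k x hx
    simp only [hF, norm_mul]
    rw [Complex.norm_of_nonneg (hc0 k), Complex.norm_cpow_eq_rpow_re_of_pos hx, Complex.norm_exp]
    simp
  have hnint : ∀ k, ∫ x in Set.Ioi (0 : ℝ), ‖F k x‖ =
      Real.exp (-K) * b ^ (1 - s.re) *
        (K ^ k / ((k.factorial : ℝ)) ^ 2 * Real.Gamma (s.re + k)) := by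
    intro k
    rw [setIntegral_congr_fun measurableSet_Ioi (hnorm k), integral_const_mul,
      Real.integral_rpow_mul_exp_neg_mul_Ioi (by positivity) hb0]
    have h1 : (1 / b) ^ (s.re + k) = b ^ (1 - s.re) * (b ^ (k + 1))⁻¹ := by
      rw [one_div, Real.inv_rpow hb0.le, ← Real.rpow_neg hb0.le, ← Real.rpow_natCast,
        ← Real.rpow_neg hb0.le, ← Real.rpow_add hb0]
      congr 1
      push_cast
      ring
    rw [h1]
    simp only [hc]
    field_simp
  have hint : ∀ k, IntegrableOn (F k) (Set.Ioi 0) := by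
    intro k
    by_cases hck : c k = 0
    · simp only [hF, hck]
      simp
    -- The integral of a non-integrable function is 0 by convention, so the nonzero value
    -- `b^{-(s+k)} Γ(s + k)` proves integrability.
    refine Integrable.const_mul (Integrable.of_integral_ne_zero ?_) _
    rw [Complex.integral_cpow_mul_exp_neg_mul_Ioi (hre k) hb0]
    refine mul_ne_zero ?_ (Complex.Gamma_ne_zero_of_re_pos (hre k))
    have hbne : (b : ℂ) ≠ 0 := by exact_mod_cast hb0.ne'
    simp [Complex.cpow_eq_zero_iff, hbne]
  have hsumm : Summable fun k => ∫ x in Set.Ioi (0 : ℝ), ‖F k x‖ := by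
    simp_rw [hnint]
    exact (summable_Gamma_mul hK hs).mul_left _
  have h := hasSum_integral_of_summable_integral_norm hint hsumm
  have hne : ∀ k : ℕ, s ≠ -k := fun k hk => by
    have h1 := congrArg Complex.re hk
    have : (0 : ℝ) ≤ k := k.cast_nonneg
    simp at h1
    linarith
  have h' := (hasSum_gammaKummer hK hne).mul_left (Complex.exp (-K) * (b : ℂ) ^ (1 - s))
  simp_rw [hval] at h
  rw [← h.unique h', mellin]
  refine setIntegral_congr_fun measurableSet_Ioi fun x hx => ?_
  have hx0 : (0 : ℝ) < x := hx
  have h3 := (Complex.hasSum_ofReal.mpr (hasSum_ricianPDF hK hθ hx0.le)).mul_left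
    ((x : ℂ) ^ (s - 1))
  simp only [smul_eq_mul]
  rw [← h3.tsum_eq]
  refine tsum_congr fun k => ?_
  have hxne : (x : ℂ) ≠ 0 := by exact_mod_cast hx0.ne'
  simp only [hF, hc]
  rw [show s + k - 1 = (s - 1) + k by ring, Complex.cpow_add _ _ hxne, Complex.cpow_natCast]
  rw [← hb]
  push_cast
  ring

/-! ### Residues through rectangles -/

/-- The boundary integral of `F` over the rectangle `[c₁, c₂] × [-T, T]`. -/
def rectIntegral (F : ℂ → ℂ) (c₁ c₂ T : ℝ) : ℂ :=
  (∫ x in c₁..c₂, F (x + (-T : ℝ) * Complex.I)) - (∫ x in c₁..c₂, F (x + T * Complex.I)) +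
    Complex.I • (∫ y in (-T)..T, F (c₂ + y * Complex.I)) -
    Complex.I • ∫ y in (-T)..T, F (c₁ + y * Complex.I)

/-- The boundary of the rectangle `[c₁, c₂] × [-T, T]`. -/
def rectBoundary (c₁ c₂ T : ℝ) : Set ℂ :=
  {s | (s.re ∈ Set.uIcc c₁ c₂ ∧ (s.im = -T ∨ s.im = T)) ∨
    ((s.re = c₂ ∨ s.re = c₁) ∧ s.im ∈ Set.uIcc (-T) T)}

lemma horizontal_mem_rectBoundary {c₁ c₂ T x y : ℝ} (hx : x ∈ Set.uIcc c₁ c₂)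
    (hy : y = -T ∨ y = T) : (x : ℂ) + y * Complex.I ∈ rectBoundary c₁ c₂ T :=
  Or.inl ⟨by simpa using hx, by simpa using hy⟩

lemma vertical_mem_rectBoundary {c₁ c₂ T x y : ℝ} (hy : y ∈ Set.uIcc (-T) T)
    (hx : x = c₂ ∨ x = c₁) : (x : ℂ) + y * Complex.I ∈ rectBoundary c₁ c₂ T :=
  Or.inr ⟨by simpa using hx, by simpa using hy⟩

lemma rectIntegral_congr {F G : ℂ → ℂ} {c₁ c₂ T : ℝ}
    (h : Set.EqOn F G (rectBoundary c₁ c₂ T)) :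
    rectIntegral F c₁ c₂ T = rectIntegral G c₁ c₂ T := by
  unfold rectIntegral
  congr 1
  · congr 1
    · congr 1
      · exact intervalIntegral.integral_congr fun x hx =>
          h (horizontal_mem_rectBoundary hx (Or.inl rfl))
      · exact intervalIntegral.integral_congr fun x hx =>
          h (horizontal_mem_rectBoundary hx (Or.inr rfl))
    · congr 1
      exact intervalIntegral.integral_congr fun x hx =>
          h (vertical_mem_rectBoundary hx (Or.inl rfl))
  · congr 1
    exact intervalIntegral.integral_congr fun x hx =>
          h (vertical_mem_rectBoundary hx (Or.inr rfl))

lemma intervalIntegrable_horizontal {F : ℂ → ℂ} {c₁ c₂ T y : ℝ}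
    (hF : ContinuousOn F (rectBoundary c₁ c₂ T)) (hy : y = -T ∨ y = T) :
    IntervalIntegrable (fun x : ℝ => F (x + y * Complex.I)) volume c₁ c₂ :=
  (hF.comp (by fun_prop) fun _ hx => horizontal_mem_rectBoundary hx hy).intervalIntegrable

lemma intervalIntegrable_vertical {F : ℂ → ℂ} {c₁ c₂ T x : ℝ}
    (hF : ContinuousOn F (rectBoundary c₁ c₂ T)) (hx : x = c₂ ∨ x = c₁) :
    IntervalIntegrable (fun y : ℝ => F (x + y * Complex.I)) volume (-T) T :=
  (hF.comp (by fun_prop) fun _ hy => vertical_mem_rectBoundary hy hx).intervalIntegrable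

lemma rectIntegral_add {F G : ℂ → ℂ} {c₁ c₂ T : ℝ} (hF : ContinuousOn F (rectBoundary c₁ c₂ T))
    (hG : ContinuousOn G (rectBoundary c₁ c₂ T)) :
    rectIntegral (fun s => F s + G s) c₁ c₂ T = rectIntegral F c₁ c₂ T + rectIntegral G c₁ c₂ T := by
  unfold rectIntegral
  rw [intervalIntegral.integral_add (intervalIntegrable_horizontal hF (Or.inl rfl))
      (intervalIntegrable_horizontal hG (Or.inl rfl)),
    intervalIntegral.integral_add (intervalIntegrable_horizontal hF (Or.inr rfl))
      (intervalIntegrable_horizontal hG (Or.inr rfl)),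
    intervalIntegral.integral_add (intervalIntegrable_vertical hF (Or.inl rfl))
      (intervalIntegrable_vertical hG (Or.inl rfl)),
    intervalIntegral.integral_add (intervalIntegrable_vertical hF (Or.inr rfl))
      (intervalIntegrable_vertical hG (Or.inr rfl))]
  simp only [smul_eq_mul]
  ring

lemma rectIntegral_const_mul (a : ℂ) (F : ℂ → ℂ) (c₁ c₂ T : ℝ) :
    rectIntegral (fun s => a * F s) c₁ c₂ T = a * rectIntegral F c₁ c₂ T := by
  unfold rectIntegral
  simp only [intervalIntegral.integral_const_mul, smul_eq_mul]
  ring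

lemma integral_horizontal_eq_sub {F G : ℂ → ℂ} {a b y : ℝ}
    (hG : ∀ x ∈ Set.uIcc a b, HasDerivAt G (F (x + y * Complex.I)) (x + y * Complex.I))
    (hF : IntervalIntegrable (fun x : ℝ => F (x + y * Complex.I)) volume a b) :
    ∫ x in a..b, F (x + y * Complex.I) = G (b + y * Complex.I) - G (a + y * Complex.I) := by
  refine intervalIntegral.integral_eq_sub_of_hasDerivAt
    (f := fun x : ℝ => G (x + y * Complex.I)) (fun x hx => ?_) hF
  have h1 : HasDerivAt (fun z : ℂ => z + y * Complex.I) 1 (x : ℂ) :=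
    (hasDerivAt_id _).add_const _
  simpa using ((hG x hx).comp (x : ℂ) h1).comp_ofReal

lemma integral_vertical_eq_sub {F G : ℂ → ℂ} {a b c : ℝ}
    (hG : ∀ y ∈ Set.uIcc a b, HasDerivAt G (F (c + y * Complex.I)) (c + y * Complex.I))
    (hF : IntervalIntegrable (fun y : ℝ => F (c + y * Complex.I)) volume a b) :
    Complex.I • ∫ y in a..b, F (c + y * Complex.I) =
      G (c + b * Complex.I) - G (c + a * Complex.I) := by
  rw [← intervalIntegral.integral_smul]
  refine intervalIntegral.integral_eq_sub_of_hasDerivAt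
    (f := fun y : ℝ => G (c + y * Complex.I)) (fun y hy => ?_) (hF.continuousOn_smul continuousOn_const)
  have h1 : HasDerivAt (fun z : ℂ => c + z * Complex.I) Complex.I (y : ℂ) := by
    simpa using ((hasDerivAt_id (y : ℂ)).mul_const Complex.I).const_add (c : ℂ)
  simpa [mul_comm] using ((hG y hy).comp (y : ℂ) h1).comp_ofReal

lemma ne_of_mem_rectBoundary {c₁ c₂ T p : ℝ} (h1 : c₁ < p) (h2 : p < c₂) (hT : 0 < T) {s : ℂ}
    (hs : s ∈ rectBoundary c₁ c₂ T) : s ≠ p := by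
  rintro rfl
  rcases hs with ⟨-, h | h⟩ | ⟨h | h, -⟩ <;> simp at h <;> linarith

lemma continuousOn_inv_pow_rectBoundary {c₁ c₂ T p : ℝ} (h1 : c₁ < p) (h2 : p < c₂) (hT : 0 < T)
    (r : ℕ) : ContinuousOn (fun s : ℂ => ((s - p) ^ r)⁻¹) (rectBoundary c₁ c₂ T) := by
  refine ContinuousOn.inv₀ (by fun_prop) fun s hs => pow_ne_zero _ (sub_ne_zero.mpr ?_)
  exact ne_of_mem_rectBoundary h1 h2 hT hs

/-- Exponents at least 2 leave a single-valued primitive on the whole boundary, so the four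
increments telescope. -/
lemma rectIntegral_inv_pow_eq_zero {c₁ c₂ T p : ℝ} (h1 : c₁ < p) (h2 : p < c₂) (hT : 0 < T)
    (r : ℕ) : rectIntegral (fun s : ℂ => ((s - p) ^ (r + 2))⁻¹) c₁ c₂ T = 0 := by
  have hd : ∀ s ∈ rectBoundary c₁ c₂ T,
      HasDerivAt (fun s : ℂ => -((r + 1 : ℂ))⁻¹ * ((s - p) ^ (r + 1))⁻¹) (((s - p) ^ (r + 2))⁻¹) s := by
    intro s hs
    have hne : s - p ≠ 0 := sub_ne_zero.mpr (ne_of_mem_rectBoundary h1 h2 hT hs)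
    have h3 := ((((hasDerivAt_id s).sub_const (p : ℂ)).pow (r + 1)).inv
      (pow_ne_zero _ hne)).const_mul (-((r + 1 : ℂ))⁻¹)
    refine h3.congr_deriv ?_
    have hr : (r + 1 : ℂ) ≠ 0 := by exact_mod_cast Nat.succ_ne_zero r
    simp
    field_simp
    ring
  have hc := continuousOn_inv_pow_rectBoundary h1 h2 hT (r + 2)
  unfold rectIntegral
  rw [integral_horizontal_eq_sub (fun x hx => hd _ (horizontal_mem_rectBoundary hx (Or.inl rfl)))
      (intervalIntegrable_horizontal hc (Or.inl rfl)),
    integral_horizontal_eq_sub (fun x hx => hd _ (horizontal_mem_rectBoundary hx (Or.inr rfl)))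
      (intervalIntegrable_horizontal hc (Or.inr rfl)),
    integral_vertical_eq_sub (fun x hx => hd _ (vertical_mem_rectBoundary hx (Or.inl rfl)))
      (intervalIntegrable_vertical hc (Or.inl rfl)),
    integral_vertical_eq_sub (fun x hx => hd _ (vertical_mem_rectBoundary hx (Or.inr rfl)))
      (intervalIntegrable_vertical hc (Or.inr rfl))]
  ring

lemma log_sub_log_neg_of_im_pos {z : ℂ} (hz : 0 < z.im) :
    Complex.log z - Complex.log (-z) = Real.pi * Complex.I := by
  rw [Complex.log, Complex.log, Complex.arg_neg_eq_arg_sub_pi_of_im_pos hz, norm_neg]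
  push_cast
  ring

lemma log_sub_log_neg_of_im_neg {z : ℂ} (hz : z.im < 0) :
    Complex.log z - Complex.log (-z) = -(Real.pi * Complex.I) := by
  rw [Complex.log, Complex.log, Complex.arg_neg_eq_arg_add_pi_of_im_neg hz, norm_neg]
  push_cast
  ring

/-- `log (s - p)` is a primitive along the bottom, top and right sides. The left side crosses its
cut, so `log (p - s)` serves there. The two primitives differ by `±πi` at the left corners, which
adds up to `2πi`. -/
lemma rectIntegral_inv {c₁ c₂ T p : ℝ} (h1 : c₁ < p) (h2 : p < c₂) (hT : 0 < T) :
    rectIntegral (fun s : ℂ => ((s - p) ^ 1)⁻¹) c₁ c₂ T = 2 * Real.pi * Complex.I := by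
  have hd : ∀ s : ℂ, s - p ∈ Complex.slitPlane →
      HasDerivAt (fun s : ℂ => Complex.log (s - p)) (((s - p) ^ 1)⁻¹) s := by
    intro s hs
    simpa using ((hasDerivAt_id s).sub_const (p : ℂ)).clog hs
  have hd' : ∀ s : ℂ, p - s ∈ Complex.slitPlane →
      HasDerivAt (fun s : ℂ => Complex.log (p - s)) (((s - p) ^ 1)⁻¹) s := by
    intro s hs
    have h3 := ((hasDerivAt_id s).const_sub (p : ℂ)).clog hs
    refine h3.congr_deriv ?_
    rw [pow_one, ← neg_sub (p : ℂ) s, inv_neg, id, neg_div, one_div]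
  have hc := continuousOn_inv_pow_rectBoundary h1 h2 hT 1
  unfold rectIntegral
  rw [integral_horizontal_eq_sub (fun x hx => hd _ (Or.inr (by simp; linarith)))
      (intervalIntegrable_horizontal hc (Or.inl rfl)),
    integral_horizontal_eq_sub (fun x hx => hd _ (Or.inr (by simp; linarith)))
      (intervalIntegrable_horizontal hc (Or.inr rfl)),
    integral_vertical_eq_sub (fun x hx => hd _ (Or.inl (by simp; linarith)))
      (intervalIntegrable_vertical hc (Or.inl rfl)),
    integral_vertical_eq_sub (fun x hx => hd' _ (Or.inl (by simp; linarith)))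
      (intervalIntegrable_vertical hc (Or.inr rfl))]
  have e1 := log_sub_log_neg_of_im_pos (z := c₁ + T * Complex.I - p) (by simpa using hT)
  have e2 := log_sub_log_neg_of_im_neg (z := c₁ + (-T : ℝ) * Complex.I - p) (by simpa using hT)
  rw [neg_sub] at e1 e2
  linear_combination e1 - e2

lemma rectIntegral_eq_zero {F : ℂ → ℂ} {c₁ c₂ T : ℝ}
    (hF : DifferentiableOn ℂ F {s | s.re ∈ Set.uIcc c₁ c₂ ∧ s.im ∈ Set.uIcc (-T) T}) :
    rectIntegral F c₁ c₂ T = 0 := by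
  have h := Complex.integral_boundary_rect_eq_zero_of_differentiableOn F
    (c₁ + (-T : ℝ) * Complex.I) (c₂ + T * Complex.I) (by
      refine hF.mono fun s hs => ?_
      simpa [Complex.mem_reProdIm] using hs)
  simpa [rectIntegral] using h

/-- Write `h(s) = h(p) + (s - p) · dslope h p s`: the first part is an explicit power of `s - p`,
the second has a pole of order one less, and `dslope h p` is again holomorphic on `U`. Induction on
`r` iterates this. -/
lemma rectIntegral_div_pow {c₁ c₂ T p : ℝ} (h1 : c₁ < p) (h2 : p < c₂) (hT : 0 < T)
    {U : Set ℂ} (hU : IsOpen U)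
    (hUr : ∀ s : ℂ, s.re ∈ Set.uIcc c₁ c₂ → s ∈ U) (r : ℕ) {h : ℂ → ℂ}
    (hh : DifferentiableOn ℂ h U) :
    rectIntegral (fun s => h s / (s - p) ^ (r + 1)) c₁ c₂ T =
      2 * Real.pi * Complex.I * ((Function.swap dslope (p : ℂ))^[r] h) p := by
  have hpU : U ∈ 𝓝 (p : ℂ) :=
    hU.mem_nhds (hUr _ (by simpa using Set.mem_uIcc_of_le h1.le h2.le))
  have hbU : rectBoundary c₁ c₂ T ⊆ U := by
    rintro s (⟨hs, -⟩ | ⟨hs | hs, -⟩)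
    · exact hUr s hs
    · exact hUr s (by rw [hs]; exact Set.right_mem_uIcc)
    · exact hUr s (by rw [hs]; exact Set.left_mem_uIcc)
  induction r generalizing h with
  | zero =>
    have hd : DifferentiableOn ℂ (dslope h p) U := (Complex.differentiableOn_dslope hpU).mpr hh
    rw [rectIntegral_congr (G := fun s => h p * ((s - p) ^ 1)⁻¹ + dslope h p s)]
    · rw [rectIntegral_add (F := fun s => h p * ((s - p) ^ 1)⁻¹) (continuousOn_const.mul (continuousOn_inv_pow_rectBoundary h1 h2 hT 1))
        (hd.continuousOn.mono hbU), rectIntegral_const_mul, rectIntegral_inv h1 h2 hT,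
        rectIntegral_eq_zero (hd.mono fun s hs => hUr s hs.1)]
      simp [mul_comm]
    · intro s hs
      have hne := ne_of_mem_rectBoundary h1 h2 hT hs
      have hne' : s - p ≠ 0 := sub_ne_zero.mpr hne
      simp only [dslope_of_ne _ hne, slope_def_field]
      field_simp
      ring
  | succ r ih =>
    have hd : DifferentiableOn ℂ (dslope h p) U := (Complex.differentiableOn_dslope hpU).mpr hh
    rw [rectIntegral_congr (G := fun s => h p * ((s - p) ^ (r + 2))⁻¹ +
      dslope h p s / (s - p) ^ (r + 1))]
    · rw [rectIntegral_add (F := fun s => h p * ((s - p) ^ (r + 2))⁻¹)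
        (continuousOn_const.mul (continuousOn_inv_pow_rectBoundary h1 h2 hT (r + 2))) ?_,
        rectIntegral_const_mul, rectIntegral_inv_pow_eq_zero h1 h2 hT, ih hd,
        Function.iterate_succ_apply]
      · simp [Function.swap]
      · simp only [div_eq_mul_inv]
        exact (hd.continuousOn.mono hbU).mul (continuousOn_inv_pow_rectBoundary h1 h2 hT (r + 1))
    · intro s hs
      have hne := ne_of_mem_rectBoundary h1 h2 hT hs
      have hne' : s - p ≠ 0 := sub_ne_zero.mpr hne
      simp only [dslope_of_ne _ hne, slope_def_field]
      field_simp
      ring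

/-- Each `dslope` drops the lowest Taylor coefficient, so `r` of them leave the `r`-th one as value
at `p`. -/
lemma iterate_dslope_eq_iteratedDeriv_div {h : ℂ → ℂ} {p : ℂ} (hh : AnalyticAt ℂ h p) (r : ℕ) :
    ((Function.swap dslope p)^[r] h) p = iteratedDeriv r h p / r.factorial := by
  have h1 := (hh.hasFPowerSeriesAt).has_fpower_series_iterate_dslope_fslope r
  rw [← h1.coeff_zero 1]
  have h2 := FormalMultilinearSeries.coeff_iterate_fslope (p := FormalMultilinearSeries.ofScalars ℂ (fun n => iteratedDeriv n h p / (n.factorial : ℂ))) r 0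
  rw [FormalMultilinearSeries.coeff] at h2
  convert! h2 using 1
  simp

/-! ### Integrals along vertical lines -/

lemma integrable_of_norm_le_div_sq {f : ℝ → ℂ} (hf : Continuous f) {C : ℝ}
    (hC : ∀ t : ℝ, 1 ≤ |t| → ‖f t‖ ≤ C / |t| ^ 2) : Integrable f := by
  obtain ⟨B, hB⟩ := (isCompact_Icc (a := (-1 : ℝ)) (b := 1)).exists_bound_of_continuousOn
    hf.continuousOn
  have hC0 : 0 ≤ C := by simpa using (norm_nonneg _).trans (hC 1 (by simp))
  have hB0 : 0 ≤ B := (norm_nonneg _).trans (hB 0 (by simp))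
  -- The factor 2 comes from `1 + t² ≤ 2` for `|t| ≤ 1` and `1 + t² ≤ 2t²` beyond.
  refine Integrable.mono' (integrable_inv_one_add_sq.const_mul (2 * (B + C)))
    hf.aestronglyMeasurable (ae_of_all _ fun t => ?_)
  have hpos : 0 < 1 + t ^ 2 := by positivity
  rw [← div_eq_mul_inv, le_div_iff₀ hpos]
  rcases le_total |t| 1 with ht | ht
  · have h1 := hB t (abs_le.mp ht)
    have h2 : t ^ 2 ≤ 1 := by rw [← sq_abs]; nlinarith [abs_nonneg t]
    nlinarith [norm_nonneg (f t)]
  · have h1 := hC t ht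
    have h2 : 1 ≤ t ^ 2 := by rw [← sq_abs]; nlinarith
    rw [sq_abs, le_div_iff₀ (by positivity)] at h1
    nlinarith [norm_nonneg (f t)]

lemma tendsto_integral_horizontal {F : ℂ → ℂ} {c₁ c₂ C : ℝ} (hc : c₁ ≤ c₂)
    (hdec : ∀ s : ℂ, c₁ ≤ s.re → s.re ≤ c₂ → 1 ≤ |s.im| → ‖F s‖ ≤ C / |s.im| ^ 2)
    {u : ℝ → ℝ} (hu : ∀ T, |u T| = |T|) :
    Tendsto (fun T : ℝ => ∫ x in c₁..c₂, F (x + u T * Complex.I)) atTop (𝓝 0) := by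
  have h1 : Tendsto (fun T : ℝ => C / T ^ 2 * |c₂ - c₁|) atTop (𝓝 0) := by
    have := (tendsto_const_nhds (x := C)).div_atTop (tendsto_pow_atTop (α := ℝ) two_ne_zero)
    simpa using this.mul_const |c₂ - c₁|
  refine squeeze_zero_norm' ?_ h1
  filter_upwards [eventually_ge_atTop 1] with T hT
  have hT' : |T| = T := abs_of_pos (by linarith)
  refine intervalIntegral.norm_integral_le_of_norm_le_const fun x hx => ?_
  rw [Set.uIoc_of_le hc] at hx
  have := hdec (x + u T * Complex.I) (by simpa using hx.1.le) (by simpa using hx.2)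
    (by simpa [hu, hT'] using hT)
  simpa [hu, hT'] using this

/-- The residue theorem on a strip: let the height of a rectangle tend to infinity, the horizontal
sides vanishing by the decay of `F`. The formula for `F` is asked only off `p`, where division by
zero would give a meaningless value. -/
lemma verticalIntegral_sub_verticalIntegral {F h : ℂ → ℂ} {c₁ c₂ p C : ℝ} (h1 : c₁ < p) (h2 : p < c₂)
    {U : Set ℂ} (hU : IsOpen U) (hUr : ∀ s : ℂ, c₁ ≤ s.re → s.re ≤ c₂ → s ∈ U)
    (hh : DifferentiableOn ℂ h U) (r : ℕ)
    (hF : ∀ s ∈ U, s ≠ p → F s = h s / (s - p) ^ (r + 1))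
    (hdec : ∀ s : ℂ, c₁ ≤ s.re → s.re ≤ c₂ → 1 ≤ |s.im| → ‖F s‖ ≤ C / |s.im| ^ 2) :
    verticalIntegral F c₂ - verticalIntegral F c₁ = iteratedDeriv r h p / r.factorial := by
  have h12 : c₁ ≤ c₂ := (h1.trans h2).le
  have hFc : ∀ c : ℝ, c₁ ≤ c → c ≤ c₂ → c ≠ p →
      Continuous fun t : ℝ => F (c + t * Complex.I) := by
    intro c hc1 hc2 hcp
    have hne : ∀ t : ℝ, (c : ℂ) + t * Complex.I - p ≠ 0 := fun t ht => by
      have := congrArg Complex.re ht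
      simp at this
      exact hcp (by linarith)
    have hmem : ∀ t : ℝ, (c : ℂ) + t * Complex.I ∈ U := fun t =>
      hUr _ (by simpa using hc1) (by simpa using hc2)
    have e : (fun t : ℝ => F (c + t * Complex.I)) =
        fun t : ℝ => h (c + t * Complex.I) / (c + t * Complex.I - p) ^ (r + 1) := by
      funext t
      exact hF _ (hmem t) (sub_ne_zero.mp (hne t))
    rw [e]
    refine Continuous.div ?_ (by fun_prop) fun t => pow_ne_zero _ (hne t)
    exact hh.continuousOn.comp_continuous (by fun_prop) hmem
  have hint : ∀ c : ℝ, c₁ ≤ c → c ≤ c₂ → c ≠ p →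
      Integrable fun t : ℝ => F (c + t * Complex.I) := fun c hc1 hc2 hcp =>
    integrable_of_norm_le_div_sq (hFc c hc1 hc2 hcp) fun t ht => by
      simpa using hdec (c + t * Complex.I) (by simpa using hc1) (by simpa using hc2)
        (by simpa using ht)
  have hlim : Tendsto (fun T : ℝ => rectIntegral F c₁ c₂ T) atTop
      (𝓝 (0 - 0 + Complex.I • (∫ t : ℝ, F (c₂ + t * Complex.I)) -
        Complex.I • ∫ t : ℝ, F (c₁ + t * Complex.I))) := by
    unfold rectIntegral
    refine Tendsto.sub (Tendsto.add (Tendsto.sub ?_ ?_) (Tendsto.const_smul ?_ _))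
      (Tendsto.const_smul ?_ _)
    · exact tendsto_integral_horizontal h12 hdec (u := fun T => -T) (fun T => abs_neg T)
    · exact tendsto_integral_horizontal h12 hdec (u := fun T => T) (fun T => rfl)
    · exact intervalIntegral_tendsto_integral (hint c₂ h12 le_rfl h2.ne') tendsto_neg_atTop_atBot
        tendsto_id
    · exact intervalIntegral_tendsto_integral (hint c₁ le_rfl h12 h1.ne) tendsto_neg_atTop_atBot
        tendsto_id
  have hUr' : ∀ s : ℂ, s.re ∈ Set.uIcc c₁ c₂ → s ∈ U := fun s hs => by
    rw [Set.uIcc_of_le h12] at hs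
    exact hUr s hs.1 hs.2
  have hpU : U ∈ 𝓝 (p : ℂ) := hU.mem_nhds (hUr _ (by simpa using h1.le) (by simpa using h2.le))
  have hconst : ∀ᶠ T : ℝ in atTop, rectIntegral F c₁ c₂ T =
      2 * Real.pi * Complex.I * (iteratedDeriv r h p / r.factorial) := by
    filter_upwards [eventually_gt_atTop 0] with T hT
    rw [← iterate_dslope_eq_iteratedDeriv_div (hh.analyticAt hpU),
      ← rectIntegral_div_pow h1 h2 hT hU hUr' r hh]
    refine rectIntegral_congr fun s hs => hF s ?_ (ne_of_mem_rectBoundary h1 h2 hT hs)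
    rcases hs with ⟨hs, -⟩ | ⟨hs | hs, -⟩
    · exact hUr' s hs
    · exact hUr' s (by rw [hs]; exact Set.right_mem_uIcc)
    · exact hUr' s (by rw [hs]; exact Set.left_mem_uIcc)
  have heq := tendsto_nhds_unique (tendsto_const_nhds.congr' (hconst.mono fun _ h => h.symm)) hlim
  unfold verticalIntegral
  have hpi : (Real.pi : ℂ) ≠ 0 := by exact_mod_cast Real.pi_pos.ne'
  have h3 : Complex.I * (2 * Real.pi * (iteratedDeriv r h p / r.factorial)) = Complex.I *
      ((∫ t : ℝ, F (c₂ + t * Complex.I)) - ∫ t : ℝ, F (c₁ + t * Complex.I)) := by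
    simp only [smul_eq_mul] at heq
    linear_combination heq
  have h4 := mul_left_cancel₀ Complex.I_ne_zero h3
  rw [← mul_sub, ← h4]
  field_simp

/-! ### Partial sums of multi-indices -/

lemma lam_zero {M : ℕ} (ℓ : Fin M → ℕ) : lam ℓ 0 = 0 := by simp [lam]

lemma lam_mono {M : ℕ} (ℓ : Fin M → ℕ) : Monotone (lam ℓ) := fun a b hab =>
  Finset.sum_le_sum_of_subset fun k hk => by
    simp only [Finset.mem_filter, Finset.mem_univ, true_and] at hk ⊢
    omega

lemma lam_eq_zero_of_lam_top {M : ℕ} {ℓ : Fin M → ℕ} (h : lam ℓ M = 0) : ℓ = 0 := by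
  funext k
  simp only [lam, Finset.sum_eq_zero_iff, Finset.mem_filter, Finset.mem_univ, true_and] at h
  exact h k k.2

lemma lam_zero_fun {M : ℕ} (n : ℕ) : lam (0 : Fin M → ℕ) n = 0 := by simp [lam]

/-- The number of hops `n` with `lam ℓ n = 0`. -/
def zeroCount {M : ℕ} (ℓ : Fin M → ℕ) : ℕ :=
  (Finset.univ.filter fun n : Fin (M + 1) => lam ℓ n = 0).card

lemma zeroCount_pos {M : ℕ} (ℓ : Fin M → ℕ) : 0 < zeroCount ℓ :=
  Finset.card_pos.mpr ⟨0, by simp [lam_zero]⟩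

lemma zeroCount_eq_of {M : ℕ} {ℓ : Fin M → ℕ} {r : ℕ} (hr1 : 1 ≤ r) (hr2 : r ≤ M + 1)
    (h0 : lam ℓ (r - 1) = 0) (h1 : r ≤ M → 0 < lam ℓ r) : zeroCount ℓ = r := by
  have h2 : (Finset.univ.filter fun n : Fin (M + 1) => lam ℓ n = 0) =
      Finset.univ.filter fun n : Fin (M + 1) => (n : ℕ) < r := by
    ext n
    simp only [Finset.mem_filter, Finset.mem_univ, true_and]
    constructor
    · intro hn
      by_contra! hlt
      have h3 := h1 (by omega)
      have h4 := lam_mono ℓ hlt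
      omega
    · intro hn
      have h4 := lam_mono ℓ (show (n : ℕ) ≤ r - 1 by omega)
      omega
  rw [zeroCount, h2, Fin.card_filter_val_lt]
  omega

/-- The partial sums are nondecreasing and start at 0, so they vanish exactly on an initial segment.
Its length determines the class `𝓛_r`, and these classes partition the box (`sum_indexSet`). The
same number bounds the pole order at `s = 1`. -/
lemma mem_indexSet_iff {M : ℕ} {L ℓ : Fin M → ℕ} {r : ℕ} (hr1 : 1 ≤ r) (hr2 : r ≤ M + 1) :
    ℓ ∈ indexSet L r ↔ ℓ ∈ box L ∧ zeroCount ℓ = r := by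
  rw [indexSet, Finset.mem_filter]
  refine and_congr_right fun _ => ⟨fun h => zeroCount_eq_of hr1 hr2 h.1 h.2, ?_⟩
  rintro rfl
  obtain ⟨m, hm, hm0, hm1⟩ : ∃ m, m ≤ M ∧ lam ℓ m = 0 ∧ (m + 1 ≤ M → 0 < lam ℓ (m + 1)) := by
    refine ⟨Nat.findGreatest (fun n => lam ℓ n = 0) M, Nat.findGreatest_le _,
      Nat.findGreatest_spec (P := fun n => lam ℓ n = 0) (Nat.zero_le M) (lam_zero ℓ), fun h => ?_⟩
    exact Nat.pos_of_ne_zero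
      (Nat.findGreatest_is_greatest (P := fun n => lam ℓ n = 0) (Nat.lt_succ_self _) h)
  have h2 := zeroCount_eq_of (ℓ := ℓ) (r := m + 1) (by omega) (by omega) (by simpa using hm0) hm1
  rw [h2]
  exact ⟨by simpa using hm0, hm1⟩

lemma zeroCount_le {M : ℕ} (ℓ : Fin M → ℕ) : zeroCount ℓ ≤ M + 1 :=
  (Finset.card_le_univ _).trans (by simp)

lemma sum_indexSet {M : ℕ} {β : Type*} [AddCommMonoid β] (L : Fin M → ℕ)
    (f : ℕ → (Fin M → ℕ) → β) :
    ∑ r ∈ Finset.Icc 1 (M + 1), ∑ ℓ ∈ indexSet L r, f r ℓ =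
      ∑ ℓ ∈ box L, f (zeroCount ℓ) ℓ := by
  rw [← Finset.sum_fiberwise_of_maps_to (s := box L) (t := Finset.Icc 1 (M + 1))
    (g := zeroCount) fun ℓ _ => Finset.mem_Icc.mpr ⟨zeroCount_pos ℓ, zeroCount_le ℓ⟩]
  refine Finset.sum_congr rfl fun r hr => ?_
  rw [Finset.mem_Icc] at hr
  have : indexSet L r = (box L).filter fun ℓ => zeroCount ℓ = r := by
    ext ℓ
    rw [mem_indexSet_iff hr.1 hr.2, Finset.mem_filter]
  rw [this]
  refine Finset.sum_congr rfl fun ℓ hℓ => ?_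
  rw [(Finset.mem_filter.mp hℓ).2]

/-! ### The continued integrand -/

/-- The polynomial `s Γ(j - s) / Γ(1 - s)`. -/
def gammaQuot : ℕ → ℂ → ℂ
  | 0, _ => -1
  | j + 1, s => s * (ascPochhammer ℂ j).eval (1 - s)

lemma differentiable_gammaQuot (j : ℕ) : Differentiable ℂ (gammaQuot j) := by
  cases j with
  | zero => exact differentiable_const _
  | succ j =>
    have h : Differentiable ℂ fun s : ℂ => (ascPochhammer ℂ j).eval (1 - s) :=
      Differentiable.comp (g := fun z => (ascPochhammer ℂ j).eval z) (f := fun s => 1 - s)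
        (Polynomial.differentiable _) (by fun_prop)
    exact differentiable_fun_id.fun_mul h

/-- The quotient is `-1/s` for `j = 0` and a polynomial for `j ≥ 1`. Hence only a vanishing total
`λ_{N-1}` produces a pole at 0, and the quotient grows at most polynomially. -/
lemma Gamma_div_Gamma_eq (j : ℕ) {s : ℂ} (h0 : s ≠ 0) (h1 : ∀ k : ℕ, 1 - s ≠ -k) :
    Complex.Gamma (j - s) / Complex.Gamma (1 - s) = gammaQuot j s / s := by
  cases j with
  | zero =>
    have h2 := Complex.Gamma_add_one (-s) (neg_ne_zero.mpr h0)
    have h3 := Complex.Gamma_ne_zero h1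
    rw [show -s + 1 = 1 - s by ring] at h2
    have h4 : Complex.Gamma (-s) ≠ 0 := fun h => h3 (by rw [h2, h, mul_zero])
    rw [gammaQuot, Nat.cast_zero, zero_sub, h2]
    field_simp
  | succ j =>
    rw [gammaQuot, mul_div_cancel_left₀ _ h0, ← Complex.Gamma_add_nat_div_Gamma_eq _ h1]
    push_cast
    ring_nf

lemma one_sub_ne_neg_nat {s : ℂ} (hs : s.re < 2) (h1 : s ≠ 1) (k : ℕ) : 1 - s ≠ -k := by
  intro h
  have h2 := congrArg Complex.re h
  simp at h2
  have hk : (k : ℝ) < 1 := by linarith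
  have hk0 : k = 0 := by
    have : k < 1 := by exact_mod_cast hk
    omega
  rw [hk0] at h
  have h3 : 1 - s = 0 := by simpa using h
  exact h1 (sub_eq_zero.mp h3).symm

lemma norm_ascPochhammer_eval_le_pow (j : ℕ) (z : ℂ) :
    ‖(ascPochhammer ℂ j).eval z‖ ≤ (‖z‖ + j) ^ j := by
  have : ∀ k ≤ j, ‖(ascPochhammer ℂ k).eval z‖ ≤ (‖z‖ + j) ^ k := by
    intro k hk
    induction k with
    | zero => simp
    | succ k ih =>
      rw [ascPochhammer_succ_eval, norm_mul, pow_succ]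
      refine mul_le_mul (ih (by omega)) ((norm_add_le _ _).trans ?_) (norm_nonneg _) (by positivity)
      have : (k : ℝ) ≤ j := by exact_mod_cast (by omega : k ≤ j)
      simpa using this
  exact this j le_rfl

lemma exists_norm_gammaQuot_div_le (j : ℕ) (σ₁ σ₂ : ℝ) :
    ∃ C : ℝ, 0 ≤ C ∧ ∀ s : ℂ, σ₁ ≤ s.re → s.re ≤ σ₂ → 1 ≤ |s.im| →
      ‖gammaQuot j s / s‖ ≤ C * |s.im| ^ j := by
  cases j with
  | zero =>
    refine ⟨1, zero_le_one, fun s _ _ h3 => ?_⟩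
    have h4 : 1 ≤ ‖s‖ := h3.trans (Complex.abs_im_le_norm s)
    simpa [gammaQuot] using inv_le_one_of_one_le₀ h4
  | succ j =>
    refine ⟨(2 + |σ₁| + |σ₂| + j) ^ j, by positivity, fun s h1 h2 h3 => ?_⟩
    have hs0 : s ≠ 0 := fun h => by rw [h] at h3; norm_num at h3
    rw [gammaQuot, mul_div_cancel_left₀ _ hs0]
    refine (norm_ascPochhammer_eval_le_pow j _).trans ?_
    have h4 : ‖1 - s‖ ≤ 1 + |σ₁| + |σ₂| + |s.im| := by
      refine (Complex.norm_le_abs_re_add_abs_im _).trans ?_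
      simp only [Complex.sub_re, Complex.one_re, Complex.sub_im, Complex.one_im, zero_sub, abs_neg]
      have : |1 - s.re| ≤ 1 + |σ₁| + |σ₂| := by
        rw [abs_le]
        constructor <;>
          linarith [neg_abs_le σ₁, le_abs_self σ₂, abs_nonneg σ₁, abs_nonneg σ₂]
      linarith
    have h5 : ‖1 - s‖ + j ≤ (2 + |σ₁| + |σ₂| + j) * |s.im| := by
      have : (0 : ℝ) ≤ 1 + |σ₁| + |σ₂| + j := by positivity
      nlinarith
    calc (‖1 - s‖ + j) ^ j ≤ ((2 + |σ₁| + |σ₂| + j) * |s.im|) ^ j := by gcongr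
      _ = (2 + |σ₁| + |σ₂| + j) ^ j * |s.im| ^ j := mul_pow _ _ _
      _ ≤ _ := mul_le_mul_of_nonneg_left (pow_le_pow_right₀ h3 (Nat.le_succ j)) (by positivity)

/-- The integrand of the contour integrals, continued to `re s < 2`, without its constant. -/
def continuedIntegrand {M : ℕ} (K : Fin (M + 1) → ℝ) (ℓ : Fin M → ℕ) (w : ℝ) (s : ℂ) : ℂ :=
  (w : ℂ) ^ s * (gammaQuot (lam ℓ M) s / s * ∏ n : Fin (M + 1), gammaKummer (K n) (1 + lam ℓ n - s))

/-- The constant split off in `continuedIntegrand`. -/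
def hopConst {M : ℕ} (K θ : Fin (M + 1) → ℝ) (ℓ : Fin M → ℕ) : ℝ :=
  ∏ n : Fin (M + 1), Real.exp (-K n) * (θ n / (K n + 1)) ^ lam ℓ n

lemma baseConst_pos {M : ℕ} {K θ ρ : Fin (M + 1) → ℝ} {γth : ℝ} (hK : ∀ n, 0 ≤ K n)
    (hθ : ∀ n, 0 < θ n) (hρ : ∀ n, 0 < ρ n) (hγth : 0 < γth) : 0 < baseConst K θ ρ γth := by
  have h1 : 0 < ∏ n, (K n + 1) := Finset.prod_pos fun n _ => by linarith [hK n]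
  have h2 : 0 < ∏ n, θ n := Finset.prod_pos fun n _ => hθ n
  have := hρ (Fin.last M)
  unfold baseConst
  positivity

/-- The Mellin integral of the first hop converges only for `Re s < 1`; on that half-plane it may be
replaced by the Gamma and Kummer functions, which continue beyond it. The scales `θ_n` combine with
`ρ_N γ_th` into the single base `a/γ`. -/
lemma contourIntegrand_eq {M : ℕ} {K θ ρ : Fin (M + 1) → ℝ} {γth γ : ℝ} (hK : ∀ n, 0 ≤ K n)
    (hθ : ∀ n, 0 < θ n) (hρ : ∀ n, 0 < ρ n) (hγth : 0 < γth) (hγ : 0 < γ) (ℓ : Fin M → ℕ)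
    {s : ℂ} (h0 : s ≠ 0) (hs : s.re < 1) :
    contourIntegrand K θ ρ γth ℓ γ s =
      hopConst K θ ℓ * continuedIntegrand K ℓ (baseConst K θ ρ γth / γ) s := by
  have hs1 : s ≠ 1 := fun h => by rw [h] at hs; norm_num at hs
  have hb : ∀ n, 0 < (K n + 1) / θ n := fun n => div_pos (by linarith [hK n]) (hθ n)
  have hw : baseConst K θ ρ γth / γ = ρ (Fin.last M) * γth / γ * ∏ n, ((K n + 1) / θ n) := by
    rw [Finset.prod_div_distrib, baseConst]
    ring
  have hz : 0 < ρ (Fin.last M) * γth / γ := by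
    have := hρ (Fin.last M)
    positivity
  have hwpow : ((baseConst K θ ρ γth / γ : ℝ) : ℂ) ^ s =
      ((ρ (Fin.last M) * γth / γ : ℝ) : ℂ) ^ s * ∏ n, (((K n + 1) / θ n : ℝ) : ℂ) ^ s := by
    rw [hw, Complex.ofReal_mul, Complex.mul_cpow_ofReal_nonneg hz.le
      (Finset.prod_nonneg fun n _ => (hb n).le)]
    congr 1
    have : ∀ t : Finset (Fin (M + 1)), ((∏ n ∈ t, (K n + 1) / θ n : ℝ) : ℂ) ^ s =
        ∏ n ∈ t, (((K n + 1) / θ n : ℝ) : ℂ) ^ s := by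
      intro t
      induction t using Finset.induction_on with
      | empty => simp
      | insert a t ha ih =>
        rw [Finset.prod_insert ha, Finset.prod_insert ha, Complex.ofReal_mul,
          Complex.mul_cpow_ofReal_nonneg (hb a).le (Finset.prod_nonneg fun n _ => (hb n).le), ih]
    exact this _
  have hm : ∀ n : Fin (M + 1),
      mellin (fun x => (ricianPDF (K n) (θ n) x : ℂ)) (1 + (lam ℓ n : ℂ) - s) =
        ((Real.exp (-K n) * (θ n / (K n + 1)) ^ lam ℓ n : ℝ) : ℂ) *
          ((((K n + 1) / θ n : ℝ) : ℂ) ^ s * gammaKummer (K n) (1 + lam ℓ n - s)) := by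
    intro n
    have hbne : (((K n + 1) / θ n : ℝ) : ℂ) ≠ 0 := by exact_mod_cast (hb n).ne'
    rw [mellin_ricianPDF (hK n) (hθ n) (by
      simp
      have : (0 : ℝ) ≤ lam ℓ n := Nat.cast_nonneg _
      linarith), show (1 : ℂ) - (1 + lam ℓ n - s) = s - lam ℓ n by ring,
      Complex.cpow_sub _ _ hbne, Complex.cpow_natCast]
    have e : θ n / (K n + 1) = ((K n + 1) / θ n)⁻¹ := (inv_div _ _).symm
    rw [e]
    push_cast
    rw [inv_pow]
    ring
  rw [contourIntegrand, continuedIntegrand, hopConst,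
    Gamma_div_Gamma_eq _ h0 (one_sub_ne_neg_nat (by linarith) hs1), hwpow,
    Finset.prod_congr rfl fun n _ => hm n, Finset.prod_mul_distrib, Finset.prod_mul_distrib]
  push_cast
  ring

/-- Each factor `Γ ₁F₁` is taken to decay to order `λ_{N-1} + 2`, which absorbs the growth `|Im
s|^{λ_{N-1}}` of the Gamma quotient and leaves an integrable `|Im s|^{-2}`. -/
lemma exists_norm_continuedIntegrand_le {M : ℕ} {K : Fin (M + 1) → ℝ} (hK : ∀ n, 0 ≤ K n)
    (ℓ : Fin M → ℕ) {w : ℝ} (hw : 0 < w) (σ₁ σ₂ : ℝ) :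
    ∃ C : ℝ, ∀ s : ℂ, σ₁ ≤ s.re → s.re ≤ σ₂ → 1 ≤ |s.im| →
      ‖continuedIntegrand K ℓ w s‖ ≤ C / |s.im| ^ 2 := by
  obtain ⟨B, hB0, hB⟩ := exists_norm_gammaQuot_div_le (lam ℓ M) σ₁ σ₂
  choose D hD0 hD using fun n : Fin (M + 1) => exists_norm_gammaKummer_le (hK n)
    (1 + lam ℓ n - σ₂) (1 + lam ℓ n - σ₁) (lam ℓ M + 2)
  refine ⟨(w ^ σ₁ + w ^ σ₂) * (B * ∏ n, D n), fun s h1 h2 h3 => ?_⟩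
  have hpos : 0 < |s.im| := by linarith
  have hP : ‖∏ n : Fin (M + 1), gammaKummer (K n) (1 + lam ℓ n - s)‖ ≤
      (∏ n, D n) / |s.im| ^ (lam ℓ M + 2) := by
    rw [norm_prod]
    calc ∏ n : Fin (M + 1), ‖gammaKummer (K n) (1 + lam ℓ n - s)‖
        ≤ ∏ n : Fin (M + 1), D n / |s.im| ^ (lam ℓ M + 2) := by
          refine Finset.prod_le_prod (fun n _ => norm_nonneg _) fun n _ => ?_
          simpa using hD n (1 + lam ℓ n - s) (by simp; linarith) (by simp; linarith) (by simpa using h3)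
      _ = (∏ n, D n) / (|s.im| ^ (lam ℓ M + 2)) ^ (M + 1) := by
          rw [Finset.prod_div_distrib, Finset.prod_const, Finset.card_univ, Fintype.card_fin]
      _ ≤ _ := by
          refine div_le_div_of_nonneg_left (Finset.prod_nonneg fun n _ => hD0 n) (by positivity) ?_
          exact le_self_pow₀ (one_le_pow₀ h3) (Nat.succ_ne_zero M)
  have hwp : ‖(w : ℂ) ^ s‖ ≤ w ^ σ₁ + w ^ σ₂ := by
    rw [Complex.norm_cpow_eq_rpow_re_of_pos hw]
    have p1 := Real.rpow_nonneg hw.le σ₁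
    have p2 := Real.rpow_nonneg hw.le σ₂
    rcases le_total w 1 with h | h
    · linarith [Real.rpow_le_rpow_of_exponent_ge hw h h1]
    · linarith [Real.rpow_le_rpow_of_exponent_le h h2]
  have hD' : 0 ≤ ∏ n, D n := Finset.prod_nonneg fun n _ => hD0 n
  rw [continuedIntegrand, norm_mul, norm_mul, mul_div_assoc]
  refine mul_le_mul hwp ?_ (by positivity) (by positivity)
  refine (mul_le_mul (hB s h1 h2 h3) hP (norm_nonneg _) (by positivity)).trans (le_of_eq ?_)
  field_simp
  ring

/-- A hop factor of `ϱ`, regularized at `s = 1`. -/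
def hopFactor (K : ℝ) (j : ℕ) (s : ℂ) : ℂ :=
  if j = 0 then -(Complex.Gamma (2 - s) * kummerC K (1 - s)) else gammaKummer K (1 + j - s)

/-- For `j = 0` the factor is `Γ(1 - s) = Γ(2 - s)/(1 - s)`, a simple pole at 1; for `j ≥ 1` there
is none. So each hop with vanishing partial sum contributes one power of `(s - 1)⁻¹`. -/
lemma gammaKummer_eq_hopFactor_div (K : ℝ) (j : ℕ) {s : ℂ} (h1 : s ≠ 1) :
    gammaKummer K (1 + j - s) = hopFactor K j s / (if j = 0 then s - 1 else 1) := by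
  rcases eq_or_ne j 0 with rfl | hj
  · have h2 := Complex.Gamma_add_one (1 - s) (sub_ne_zero.mpr h1.symm)
    have h3 : s - 1 ≠ 0 := sub_ne_zero.mpr h1
    rw [hopFactor, if_pos rfl, if_pos rfl, show (2 : ℂ) - s = 1 - s + 1 by ring, h2, gammaKummer]
    simp
    field_simp
    ring
  · simp [hopFactor, hj]

lemma differentiableAt_hopFactor {K : ℝ} (hK : 0 ≤ K) (j : ℕ) {s : ℂ} (hs : s.re < 2) :
    DifferentiableAt ℂ (hopFactor K j) s := by
  unfold hopFactor
  split_ifs with hj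
  · have hd : DifferentiableAt ℂ Complex.Gamma (2 - s) :=
      Complex.differentiableAt_Gamma _ fun k hk => by
        have h1 := congrArg Complex.re hk
        have : (0 : ℝ) ≤ k := k.cast_nonneg
        simp at h1
        linarith
    exact ((hd.comp s (by fun_prop)).mul
      ((differentiable_kummerC hK _).comp s (by fun_prop))).neg
  · refine DifferentiableAt.comp s (differentiableAt_gammaKummer hK ?_) (by fun_prop)
    have : (1 : ℝ) ≤ j := by exact_mod_cast Nat.one_le_iff_ne_zero.mpr hj
    simp
    linarith

/-- The function `ϱ` on the complex plane, with its singularity at `s = 1` removed. -/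
def varrhoC {M : ℕ} (K : Fin (M + 1) → ℝ) (ℓ : Fin M → ℕ) (s : ℂ) : ℂ :=
  gammaQuot (lam ℓ M) s / s * ∏ n : Fin (M + 1), hopFactor (K n) (lam ℓ n) s

lemma differentiableAt_varrhoC {M : ℕ} {K : Fin (M + 1) → ℝ} (hK : ∀ n, 0 ≤ K n) (ℓ : Fin M → ℕ)
    {s : ℂ} (h0 : s ≠ 0) (hs : s.re < 2) : DifferentiableAt ℂ (varrhoC K ℓ) s := by
  refine DifferentiableAt.mul ((differentiable_gammaQuot _ s).div differentiableAt_id h0) ?_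
  exact DifferentiableAt.fun_finsetProd fun n _ => differentiableAt_hopFactor (hK n) _ hs

lemma prod_gammaKummer_eq {M : ℕ} (K : Fin (M + 1) → ℝ) (ℓ : Fin M → ℕ) {s : ℂ} (h1 : s ≠ 1) :
    ∏ n : Fin (M + 1), gammaKummer (K n) (1 + lam ℓ n - s) =
      (∏ n : Fin (M + 1), hopFactor (K n) (lam ℓ n) s) / (s - 1) ^ zeroCount ℓ := by
  rw [Finset.prod_congr rfl fun n _ => gammaKummer_eq_hopFactor_div (K n) (lam ℓ n) h1,
    Finset.prod_div_distrib, Finset.prod_ite, Finset.prod_const, Finset.prod_const_one, mul_one,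
    zeroCount]

/-! ### Shifting the contours -/

lemma isOpen_re_lt (a : ℝ) : IsOpen {s : ℂ | s.re < a} :=
  isOpen_lt Complex.continuous_re continuous_const

lemma differentiableAt_const_cpow_of_pos {w : ℝ} (hw : 0 < w) (s : ℂ) :
    DifferentiableAt ℂ (fun s : ℂ => (w : ℂ) ^ s) s :=
  differentiableAt_id.const_cpow (Or.inl (by exact_mod_cast hw.ne'))

/-- The value at `0` of `s` times the continued integrand. -/
def residueZero {M : ℕ} (K : Fin (M + 1) → ℝ) (ℓ : Fin M → ℕ) : ℂ :=
  gammaQuot (lam ℓ M) 0 * ∏ n : Fin (M + 1), gammaKummer (K n) (1 + lam ℓ n)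

/-- For `ℓ = 0` each hop contributes `e^{-K} ₁F₁(1, 1; K) = 1`, its total mass. Otherwise the Gamma
quotient has no pole at 0. -/
lemma hopConst_mul_residueZero {M : ℕ} (K θ : Fin (M + 1) → ℝ) (ℓ : Fin M → ℕ) :
    hopConst K θ ℓ * residueZero K ℓ = if ℓ = 0 then -1 else 0 := by
  split_ifs with h
  · subst h
    simp only [hopConst, residueZero, lam_zero_fun, gammaKummer, gammaQuot]
    simp only [pow_zero, mul_one, Nat.cast_zero, add_zero, Complex.Gamma_one, one_mul, kummerC_one]
    push_cast
    rw [neg_one_mul, mul_neg, ← Finset.prod_mul_distrib, Finset.prod_eq_one]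
    intro n _
    rw [← Complex.exp_add]
    simp
  · obtain ⟨j, hj⟩ := Nat.exists_eq_succ_of_ne_zero fun h0 => h (lam_eq_zero_of_lam_top h0)
    rw [residueZero, hj]
    simp [gammaQuot]

lemma verticalIntegral_continuedIntegrand_half {M : ℕ} {K : Fin (M + 1) → ℝ} (hK : ∀ n, 0 ≤ K n)
    (ℓ : Fin M → ℕ) {w : ℝ} (hw : 0 < w) {σ : ℝ} (hσ : σ < 0) :
    verticalIntegral (continuedIntegrand K ℓ w) (1 / 2 : ℝ) -
      verticalIntegral (continuedIntegrand K ℓ w) σ = residueZero K ℓ := by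
  obtain ⟨C, hC⟩ := exists_norm_continuedIntegrand_le hK ℓ hw σ (1 / 2)
  rw [verticalIntegral_sub_verticalIntegral (p := 0) hσ (by norm_num) (isOpen_re_lt 1)
    (fun s _ hs => by simp only [Set.mem_ofPred_eq]; linarith)
    (h := fun s => (w : ℂ) ^ s * (gammaQuot (lam ℓ M) s *
      ∏ n : Fin (M + 1), gammaKummer (K n) (1 + lam ℓ n - s))) ?_ 0 ?_ hC]
  · simp [residueZero]
  · intro s hs
    simp only [Set.mem_ofPred_eq] at hs
    refine DifferentiableAt.differentiableWithinAt ((differentiableAt_const_cpow_of_pos hw s).mul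
      ((differentiable_gammaQuot _ s).mul
      (DifferentiableAt.fun_finsetProd fun n _ => ?_)))
    refine DifferentiableAt.comp s (differentiableAt_gammaKummer (hK n) ?_) (by fun_prop)
    have : (0 : ℝ) ≤ lam ℓ n := Nat.cast_nonneg _
    simp
    linarith
  · intro s _ _
    rw [continuedIntegrand]
    simp
    ring

lemma verticalIntegral_continuedIntegrand_three_half {M : ℕ} {K : Fin (M + 1) → ℝ}
    (hK : ∀ n, 0 ≤ K n) (ℓ : Fin M → ℕ) {w : ℝ} (hw : 0 < w) :
    verticalIntegral (continuedIntegrand K ℓ w) (3 / 2 : ℝ) -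
      verticalIntegral (continuedIntegrand K ℓ w) (1 / 2 : ℝ) =
      iteratedDeriv (zeroCount ℓ - 1) (fun s => (w : ℂ) ^ s * varrhoC K ℓ s) 1 /
        (zeroCount ℓ - 1).factorial := by
  obtain ⟨C, hC⟩ := exists_norm_continuedIntegrand_le hK ℓ hw (1 / 2) (3 / 2)
  -- The regularized integrand is holomorphic between the singularities of the factors at 0 and 2.
  have hU : IsOpen {s : ℂ | 0 < s.re ∧ s.re < 2} :=
    (isOpen_lt continuous_const Complex.continuous_re).inter (isOpen_re_lt 2)
  rw [verticalIntegral_sub_verticalIntegral (p := 1) (by norm_num) (by norm_num) hU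
    (fun s h1 h2 => ⟨by linarith, by linarith⟩)
    (h := fun s => (w : ℂ) ^ s * varrhoC K ℓ s) ?_ (zeroCount ℓ - 1) ?_ hC]
  · simp
  · intro s hs
    exact DifferentiableAt.differentiableWithinAt ((differentiableAt_const_cpow_of_pos hw s).mul
      (differentiableAt_varrhoC hK ℓ (fun h => by simp [h] at hs) hs.2))
  · intro s _ hs1
    rw [Nat.sub_add_cancel (zeroCount_pos ℓ), continuedIntegrand,
      prod_gammaKummer_eq K ℓ (by simpa using hs1), varrhoC]
    simp
    ring

lemma verticalIntegral_const_mul (a : ℂ) (F : ℂ → ℂ) (c : ℝ) :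
    verticalIntegral (fun s => a * F s) c = a * verticalIntegral F c := by
  unfold verticalIntegral
  rw [integral_const_mul]
  ring

lemma verticalIntegral_congr {F G : ℂ → ℂ} {c : ℝ} (h : ∀ s : ℂ, s.re = c → F s = G s) :
    verticalIntegral F c = verticalIntegral G c := by
  unfold verticalIntegral
  congr 2
  funext t
  exact h _ (by simp)

/-- The constant in front of the contour integral with index `ℓ`. -/
def indexCoeff {M : ℕ} (ρ : Fin (M + 1) → ℝ) (ℓ : Fin M → ℕ) : ℝ :=
  (-1) ^ lam ℓ M *
    ∏ k : Fin M, (1 / ((ℓ k).factorial : ℝ)) * (ρ k.castSucc / ρ (Fin.last M)) ^ ℓ k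

lemma contourOutage_eq {M : ℕ} {K θ ρ : Fin (M + 1) → ℝ} {γth γ : ℝ} (hK : ∀ n, 0 ≤ K n)
    (hθ : ∀ n, 0 < θ n) (hρ : ∀ n, 0 < ρ n) (hγth : 0 < γth) (hγ : 0 < γ)
    {L : Fin M → ℕ} (hL : ∀ k, 1 ≤ L k) {κ : (Fin M → ℕ) → ℝ}
    (hκ : ∀ ℓ ∈ box L, (lam ℓ M : ℝ) < κ ℓ) :
    contourOutage K θ ρ γth L κ γ =
      ∑ ℓ ∈ box L, indexCoeff ρ ℓ * hopConst K θ ℓ *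
        (iteratedDeriv (zeroCount ℓ - 1)
          (fun s => ((baseConst K θ ρ γth / γ : ℝ) : ℂ) ^ s * varrhoC K ℓ s) 1 /
          (zeroCount ℓ - 1).factorial -
        verticalIntegral (continuedIntegrand K ℓ (baseConst K θ ρ γth / γ)) (3 / 2 : ℝ)) := by
  set w := baseConst K θ ρ γth / γ with hw
  have hw0 : 0 < w := div_pos (baseConst_pos hK hθ hρ hγth) hγ
  have h1 : ∀ ℓ ∈ box L, verticalIntegral (contourIntegrand K θ ρ γth ℓ γ) (-κ ℓ) =
      hopConst K θ ℓ * (verticalIntegral (continuedIntegrand K ℓ w) (3 / 2 : ℝ) -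
        iteratedDeriv (zeroCount ℓ - 1) (fun s => (w : ℂ) ^ s * varrhoC K ℓ s) 1 /
          (zeroCount ℓ - 1).factorial) - if ℓ = 0 then -1 else 0 := by
    intro ℓ hℓ
    have hk : 0 < κ ℓ := lt_of_le_of_lt (Nat.cast_nonneg _) (hκ ℓ hℓ)
    rw [verticalIntegral_congr (G := fun s => hopConst K θ ℓ * continuedIntegrand K ℓ w s)
      fun s hs => contourIntegrand_eq hK hθ hρ hγth hγ ℓ
        (fun h => by rw [h] at hs; simp at hs; linarith) (by linarith),
      verticalIntegral_const_mul, ← hopConst_mul_residueZero K θ ℓ,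
      ← verticalIntegral_continuedIntegrand_half hK ℓ hw0 (neg_lt_zero.mpr hk),
      ← verticalIntegral_continuedIntegrand_three_half hK ℓ hw0]
    ring
  have h0 : (0 : Fin M → ℕ) ∈ box L := by
    simp only [box, Fintype.mem_piFinset, Finset.mem_range]
    exact fun k => hL k
  rw [contourOutage, Finset.sum_congr rfl fun ℓ hℓ => by rw [h1 ℓ hℓ]]
  simp only [mul_sub, Finset.sum_sub_distrib, mul_ite, mul_zero, Finset.sum_ite_eq', h0, if_true]
  have e0 : ((-1 : ℂ)) ^ lam (0 : Fin M → ℕ) M * (∏ k : Fin M, (1 / (((0 : Fin M → ℕ) k).factorial : ℂ)) *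
      ((ρ k.castSucc / ρ (Fin.last M) : ℝ) : ℂ) ^ (0 : Fin M → ℕ) k) * -1 = -1 := by
    simp [lam_zero_fun]
  rw [e0]
  have e1 : ∀ ℓ : Fin M → ℕ, (indexCoeff ρ ℓ : ℂ) = (-1) ^ lam ℓ M *
    (∏ k : Fin M, (1 / ((ℓ k).factorial : ℂ)) *
      ((ρ k.castSucc / ρ (Fin.last M) : ℝ) : ℂ) ^ ℓ k) := by
    intro ℓ
    rw [indexCoeff]
    push_cast
    rfl
  simp only [e1, mul_assoc]
  ring

/-- On the line `Re s = c` the base `w` enters the modulus only through `w^c`. With `c = 3/2` and `w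
= a/γ` this yields the remainder `O(γ^{-3/2})`; any abscissa strictly between 1 and 2 would do. -/
lemma norm_verticalIntegral_continuedIntegrand {M : ℕ} (K : Fin (M + 1) → ℝ) (ℓ : Fin M → ℕ)
    {w : ℝ} (hw : 0 < w) (c : ℝ) :
    ‖verticalIntegral (continuedIntegrand K ℓ w) c‖ ≤
      w ^ c * (‖(1 / (2 * Real.pi) : ℂ)‖ *
        ∫ t : ℝ, ‖continuedIntegrand K ℓ 1 (c + t * Complex.I)‖) := by
  rw [verticalIntegral, norm_mul, mul_left_comm]
  refine mul_le_mul_of_nonneg_left ?_ (norm_nonneg _)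
  refine (norm_integral_le_integral_norm _).trans (le_of_eq ?_)
  rw [← integral_const_mul]
  congr 1
  funext t
  rw [continuedIntegrand, continuedIntegrand, norm_mul, norm_mul,
    Complex.norm_cpow_eq_rpow_re_of_pos hw]
  simp

lemma isLittleO_verticalIntegral_continuedIntegrand {M : ℕ} (K : Fin (M + 1) → ℝ) (ℓ : Fin M → ℕ)
    {a : ℝ} (ha : 0 < a) :
    (fun γ : ℝ => verticalIntegral (continuedIntegrand K ℓ (a / γ)) (3 / 2 : ℝ))
      =o[atTop] (fun γ : ℝ => γ⁻¹) := by
  set D := ‖(1 / (2 * Real.pi) : ℂ)‖ *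
        ∫ t : ℝ, ‖continuedIntegrand K ℓ 1 ((3 / 2 : ℝ) + t * Complex.I)‖ with hD
  have h1 : (fun γ : ℝ => a ^ (3 / 2 : ℝ) * D * (γ ^ (-(1 / 2) : ℝ) * γ⁻¹))
      =o[atTop] (fun γ : ℝ => γ⁻¹) := by
    refine IsLittleO.const_mul_left ?_ _
    have := ((isLittleO_one_iff ℝ).mpr
      (tendsto_rpow_neg_atTop (show (0 : ℝ) < 1 / 2 by norm_num))).mul_isBigO
      (isBigO_refl (fun γ : ℝ => γ⁻¹) atTop)
    simpa using this
  refine IsBigO.trans_isLittleO (IsBigO.of_bound 1 ?_) h1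
  filter_upwards [eventually_gt_atTop 0] with γ hγ
  refine (norm_verticalIntegral_continuedIntegrand K ℓ (div_pos ha hγ) (3 / 2)).trans ?_
  rw [one_mul]
  refine le_trans (le_of_eq ?_) (le_abs_self _)
  rw [Real.div_rpow ha.le hγ.le, ← Real.rpow_neg_one γ, ← Real.rpow_add hγ, ← hD, div_eq_mul_inv,
    ← Real.rpow_neg hγ.le]
  norm_num
  ring

/-! ### The derivatives of `ϱ` at its removable singularity -/

lemma iteratedDeriv_ofReal {v : ℝ → ℝ} {V : ℂ → ℂ} {U : Set ℝ} (hU : IsOpen U)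
    (hV : ∀ x ∈ U, AnalyticAt ℂ V x) (hvV : ∀ x ∈ U, (v x : ℂ) = V x) (k : ℕ) :
    ∀ x ∈ U, ((iteratedDeriv k v x : ℝ) : ℂ) = iteratedDeriv k V x := by
  induction k with
  | zero => simpa using hvV
  | succ k ih =>
    intro x hx
    have hA : AnalyticAt ℂ (iteratedDeriv k V) x := by
      rw [iteratedDeriv_eq_iterate]
      exact (hV x hx).iterated_deriv k
    have hd : HasDerivAt (iteratedDeriv k V) (iteratedDeriv (k + 1) V x) x := by
      rw [iteratedDeriv_succ]
      exact hA.differentiableAt.hasDerivAt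
    have he : (fun y : ℝ => (iteratedDeriv k V y).re) =ᶠ[𝓝 x] iteratedDeriv k v := by
      filter_upwards [hU.mem_nhds hx] with y hy
      rw [← ih y hy, Complex.ofReal_re]
    have h1 : HasDerivAt (iteratedDeriv k v) (iteratedDeriv (k + 1) V x).re x :=
      hd.real_of_complex.congr_of_eventuallyEq he.symm
    have h2 := h1.ofReal_comp
    have h3 : HasDerivAt (fun y : ℝ => ((iteratedDeriv k v y : ℝ) : ℂ))
        (iteratedDeriv (k + 1) V x) x := by
      refine hd.comp_ofReal.congr_of_eventuallyEq ?_
      filter_upwards [hU.mem_nhds hx] with y hy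
      exact ih y hy
    rw [iteratedDeriv_succ, h1.deriv]
    exact h2.unique h3

lemma ofReal_varrho {M : ℕ} (K : Fin (M + 1) → ℝ) (ℓ : Fin M → ℕ) {x : ℝ} (h0 : 0 < x) (h2 : x < 2)
    (h1 : x ≠ 1) : ((varrho K ℓ (zeroCount ℓ) x : ℝ) : ℂ) = varrhoC K ℓ x := by
  have hx0 : (x : ℂ) ≠ 0 := by exact_mod_cast h0.ne'
  have hx1 : (x : ℂ) ≠ 1 := by exact_mod_cast h1
  have hq := Gamma_div_Gamma_eq (lam ℓ M) hx0 (one_sub_ne_neg_nat (by simpa using h2) hx1)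
  have hp := prod_gammaKummer_eq K ℓ hx1
  have hx1' : ((x : ℂ) - 1) ^ zeroCount ℓ ≠ 0 := pow_ne_zero _ (sub_ne_zero.mpr hx1)
  rw [eq_div_iff hx1'] at hp
  rw [varrhoC, ← hp, ← hq, varrho]
  simp only [gammaKummer]
  push_cast
  simp only [← Complex.Gamma_ofReal, ofReal_kummer]
  push_cast
  ring

/-- Away from 1 the real function `ϱ` is the restriction of the holomorphic `varrhoC`, and so are
its derivatives. At 1 the formula for `ϱ` involves default values of `Γ` at its poles, hence the
limit over the punctured neighbourhood, given by continuity of the holomorphic derivatives. -/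
lemma ofReal_varrhoDeriv {M : ℕ} {K : Fin (M + 1) → ℝ} (hK : ∀ n, 0 ≤ K n) (ℓ : Fin M → ℕ) (k : ℕ) :
    ((varrhoDeriv K ℓ (zeroCount ℓ) k : ℝ) : ℂ) = iteratedDeriv k (varrhoC K ℓ) 1 := by
  have hopen : IsOpen {s : ℂ | 0 < s.re ∧ s.re < 2} :=
    (isOpen_lt continuous_const Complex.continuous_re).inter (isOpen_re_lt 2)
  have hA : ∀ x : ℝ, 0 < x → x < 2 → AnalyticAt ℂ (varrhoC K ℓ) x := fun x h0 h2 =>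
    DifferentiableOn.analyticAt (s := {s : ℂ | 0 < s.re ∧ s.re < 2})
      (fun s hs => (differentiableAt_varrhoC hK ℓ (fun h => by simp [h] at hs)
        hs.2).differentiableWithinAt) (hopen.mem_nhds (by simp [h0, h2]))
  have hU : IsOpen (Set.Ioo (0 : ℝ) 2 ∩ {1}ᶜ) := isOpen_Ioo.inter isOpen_compl_singleton
  have heq := iteratedDeriv_ofReal (v := varrho K ℓ (zeroCount ℓ)) (V := varrhoC K ℓ) hU
    (fun x hx => hA x hx.1.1 hx.1.2) (fun x hx => ofReal_varrho K ℓ hx.1.1 hx.1.2 hx.2) k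
  have hcont : ContinuousAt (iteratedDeriv k (varrhoC K ℓ)) ((1 : ℝ) : ℂ) := by
    rw [iteratedDeriv_eq_iterate]
    exact ((hA 1 one_pos one_lt_two).iterated_deriv k).continuousAt
  have hmem : Set.Ioo (0 : ℝ) 2 ∩ {1}ᶜ ∈ 𝓝[≠] (1 : ℝ) :=
    inter_mem (mem_nhdsWithin_of_mem_nhds (Ioo_mem_nhds one_pos one_lt_two)) self_mem_nhdsWithin
  have hlim : Tendsto (fun x : ℝ => iteratedDeriv k (varrhoC K ℓ) (x : ℂ)) (𝓝[≠] (1 : ℝ))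
      (𝓝 (iteratedDeriv k (varrhoC K ℓ) ((1 : ℝ) : ℂ))) :=
    (hcont.comp (f := fun x : ℝ => (x : ℂ)) Complex.continuous_ofReal.continuousAt).tendsto.mono_left
      nhdsWithin_le_nhds
  have hlimC : Tendsto (fun x : ℝ => ((iteratedDeriv k (varrho K ℓ (zeroCount ℓ)) x : ℝ) : ℂ))
      (𝓝[≠] (1 : ℝ)) (𝓝 (iteratedDeriv k (varrhoC K ℓ) ((1 : ℝ) : ℂ))) := by
    refine hlim.congr' ?_
    filter_upwards [hmem] with x hx
    exact (heq x hx).symm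
  have hlimR : Tendsto (iteratedDeriv k (varrho K ℓ (zeroCount ℓ)))
      (𝓝[≠] (1 : ℝ)) (𝓝 (iteratedDeriv k (varrhoC K ℓ) ((1 : ℝ) : ℂ)).re) := by
    refine ((Complex.continuous_re.tendsto _).comp hlimC).congr fun x => ?_
    simp
  have hlimR' := (Complex.continuous_ofReal.tendsto _).comp hlimR
  rw [varrhoDeriv, hlimR.limUnder_eq]
  simpa using tendsto_nhds_unique hlimR' hlimC

/-- Leibniz rule: the `l`-th derivative of `w^s` at 1 is `w (log w)^l`, and the binomial coefficient
over `r!` is `1/(l! (r-l)!)`. -/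
lemma iteratedDeriv_cpow_mul_varrhoC {M : ℕ} {K : Fin (M + 1) → ℝ} (hK : ∀ n, 0 ≤ K n)
    (ℓ : Fin M → ℕ) {w : ℝ} (hw : 0 < w) (r : ℕ) :
    iteratedDeriv r (fun s => (w : ℂ) ^ s * varrhoC K ℓ s) 1 / r.factorial =
      ((w * ∑ l ∈ Finset.range (r + 1), varrhoDeriv K ℓ (zeroCount ℓ) (r - l) /
        (((r - l).factorial : ℝ) * (l.factorial : ℝ)) * Real.log w ^ l : ℝ) : ℂ) := by
  have hA : AnalyticAt ℂ (varrhoC K ℓ) 1 :=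
    DifferentiableOn.analyticAt (s := {s : ℂ | 0 < s.re ∧ s.re < 2})
      (fun s hs => (differentiableAt_varrhoC hK ℓ (fun h => by simp [h] at hs)
        hs.2).differentiableWithinAt)
      (((isOpen_lt continuous_const Complex.continuous_re).inter (isOpen_re_lt 2)).mem_nhds
        (by simp))
  have hwne : (w : ℂ) ≠ 0 := by exact_mod_cast hw.ne'
  have hcp : (fun s : ℂ => (w : ℂ) ^ s) = fun s => Complex.exp ((Real.log w : ℝ) * s) := by
    funext s
    rw [Complex.cpow_def_of_ne_zero hwne, Complex.ofReal_log hw.le]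
  have hcd : ContDiffAt ℂ (r : WithTop ℕ∞) (fun s : ℂ => (w : ℂ) ^ s) 1 := by
    rw [hcp]
    fun_prop
  rw [iteratedDeriv_fun_mul hcd hA.contDiffAt, Finset.sum_div, Complex.ofReal_mul,
    Complex.ofReal_sum, Finset.mul_sum]
  refine Finset.sum_congr rfl fun l hl => ?_
  have hlr : l ≤ r := Nat.lt_succ_iff.mp (Finset.mem_range.mp hl)
  have hexp : Complex.exp ((Real.log w : ℝ) * 1) = w := by
    rw [mul_one, ← Complex.ofReal_exp, Real.exp_log hw]
  rw [hcp, iteratedDeriv_cexp_const_mul]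
  simp only [hexp]
  rw [← ofReal_varrhoDeriv hK, Nat.cast_choose ℂ hlr]
  push_cast
  have h1 : (r.factorial : ℂ) ≠ 0 := Nat.cast_ne_zero.mpr r.factorial_ne_zero
  have h2 : (l.factorial : ℂ) ≠ 0 := Nat.cast_ne_zero.mpr l.factorial_ne_zero
  have h3 : ((r - l).factorial : ℂ) ≠ 0 := Nat.cast_ne_zero.mpr (r - l).factorial_ne_zero
  field_simp

/-- The index shift in `ζ_ℓ` comes from `λ_0 = 0`: the first hop carries no power of `θ`. -/
lemma indexCoeff_mul_hopConst {M : ℕ} (K θ ρ : Fin (M + 1) → ℝ) (ℓ : Fin M → ℕ) :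
    indexCoeff ρ ℓ * hopConst K θ ℓ = (-1) ^ lam ℓ M * zetaCoeff K θ ρ ℓ := by
  rw [indexCoeff, hopConst, zetaCoeff, Finset.prod_mul_distrib, Finset.prod_mul_distrib,
    Fin.prod_univ_castSucc (n := M) (fun n => Real.exp (-K n)),
    Fin.prod_univ_succ (n := M) (fun n => (θ n / (K n + 1)) ^ lam ℓ n),
    Finset.prod_mul_distrib, Finset.prod_mul_distrib, Finset.prod_div_distrib,
    Finset.prod_div_distrib]
  simp only [Fin.val_zero, lam_zero, pow_zero, one_mul, Fin.val_succ, Finset.prod_const_one]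
  ring

lemma log_div_pow {a γ : ℝ} (ha : 0 < a) (hγ : 0 < γ) (l : ℕ) :
    Real.log (a / γ) ^ l = ∑ p ∈ Finset.range (l + 1),
      (l.choose p : ℝ) * (-1) ^ p * Real.log a ^ (l - p) * Real.log γ ^ p := by
  rw [Real.log_div ha.ne' hγ.ne', sub_eq_neg_add, add_pow]
  refine Finset.sum_congr rfl fun p _ => ?_
  rw [neg_pow (Real.log γ)]
  ring

lemma riceExpansion_eq {M : ℕ} {K θ ρ : Fin (M + 1) → ℝ} {γth γ : ℝ} (hK : ∀ n, 0 ≤ K n)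
    (hθ : ∀ n, 0 < θ n) (hρ : ∀ n, 0 < ρ n) (hγth : 0 < γth) (hγ : 0 < γ) (L : Fin M → ℕ) :
    riceExpansion K θ ρ γth L γ = ∑ ℓ ∈ box L, (-1) ^ lam ℓ M * zetaCoeff K θ ρ ℓ *
      (baseConst K θ ρ γth / γ * ∑ l ∈ Finset.range (zeroCount ℓ),
        varrhoDeriv K ℓ (zeroCount ℓ) (zeroCount ℓ - 1 - l) /
        (((zeroCount ℓ - 1 - l).factorial : ℝ) * (l.factorial : ℝ)) *
          Real.log (baseConst K θ ρ γth / γ) ^ l) := by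
  rw [riceExpansion, sum_indexSet L fun r ℓ => (-1) ^ lam ℓ M * zetaCoeff K θ ρ ℓ *
        ∑ l ∈ Finset.range r,
          varrhoDeriv K ℓ r (r - 1 - l) / (((r - 1 - l).factorial : ℝ) * (l.factorial : ℝ)) *
            ∑ p ∈ Finset.range (l + 1),
              (l.choose p : ℝ) * (-1) ^ p * Real.log (baseConst K θ ρ γth) ^ (l - p) *
                (Real.log γ ^ p / γ), Finset.mul_sum]
  refine Finset.sum_congr rfl fun ℓ _ => ?_
  rw [mul_left_comm, div_eq_mul_inv (baseConst K θ ρ γth), mul_assoc (baseConst K θ ρ γth)]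
  congr 2
  rw [Finset.mul_sum]
  refine Finset.sum_congr rfl fun l _ => ?_
  rw [← div_eq_mul_inv, log_div_pow (baseConst_pos hK hθ hρ hγth) hγ, mul_left_comm]
  congr 1
  rw [Finset.mul_sum]
  refine Finset.sum_congr rfl fun p _ => ?_
  ring

lemma isLittleO_contourOutage_sub_riceExpansion {M : ℕ} {K θ ρ : Fin (M + 1) → ℝ} {γth : ℝ}
    (hK : ∀ n, 0 ≤ K n) (hθ : ∀ n, 0 < θ n) (hρ : ∀ n, 0 < ρ n) (hγth : 0 < γth)
    {L : Fin M → ℕ} (hL : ∀ k, 1 ≤ L k) {κ : (Fin M → ℕ) → ℝ}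
    (hκ : ∀ ℓ ∈ box L, (lam ℓ M : ℝ) < κ ℓ) :
    (fun γ : ℝ => contourOutage K θ ρ γth L κ γ - (riceExpansion K θ ρ γth L γ : ℂ))
      =o[atTop] (fun γ : ℝ => γ⁻¹) := by
  have h1 : (fun γ : ℝ => -∑ ℓ ∈ box L, (indexCoeff ρ ℓ * hopConst K θ ℓ : ℂ) *
      verticalIntegral (continuedIntegrand K ℓ (baseConst K θ ρ γth / γ)) (3 / 2 : ℝ))
      =o[atTop] (fun γ : ℝ => γ⁻¹) :=
    (IsLittleO.fun_sum fun ℓ _ => (isLittleO_verticalIntegral_continuedIntegrand K ℓ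
      (baseConst_pos hK hθ hρ hγth)).const_mul_left _).neg_left
  refine h1.congr' ?_ EventuallyEq.rfl
  filter_upwards [eventually_gt_atTop 0] with γ hγ
  have hw : 0 < baseConst K θ ρ γth / γ := div_pos (baseConst_pos hK hθ hρ hγth) hγ
  rw [contourOutage_eq hK hθ hρ hγth hγ hL hκ, riceExpansion_eq hK hθ hρ hγth hγ,
    Complex.ofReal_sum, ← Finset.sum_sub_distrib, ← Finset.sum_neg_distrib]
  refine Finset.sum_congr rfl fun ℓ _ => ?_
  rw [iteratedDeriv_cpow_mul_varrhoC hK ℓ hw, Nat.sub_add_cancel (zeroCount_pos ℓ),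
    ← indexCoeff_mul_hopConst]
  push_cast
  ring

lemma integrable_contourIntegrand {M : ℕ} {K θ ρ : Fin (M + 1) → ℝ} {γth γ : ℝ} (hK : ∀ n, 0 ≤ K n)
    (hθ : ∀ n, 0 < θ n) (hρ : ∀ n, 0 < ρ n) (hγth : 0 < γth) (hγ : 0 < γ) (ℓ : Fin M → ℕ)
    {σ : ℝ} (hσ : σ < 0) :
    Integrable fun t : ℝ => contourIntegrand K θ ρ γth ℓ γ ((σ : ℂ) + t * Complex.I) := by
  have hw : 0 < baseConst K θ ρ γth / γ := div_pos (baseConst_pos hK hθ hρ hγth) hγ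
  have hne : ∀ t : ℝ, (σ : ℂ) + t * Complex.I ≠ 0 := fun t ht => by
    have := congrArg Complex.re ht
    simp at this
    linarith
  have e : (fun t : ℝ => contourIntegrand K θ ρ γth ℓ γ ((σ : ℂ) + t * Complex.I)) =
      fun t : ℝ => hopConst K θ ℓ *
        continuedIntegrand K ℓ (baseConst K θ ρ γth / γ) ((σ : ℂ) + t * Complex.I) := by
    funext t
    exact contourIntegrand_eq hK hθ hρ hγth hγ ℓ (hne t) (by simp; linarith)
  rw [e]
  refine Integrable.const_mul ?_ _
  obtain ⟨C, hC⟩ := exists_norm_continuedIntegrand_le hK ℓ hw σ σ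
  refine integrable_of_norm_le_div_sq (C := C) ?_ fun t ht => ?_
  · refine continuous_iff_continuousAt.mpr fun t => ?_
    refine ContinuousAt.comp (g := continuedIntegrand K ℓ (baseConst K θ ρ γth / γ))
      (f := fun t : ℝ => (σ : ℂ) + t * Complex.I) (DifferentiableAt.continuousAt (𝕜 := ℂ) ?_)
      (by fun_prop)
    refine (differentiableAt_const_cpow_of_pos hw _).mul
      (((differentiable_gammaQuot _ _).div differentiableAt_id (hne t)).mul
      (DifferentiableAt.fun_finsetProd fun n _ => ?_))
    refine DifferentiableAt.comp _ (differentiableAt_gammaKummer (hK n) ?_) (by fun_prop)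
    have : (0 : ℝ) ≤ lam ℓ n := Nat.cast_nonneg _
    simp
    linarith
  · simpa using hC (σ + t * Complex.I) (by simp) (by simp) (by simpa using ht)

/-! ### Asymptotics of the expansion -/

lemma isEquivalent_log_div {a : ℝ} (ha : 0 < a) :
    IsEquivalent atTop (fun γ : ℝ => Real.log (a / γ)) (fun γ : ℝ => -Real.log γ) := by
  have h1 : (fun γ : ℝ => Real.log a) =o[atTop] (fun γ : ℝ => -Real.log γ) :=
    (isLittleO_const_left.mpr (Or.inr
      (tendsto_norm_atTop_atTop.comp Real.tendsto_log_atTop))).neg_right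
  refine IsLittleO.congr' h1 ?_ EventuallyEq.rfl
  filter_upwards [eventually_gt_atTop 0] with γ hγ
  simp [Real.log_div ha.ne' hγ.ne']

lemma isLittleO_log_pow_div {l m : ℕ} (h : l < m) :
    (fun γ : ℝ => Real.log γ ^ l / γ) =o[atTop] (fun γ : ℝ => Real.log γ ^ m / γ) := by
  have h1 : (fun γ : ℝ => Real.log γ ^ l) =o[atTop] (fun γ : ℝ => Real.log γ ^ m) :=
    (isLittleO_pow_pow_atTop_of_lt h).comp_tendsto Real.tendsto_log_atTop
  simpa [div_eq_mul_inv] using h1.mul_isBigO (isBigO_refl (fun γ : ℝ => γ⁻¹) atTop)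

lemma isLittleO_div_mul_log_pow_sub {a : ℝ} (ha : 0 < a) (l : ℕ) :
    (fun γ : ℝ => a / γ * Real.log (a / γ) ^ l - (-1) ^ l * a * (Real.log γ ^ l / γ))
      =o[atTop] (fun γ : ℝ => Real.log γ ^ l / γ) := by
  have h1 := (IsEquivalent.refl (u := fun γ : ℝ => a / γ) (l := atTop)).mul
    ((isEquivalent_log_div ha).pow l)
  have h2 : (fun γ : ℝ => a / γ) * (fun γ : ℝ => -Real.log γ) ^ l =
      fun γ : ℝ => (-1) ^ l * a * (Real.log γ ^ l / γ) := by
    funext γ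
    simp only [Pi.mul_apply, Pi.pow_apply, neg_pow (Real.log γ)]
    ring
  rw [h2] at h1
  exact h1.isLittleO.trans_isBigO (isBigO_const_mul_self _ _ _)

/-- The contribution of one index to the expansion, without its constant. -/
def expansionTerm {M : ℕ} (K : Fin (M + 1) → ℝ) (ℓ : Fin M → ℕ) (a γ : ℝ) : ℝ :=
  a / γ * ∑ l ∈ Finset.range (zeroCount ℓ),
    varrhoDeriv K ℓ (zeroCount ℓ) (zeroCount ℓ - 1 - l) /
      (((zeroCount ℓ - 1 - l).factorial : ℝ) * (l.factorial : ℝ)) * Real.log (a / γ) ^ l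

/-- Only the top power `l = r` of the logarithm survives, with coefficient `ϱ(1)/r!`, and `log (a/γ)
~ -log γ` supplies the sign. -/
lemma isLittleO_expansionTerm_sub {M : ℕ} (K : Fin (M + 1) → ℝ) {ℓ : Fin M → ℕ} {a : ℝ} (ha : 0 < a)
    {r : ℕ} (hr : zeroCount ℓ = r + 1) :
    (fun γ : ℝ => expansionTerm K ℓ a γ -
      varrhoDeriv K ℓ (zeroCount ℓ) 0 / r.factorial * ((-1) ^ r * a * (Real.log γ ^ r / γ)))
      =o[atTop] (fun γ : ℝ => Real.log γ ^ r / γ) := by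
  have h1 := (isLittleO_div_mul_log_pow_sub ha r).const_mul_left
    (varrhoDeriv K ℓ (zeroCount ℓ) 0 / r.factorial)
  have h2 : ∀ l ∈ Finset.range r, (fun γ : ℝ => varrhoDeriv K ℓ (r + 1) (r - l) /
      (((r - l).factorial : ℝ) * (l.factorial : ℝ)) * (a / γ * Real.log (a / γ) ^ l))
      =o[atTop] (fun γ : ℝ => Real.log γ ^ r / γ) := by
    intro l hl
    refine IsLittleO.const_mul_left ?_ _
    have h3 := isLittleO_log_pow_div (Finset.mem_range.mp hl)
    have h4 := ((isLittleO_div_mul_log_pow_sub ha l).isBigO.trans_isLittleO h3).add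
      (h3.const_mul_left ((-1) ^ l * a))
    simpa using h4
  refine ((IsLittleO.fun_sum h2).add h1).congr_left fun γ => ?_
  rw [expansionTerm, hr, Finset.sum_range_succ]
  simp only [Nat.add_sub_cancel, Nat.sub_self, Nat.factorial_zero, Nat.cast_one, one_mul, mul_add,
    Finset.mul_sum]
  rw [Finset.sum_congr rfl fun l _ => mul_left_comm (a / γ) _ _]
  ring

lemma isBigO_expansionTerm {M : ℕ} (K : Fin (M + 1) → ℝ) {ℓ : Fin M → ℕ} {a : ℝ} (ha : 0 < a)
    {r : ℕ} (hr : zeroCount ℓ = r + 1) :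
    (expansionTerm K ℓ a) =O[atTop] (fun γ : ℝ => Real.log γ ^ r / γ) := by
  have h1 := (isLittleO_expansionTerm_sub K ha hr).isBigO.add
    (((isBigO_refl (fun γ : ℝ => Real.log γ ^ r / γ) atTop).const_mul_left ((-1) ^ r * a)).const_mul_left
      (varrhoDeriv K ℓ (zeroCount ℓ) 0 / r.factorial))
  simpa using h1

lemma isLittleO_expansionTerm {M : ℕ} (K : Fin (M + 1) → ℝ) {ℓ : Fin M → ℕ} {a : ℝ} (ha : 0 < a)
    {r : ℕ} (hr : zeroCount ℓ ≤ r) :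
    (expansionTerm K ℓ a) =o[atTop] (fun γ : ℝ => Real.log γ ^ r / γ) := by
  obtain ⟨q, hq⟩ := Nat.exists_eq_succ_of_ne_zero (zeroCount_pos ℓ).ne'
  exact (isBigO_expansionTerm K ha hq).trans_isLittleO (isLittleO_log_pow_div (by omega))

lemma varrhoDeriv_zero {M : ℕ} {K : Fin (M + 1) → ℝ} (hK : ∀ n, 0 ≤ K n) (ℓ : Fin M → ℕ) :
    ((varrhoDeriv K ℓ (zeroCount ℓ) 0 : ℝ) : ℂ) =
      gammaQuot (lam ℓ M) 1 * ∏ n : Fin (M + 1), hopFactor (K n) (lam ℓ n) 1 := by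
  rw [ofReal_varrhoDeriv hK, iteratedDeriv_zero, varrhoC, div_one]

lemma hopFactor_zero_one (K : ℝ) : hopFactor K 0 1 = -1 := by
  rw [hopFactor, if_pos rfl, sub_self, kummerC_zero, show (2 : ℂ) - 1 = 1 by norm_num,
    Complex.Gamma_one, one_mul]

lemma hopFactor_one_one (K : ℝ) : hopFactor K 1 1 = Complex.exp K := by
  rw [hopFactor, if_neg one_ne_zero, Nat.cast_one, add_sub_cancel_right, gammaKummer,
    Complex.Gamma_one, one_mul, kummerC_one]

lemma gammaQuot_one_of_two_le {j : ℕ} (hj : 2 ≤ j) : gammaQuot j 1 = 0 := by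
  obtain ⟨i, rfl⟩ := Nat.exists_eq_add_of_le hj
  rw [show 2 + i = (i + 1) + 1 by ring, gammaQuot, sub_self, one_mul,
    ascPochhammer_ne_zero_eval_zero _ (Nat.succ_ne_zero i)]

lemma zeroCount_zero {M : ℕ} : zeroCount (0 : Fin M → ℕ) = M + 1 := by
  simp [zeroCount, lam_zero_fun]

lemma eq_zero_of_zeroCount {M : ℕ} {ℓ : Fin M → ℕ} (h : zeroCount ℓ = M + 1) : ℓ = 0 := by
  refine lam_eq_zero_of_lam_top ?_
  have h1 : (Finset.univ.filter fun n : Fin (M + 1) => lam ℓ n = 0) = Finset.univ :=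
    Finset.card_eq_iff_eq_univ _ |>.mp (by simpa [zeroCount] using h)
  have h2 := Finset.mem_univ (Fin.last M)
  rw [← h1] at h2
  simpa using h2

lemma varrhoDeriv_zero_zero {M : ℕ} {K : Fin (M + 1) → ℝ} (hK : ∀ n, 0 ≤ K n) :
    varrhoDeriv K (0 : Fin M → ℕ) (M + 1) 0 = (-1) ^ M := by
  have h := varrhoDeriv_zero hK (0 : Fin M → ℕ)
  simp only [zeroCount_zero, lam_zero_fun, hopFactor_zero_one, gammaQuot, Finset.prod_const,
    Finset.card_univ, Fintype.card_fin, pow_succ] at h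
  have h2 : ((varrhoDeriv K (0 : Fin M → ℕ) (M + 1) 0 : ℝ) : ℂ) = (((-1) ^ M : ℝ) : ℂ) := by
    rw [h]
    push_cast
    ring
  exact_mod_cast h2

lemma riceExpansion_eq_sum_expansionTerm {M : ℕ} {K θ ρ : Fin (M + 1) → ℝ} {γth γ : ℝ}
    (hK : ∀ n, 0 ≤ K n) (hθ : ∀ n, 0 < θ n) (hρ : ∀ n, 0 < ρ n) (hγth : 0 < γth) (hγ : 0 < γ)
    (L : Fin M → ℕ) :
    riceExpansion K θ ρ γth L γ = ∑ ℓ ∈ box L, (-1) ^ lam ℓ M * zetaCoeff K θ ρ ℓ *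
      expansionTerm K ℓ (baseConst K θ ρ γth) γ :=
  riceExpansion_eq hK hθ hρ hγth hγ L

lemma zero_mem_box {M : ℕ} {L : Fin M → ℕ} (hL : ∀ k, 1 ≤ L k) : (0 : Fin M → ℕ) ∈ box L := by
  simp only [box, Fintype.mem_piFinset, Finset.mem_range]
  exact fun k => hL k

lemma riceLeading_eq {M : ℕ} (K θ ρ : Fin (M + 1) → ℝ) (γth γ : ℝ) :
    riceLeading K θ ρ γth γ = zetaCoeff K θ ρ 0 * (baseConst K θ ρ γth / M.factorial *
      (Real.log γ ^ M / γ)) := by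
  have h1 : zetaCoeff K θ ρ 0 = ∏ n, Real.exp (-K n) := by
    rw [Fin.prod_univ_castSucc, zetaCoeff, mul_comm]
    simp [lam_zero_fun]
  rw [riceLeading, h1, baseConst, Finset.prod_div_distrib, Finset.prod_mul_distrib]
  simp only [Real.exp_neg, Finset.prod_inv_distrib]
  field_simp

lemma isLittleO_riceExpansion_sub_riceLeading {M : ℕ} {K θ ρ : Fin (M + 1) → ℝ} {γth : ℝ}
    (hK : ∀ n, 0 ≤ K n) (hθ : ∀ n, 0 < θ n) (hρ : ∀ n, 0 < ρ n) (hγth : 0 < γth)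
    {L : Fin M → ℕ} (hL : ∀ k, 1 ≤ L k) :
    (fun γ => riceExpansion K θ ρ γth L γ - riceLeading K θ ρ γth γ)
      =o[atTop] (fun γ : ℝ => Real.log γ ^ M / γ) := by
  have ha := baseConst_pos hK hθ hρ hγth
  set a := baseConst K θ ρ γth with ha'
  have h1 := (isLittleO_expansionTerm_sub K (ℓ := 0) ha (zeroCount_zero (M := M))).const_mul_left
    ((-1) ^ lam (0 : Fin M → ℕ) M * zetaCoeff K θ ρ 0)
  have h2 : ∀ ℓ ∈ (box L).erase 0, (fun γ : ℝ => (-1) ^ lam ℓ M * zetaCoeff K θ ρ ℓ *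
      expansionTerm K ℓ a γ) =o[atTop] (fun γ : ℝ => Real.log γ ^ M / γ) := by
    intro ℓ hℓ
    have h3 : zeroCount ℓ ≠ M + 1 := fun h => (Finset.mem_erase.mp hℓ).1 (eq_zero_of_zeroCount h)
    exact (isLittleO_expansionTerm K ha (by have := zeroCount_le ℓ; omega)).const_mul_left _
  refine ((IsLittleO.fun_sum h2).add h1).congr' ?_ EventuallyEq.rfl
  filter_upwards [eventually_gt_atTop 0] with γ hγ
  rw [riceExpansion_eq_sum_expansionTerm hK hθ hρ hγth hγ L, ← ha',
    ← Finset.sum_erase_add _ _ (zero_mem_box hL), riceLeading_eq, zeroCount_zero,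
    varrhoDeriv_zero_zero hK, lam_zero_fun]
  -- One sign is `ϱ(1)` for `ℓ = 0`, the other comes from `(log (a/γ))^M`.
  have e : ((-1 : ℝ)) ^ M * (-1) ^ M = 1 := by rw [← mul_pow]; simp
  linear_combination (-(zetaCoeff K θ ρ 0 * a / M.factorial * (Real.log γ ^ M / γ))) * e

/-- The multi-index `(0, …, 0, 1)`. -/
def lastIndex (m : ℕ) : Fin (m + 1) → ℕ := Pi.single (Fin.last m) 1

lemma lam_lastIndex (m n : ℕ) : lam (lastIndex m) n = if m < n then 1 else 0 := by
  rw [lam, Finset.sum_filter]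
  simp only [lastIndex]
  rw [Finset.sum_eq_single (Fin.last m)]
  · simp
  · intro b _ hb
    simp [hb]
  · simp

lemma zeroCount_lastIndex (m : ℕ) : zeroCount (lastIndex m) = m + 1 :=
  zeroCount_eq_of (by omega) (by omega) (by simp [lam_lastIndex]) (by simp [lam_lastIndex])

lemma varrhoDeriv_lastIndex {m : ℕ} {K : Fin (m + 1 + 1) → ℝ} (hK : ∀ n, 0 ≤ K n) :
    varrhoDeriv K (lastIndex m) (m + 1) 0 = (-1) ^ (m + 1) * Real.exp (K (Fin.last (m + 1))) := by
  have h := varrhoDeriv_zero hK (lastIndex m)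
  rw [zeroCount_lastIndex, Fin.prod_univ_castSucc] at h
  have h1 : ∀ n : Fin (m + 1), hopFactor (K n.castSucc) (lam (lastIndex m) (n.castSucc : Fin (m + 2))) 1 = -1 := by
    intro n
    rw [lam_lastIndex, if_neg (by simp; omega), hopFactor_zero_one]
  rw [Finset.prod_congr rfl fun n _ => h1 n] at h
  simp only [lam_lastIndex, Fin.val_last, Finset.prod_const, Finset.card_univ, Fintype.card_fin,
    Nat.lt_succ_self, if_true, hopFactor_one_one] at h
  have h2 : ((varrhoDeriv K (lastIndex m) (m + 1) 0 : ℝ) : ℂ) =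
      (((-1) ^ (m + 1) * Real.exp (K (Fin.last (m + 1))) : ℝ) : ℂ) := by
    rw [h]
    simp [gammaQuot]
  exact_mod_cast h2

/-- All entries but the last vanish, so the last is at least 2, and then `Γ(λ - s)/Γ(1 - s)` has a
zero at `s = 1` that lowers the pole order. -/
lemma varrhoDeriv_eq_zero_of_ne_lastIndex {m : ℕ} {K : Fin (m + 1 + 1) → ℝ} (hK : ∀ n, 0 ≤ K n)
    {ℓ : Fin (m + 1) → ℕ} (h0 : zeroCount ℓ = m + 1) (hne : ℓ ≠ lastIndex m) :
    varrhoDeriv K ℓ (zeroCount ℓ) 0 = 0 := by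
  -- The bounds `ℓ k + 1` give some box containing `ℓ`, only to read the shape of `ℓ` off
  -- `mem_indexSet_iff`.
  have hmem : ℓ ∈ indexSet (fun k => ℓ k + 1) (m + 1) := by
    rw [mem_indexSet_iff (by omega) (by omega)]
    exact ⟨by simp [box], h0⟩
  rw [indexSet, Finset.mem_filter] at hmem
  obtain ⟨-, h1, h2⟩ := hmem
  have h3 : ∀ k : Fin (m + 1), k ≠ Fin.last m → ℓ k = 0 := by
    intro k hk
    simp only [lam, Finset.sum_eq_zero_iff, Finset.mem_filter, Finset.mem_univ, true_and] at h1
    refine h1 k ?_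
    have := Fin.val_lt_last hk
    omega
  have h4 : lam ℓ (m + 1) = ℓ (Fin.last m) := by
    rw [lam, Finset.filter_true_of_mem fun k _ => k.2, Finset.sum_eq_single (Fin.last m)]
    · exact fun b _ hb => h3 b hb
    · simp
  have h5 : 2 ≤ lam ℓ (m + 1) := by
    have h6 := h2 le_rfl
    by_contra! hlt
    refine hne (funext fun k => ?_)
    rcases eq_or_ne k (Fin.last m) with rfl | hk
    · simp only [lastIndex, Pi.single_eq_same]
      omega
    · simp only [lastIndex, Pi.single_eq_of_ne hk]
      exact h3 k hk
  have h := varrhoDeriv_zero hK ℓ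
  rw [gammaQuot_one_of_two_le h5, zero_mul] at h
  exact_mod_cast h

/-- In the term of `(0, …, 0, 1)` every trace of the last hop cancels: `e^{K_N}` against `e^{-K_N}`,
`θ_N/(K_N + 1)` against its inverse in `a`, and `ρ_{N-1}/ρ_N` turns `ρ_N` into `ρ_{N-1}`. What is
left is the leading term of the link without its last hop. -/
lemma riceLeading_castSucc {m : ℕ} {K θ ρ : Fin (m + 1 + 1) → ℝ} {γth : ℝ}
    (hK : ∀ n, 0 ≤ K n) (hθ : ∀ n, 0 < θ n) (hρ : ∀ n, 0 < ρ n) (γ : ℝ) :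
    riceLeading (fun n => K n.castSucc) (fun n => θ n.castSucc) (fun n => ρ n.castSucc) γth γ =
      zetaCoeff K θ ρ (lastIndex m) * Real.exp (K (Fin.last (m + 1))) *
        (baseConst K θ ρ γth / m.factorial * (Real.log γ ^ m / γ)) := by
  have h1 : zetaCoeff K θ ρ (lastIndex m) * Real.exp (K (Fin.last (m + 1))) =
      (∏ n : Fin (m + 1), Real.exp (-K n.castSucc)) *
        (ρ (Fin.last m).castSucc / ρ (Fin.last (m + 1))) *
        (θ (Fin.last (m + 1)) / (K (Fin.last (m + 1)) + 1)) := by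
    have e1 : ∏ k : Fin (m + 1), (ρ k.castSucc / ρ (Fin.last (m + 1))) ^ lastIndex m k =
        ρ (Fin.last m).castSucc / ρ (Fin.last (m + 1)) := by
      rw [Finset.prod_eq_single (Fin.last m)]
      · simp [lastIndex]
      · intro b _ hb
        simp [lastIndex, hb]
      · simp
    have e2 : ∏ k : Fin (m + 1), (θ k.succ / (K k.succ + 1)) ^ lam (lastIndex m) ((k : ℕ) + 1) =
        θ (Fin.last (m + 1)) / (K (Fin.last (m + 1)) + 1) := by
      rw [Finset.prod_eq_single (Fin.last m)]
      · simp [lam_lastIndex]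
      · intro b _ hb
        have := Fin.val_lt_last hb
        rw [lam_lastIndex, if_neg (by omega), pow_zero]
      · simp
    have e3 : ∏ k : Fin (m + 1), ((lastIndex m k).factorial : ℝ) = 1 := by
      refine Finset.prod_eq_one fun k _ => ?_
      rcases eq_or_ne k (Fin.last m) with rfl | hk
      · simp [lastIndex]
      · simp [lastIndex, hk]
    rw [zetaCoeff, Finset.prod_mul_distrib, Finset.prod_mul_distrib, e1, e2,
      Finset.prod_div_distrib, e3, Real.exp_neg (K (Fin.last (m + 1)))]
    field_simp
  rw [h1, riceLeading, baseConst, Finset.prod_div_distrib, Finset.prod_mul_distrib,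
    Fin.prod_univ_castSucc (n := m + 1) (fun n => K n + 1), Fin.prod_univ_castSucc (n := m + 1) θ]
  simp only [Real.exp_neg, Finset.prod_inv_distrib]
  have p1 := hρ (Fin.last (m + 1))
  have p2 := hθ (Fin.last (m + 1))
  have p3 : K (Fin.last (m + 1)) + 1 ≠ 0 := by linarith [hK (Fin.last (m + 1))]
  field_simp

/-- The all-ones expansion is the `ℓ = 0` term. Of the remaining indices only `lastIndex m` reaches
the power `(log γ)^m`. -/
lemma isLittleO_riceExpansion_sub_riceExpansion_one {m : ℕ} {K θ ρ : Fin (m + 1 + 1) → ℝ} {γth : ℝ}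
    (hK : ∀ n, 0 ≤ K n) (hθ : ∀ n, 0 < θ n) (hρ : ∀ n, 0 < ρ n) (hγth : 0 < γth)
    {L : Fin (m + 1) → ℕ} (hL : ∀ k, 2 ≤ L k) :
    (fun γ => riceExpansion K θ ρ γth L γ - riceExpansion K θ ρ γth (fun _ => 1) γ -
      riceLeading (fun n => K n.castSucc) (fun n => θ n.castSucc) (fun n => ρ n.castSucc) γth γ)
      =o[atTop] (fun γ : ℝ => Real.log γ ^ m / γ) := by
  have ha := baseConst_pos hK hθ hρ hγth
  set a := baseConst K θ ρ γth with ha'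
  have h1 := (isLittleO_expansionTerm_sub K ha (zeroCount_lastIndex m)).const_mul_left
    (-zetaCoeff K θ ρ (lastIndex m))
  have hne : lastIndex m ≠ 0 := fun h => by
    have := congrFun h (Fin.last m)
    simp [lastIndex] at this
  have hmem : lastIndex m ∈ (box L).erase 0 := by
    refine Finset.mem_erase.mpr ⟨hne, ?_⟩
    simp only [box, Fintype.mem_piFinset, Finset.mem_range]
    intro k
    have := hL k
    have h2 : lastIndex m k ≤ 1 := by
      rcases eq_or_ne k (Fin.last m) with rfl | hk
      · simp [lastIndex]
      · simp [lastIndex, hk]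
    omega
  have h2 : ∀ ℓ ∈ ((box L).erase 0).erase (lastIndex m),
      (fun γ : ℝ => (-1) ^ lam ℓ (m + 1) * zetaCoeff K θ ρ ℓ *
      expansionTerm K ℓ a γ) =o[atTop] (fun γ : ℝ => Real.log γ ^ m / γ) := by
    intro ℓ hℓ
    rw [Finset.mem_erase, Finset.mem_erase] at hℓ
    refine IsLittleO.const_mul_left ?_ _
    have h3 : zeroCount ℓ ≠ m + 1 + 1 := fun h => hℓ.2.1 (eq_zero_of_zeroCount h)
    have h4 := zeroCount_le ℓ
    rcases eq_or_ne (zeroCount ℓ) (m + 1) with h5 | h5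
    · have h6 := isLittleO_expansionTerm_sub K (ℓ := ℓ) ha h5
      rw [varrhoDeriv_eq_zero_of_ne_lastIndex hK h5 hℓ.1] at h6
      simpa using h6
    · exact isLittleO_expansionTerm K ha (by omega)
  refine ((IsLittleO.fun_sum h2).add h1).congr' ?_ EventuallyEq.rfl
  filter_upwards [eventually_gt_atTop 0] with γ hγ
  have hbox : box (fun _ : Fin (m + 1) => 1) = {0} := by
    ext ℓ
    simp [box, funext_iff]
  have e : ((-1 : ℝ)) ^ m * (-1) ^ m = 1 := by rw [← mul_pow]; simp
  rw [riceExpansion_eq_sum_expansionTerm hK hθ hρ hγth hγ L,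
    riceExpansion_eq_sum_expansionTerm hK hθ hρ hγth hγ, hbox, Finset.sum_singleton,
    ← Finset.sum_erase_add _ _ (zero_mem_box fun k => (by norm_num : 1 ≤ 2).trans (hL k)),
    add_sub_cancel_right, ← Finset.sum_erase_add _ _ hmem, riceLeading_castSucc hK hθ hρ,
    zeroCount_lastIndex, varrhoDeriv_lastIndex hK, lam_lastIndex, if_pos (Nat.lt_succ_self m),
    ← ha']
  rw [pow_succ]
  linear_combination (-zetaCoeff K θ ρ (lastIndex m) * Real.exp (K (Fin.last (m + 1))) *
    (a / m.factorial * (Real.log γ ^ m / γ))) * e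

/-! ### The Rician power law -/

lemma integral_ricianLaw {K θ : ℝ} (hK : 0 ≤ K) (hθ : 0 < θ) (g : ℝ → ℂ) :
    ∫ x, g x ∂(ricianLaw K θ) = ∫ x in Set.Ioi 0, g x * (ricianPDF K θ x : ℂ) := by
  rw [ricianLaw, integral_withDensity_eq_integral_toReal_smul
    (measurable_ricianPDF K θ).ennreal_ofReal (ae_of_all _ fun x => ENNReal.ofReal_lt_top),
    ← integral_Ici_eq_integral_Ioi, ← integral_indicator measurableSet_Ici]
  congr 1
  funext x
  rw [ENNReal.toReal_ofReal (ricianPDF_nonneg hK hθ x), Complex.real_smul, mul_comm]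
  by_cases hx : 0 ≤ x
  · rw [Set.indicator_of_mem (Set.mem_Ici.mpr hx)]
  · rw [Set.indicator_of_notMem (by simpa using hx), ricianPDF, if_neg hx]
    simp

lemma integral_cpow_ricianLaw {K θ : ℝ} (hK : 0 ≤ K) (hθ : 0 < θ) (s : ℂ) :
    ∫ x, (x : ℂ) ^ s ∂(ricianLaw K θ) = mellin (fun x => (ricianPDF K θ x : ℂ)) (1 + s) := by
  rw [integral_ricianLaw hK hθ, mellin]
  simp

lemma ricianLaw_eq_setLIntegral (K θ : ℝ) (s : Set ℝ) (hs : MeasurableSet s) :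
    ricianLaw K θ s = ∫⁻ x in s, ENNReal.ofReal (ricianPDF K θ x) := by
  rw [ricianLaw, withDensity_apply _ hs]

lemma mellin_ricianPDF_one {K θ : ℝ} (hK : 0 ≤ K) (hθ : 0 < θ) :
    mellin (fun x => (ricianPDF K θ x : ℂ)) 1 = 1 := by
  rw [mellin_ricianPDF hK hθ (by simp), sub_self, Complex.cpow_zero, gammaKummer,
    Complex.Gamma_one, kummerC_one, mul_one, one_mul, ← Complex.exp_add]
  simp

lemma isProbabilityMeasure_ricianLaw {K θ : ℝ} (hK : 0 ≤ K) (hθ : 0 < θ) :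
    IsProbabilityMeasure (ricianLaw K θ) := by
  have h1 := integral_ricianLaw hK hθ fun _ => 1
  have h2 := mellin_ricianPDF_one hK hθ
  simp only [mellin, sub_self, Complex.cpow_zero, one_smul] at h2
  simp only [one_mul, h2] at h1
  rw [integral_const, Complex.real_smul, mul_one] at h1
  have h3 : (ricianLaw K θ).real Set.univ = 1 := by exact_mod_cast h1
  constructor
  rw [measureReal_def] at h3
  rwa [ENNReal.toReal_eq_one_iff] at h3

lemma ricianLaw_absolutelyContinuous (K θ : ℝ) : ricianLaw K θ ≪ volume :=
  withDensity_absolutelyContinuous _ _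

lemma ae_pos_ricianLaw (K θ : ℝ) : ∀ᵐ x ∂(ricianLaw K θ), 0 < x := by
  have h1 : ∀ᵐ x ∂(ricianLaw K θ), 0 ≤ x := by
    rw [ae_iff]
    simp only [not_le]
    change ricianLaw K θ (Set.Iio 0) = 0
    rw [ricianLaw_eq_setLIntegral _ _ _ measurableSet_Iio]
    refine (setLIntegral_congr_fun measurableSet_Iio fun x hx => ?_).trans lintegral_zero
    simp [ricianPDF, not_le.mpr (Set.mem_Iio.mp hx)]
  have h2 : ∀ᵐ x ∂(ricianLaw K θ), x ≠ 0 :=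
    (ricianLaw_absolutelyContinuous K θ).ae_le (Measure.ae_ne volume 0)
  filter_upwards [h1, h2] with x hx hx'
  exact lt_of_le_of_ne hx hx'.symm

lemma noAtoms_ricianLaw (K θ : ℝ) (x : ℝ) : ricianLaw K θ {x} = 0 :=
  ricianLaw_absolutelyContinuous K θ (by simp)

lemma mellin_ricianPDF_ne_zero {K θ : ℝ} (hK : 0 ≤ K) (hθ : 0 < θ) {σ : ℝ} (hσ : 0 < σ) :
    mellin (fun x => (ricianPDF K θ x : ℂ)) σ ≠ 0 := by
  rw [mellin_ricianPDF hK hθ (by simpa using hσ)]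
  have hb0 : (((K + 1) / θ : ℝ) : ℂ) ≠ 0 := by
    have : 0 < (K + 1) / θ := by positivity
    exact_mod_cast this.ne'
  refine mul_ne_zero (mul_ne_zero (Complex.exp_ne_zero _) ?_) (gammaKummer_ofReal_ne_zero hK hσ)
  simp only [ne_eq, Complex.cpow_eq_zero_iff, hb0, false_and, not_false_iff]

/-! ### The Mellin transform of a tail -/

/-- Fubini with `∫_0^y z^{s-1} dz = y^s/s`; the same integral at exponent `Re s` gives the absolute
integrability. -/
lemma mellin_measureReal_Ici {ν : Measure ℝ} [IsProbabilityMeasure ν] (hν : ∀ᵐ y ∂ν, 0 < y)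
    {s : ℂ} (hs : 0 < s.re) (hint : Integrable (fun y : ℝ => (y : ℂ) ^ (s.re : ℂ)) ν) :
    MellinConvergent (fun z => (ν.real (Set.Ici z) : ℂ)) s ∧
    mellin (fun z => (ν.real (Set.Ici z) : ℂ)) s = (∫ y : ℝ, (y : ℂ) ^ s ∂ν) / s := by
  have hs0 : s ≠ 0 := fun h => by simp [h] at hs
  set g : ℝ → ℝ → ℂ := fun z y => (z : ℂ) ^ (s - 1) * Set.indicator (Set.Ici z) (fun _ => 1) y with hg
  have hgm : Measurable (Function.uncurry g) := by
    have h1 : MeasurableSet {p : ℝ × ℝ | p.1 ≤ p.2} := measurableSet_le measurable_fst measurable_snd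
    have h2 : Function.uncurry g = fun p : ℝ × ℝ => (p.1 : ℂ) ^ (s - 1) *
        Set.indicator {p : ℝ × ℝ | p.1 ≤ p.2} (fun _ => (1 : ℂ)) p := by
      funext p
      simp [hg, Function.uncurry, Set.indicator]
    rw [h2]
    exact Measurable.mul (by fun_prop) (measurable_const.indicator h1)
  have hzy : ∀ (a : ℂ) (y : ℝ), 0 < a.re → 0 < y →
      ∫ z in Set.Ioi (0 : ℝ), (z : ℂ) ^ (a - 1) * Set.indicator (Set.Ici z) (fun _ => (1 : ℂ)) y =
        (y : ℂ) ^ a / a := by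
    intro a y ha hy
    have ha0 : a ≠ 0 := fun h => by simp [h] at ha
    have h1 : ∀ z : ℝ, (z : ℂ) ^ (a - 1) * Set.indicator (Set.Ici z) (fun _ => (1 : ℂ)) y =
        Set.indicator (Set.Iic y) (fun z : ℝ => (z : ℂ) ^ (a - 1)) z := by
      intro z
      simp [Set.indicator]
    simp_rw [h1]
    rw [setIntegral_indicator measurableSet_Iic, Set.Ioi_inter_Iic,
      ← intervalIntegral.integral_of_le hy.le, integral_cpow (Or.inl (by simpa using ha))]
    simp [ha0]
  have hnorm : ∀ y : ℝ, 0 < y → ∫ z in Set.Ioi (0 : ℝ), ‖g z y‖ = ‖(y : ℂ) ^ (s.re : ℂ) / s.re‖ := by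
    intro y hy
    have h1 := hzy s.re y (by simpa using hs) hy
    have h2 : ∀ z ∈ Set.Ioi (0 : ℝ), (z : ℂ) ^ ((s.re : ℂ) - 1) *
        Set.indicator (Set.Ici z) (fun _ => (1 : ℂ)) y = ((‖g z y‖ : ℝ) : ℂ) := by
      intro z hz
      have hz0 : (0 : ℝ) < z := hz
      simp only [hg, norm_mul]
      rw [Complex.norm_cpow_eq_rpow_re_of_pos hz0]
      simp only [Set.indicator]
      split_ifs
      · simp [Complex.ofReal_cpow hz0.le]
      · simp
    rw [setIntegral_congr_fun measurableSet_Ioi h2, integral_complex_ofReal] at h1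
    rw [← h1, Complex.norm_of_nonneg]
    exact integral_nonneg fun z => norm_nonneg _
  have hgi : Integrable (Function.uncurry g) ((volume.restrict (Set.Ioi (0 : ℝ))).prod ν) := by
    rw [integrable_prod_iff' hgm.aestronglyMeasurable]
    constructor
    · filter_upwards [hν] with y hy
      have hsec : Measurable fun z => Function.uncurry g (z, y) :=
        hgm.comp (measurable_id.prodMk measurable_const)
      rw [← integrable_norm_iff hsec.aestronglyMeasurable]
      refine Integrable.of_integral_ne_zero ?_
      change ∫ z in Set.Ioi (0 : ℝ), ‖g z y‖ ≠ 0
      rw [hnorm y hy, norm_ne_zero_iff]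
      refine div_ne_zero ?_ (by exact_mod_cast hs.ne')
      have : (y : ℂ) ≠ 0 := by exact_mod_cast hy.ne'
      simp only [ne_eq, Complex.cpow_eq_zero_iff, this, false_and, not_false_iff]
    · refine ((hint.div_const (s.re : ℂ)).norm).congr ?_
      filter_upwards [hν] with y hy
      exact (hnorm y hy).symm
  have hin : ∀ z : ℝ, ∫ y, g z y ∂ν = (z : ℂ) ^ (s - 1) * (ν.real (Set.Ici z) : ℂ) := by
    intro z
    simp only [hg]
    rw [integral_const_mul, integral_indicator measurableSet_Ici, setIntegral_const,
      Complex.real_smul, mul_one]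
  constructor
  · have h1 := hgi.integral_prod_left
    refine h1.congr (ae_of_all _ fun z => ?_)
    simpa using hin z
  · have h1 := integral_integral_swap hgi
    simp_rw [hin] at h1
    rw [mellin]
    simp only [smul_eq_mul]
    rw [h1, ← integral_div]
    refine integral_congr_ae ?_
    filter_upwards [hν] with y hy
    exact hzy s y hs hy

lemma continuousAt_measureReal_Ici {ν : Measure ℝ} [IsProbabilityMeasure ν] {z : ℝ}
    (hz : ν {z} = 0) : ContinuousAt (fun z => (ν.real (Set.Ici z) : ℂ)) z := by
  have h1 : (fun z => (ν.real (Set.Ici z) : ℂ)) =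
      fun z => ∫ y, Set.indicator (Set.Ici z) (fun _ => (1 : ℂ)) y ∂ν := by
    funext z
    rw [integral_indicator measurableSet_Ici, setIntegral_const, Complex.real_smul, mul_one]
  rw [h1]
  refine continuousAt_of_dominated (bound := fun _ => 1)
    (Eventually.of_forall fun z => (measurable_const.indicator measurableSet_Ici).aestronglyMeasurable)
    (Eventually.of_forall fun z => ae_of_all _ fun y => ?_) (integrable_const _) ?_
  · simp only [Set.indicator]
    split_ifs <;> simp
  · have h2 : ∀ᵐ y ∂ν, y ≠ z := by
      rw [ae_iff]
      simpa using hz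
    filter_upwards [h2] with y hy
    refine ContinuousAt.congr (continuousAt_const
      (y := Set.indicator (Set.Ici z) (fun _ => (1 : ℂ)) y)) ?_
    rcases lt_or_gt_of_ne hy with h | h
    · filter_upwards [eventually_gt_nhds h] with t ht
      simp [Set.indicator, not_le.mpr h, not_le.mpr ht]
    · filter_upwards [eventually_lt_nhds h] with t ht
      simp [Set.indicator, h.le, ht.le]

/-! ### Products of independent Rician powers -/

/-- The pushforward along a map that is not a.e. measurable is the zero measure, which the law is
not. -/
lemma aemeasurable_of_map_eq_ricianLaw {Ω : Type*} [MeasurableSpace Ω] {μ : Measure Ω} {X : Ω → ℝ}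
    {K θ : ℝ} (hK : 0 ≤ K) (hθ : 0 < θ) (h : μ.map X = ricianLaw K θ) : AEMeasurable X μ := by
  have := isProbabilityMeasure_ricianLaw hK hθ
  refine AEMeasurable.of_map_ne_zero ?_
  rw [h]
  exact IsProbabilityMeasure.ne_zero _

lemma ae_pos_of_map_eq_ricianLaw {Ω : Type*} [MeasurableSpace Ω] {μ : Measure Ω} {X : Ω → ℝ}
    {K θ : ℝ} (hX : AEMeasurable X μ) (h : μ.map X = ricianLaw K θ) : ∀ᵐ ω ∂μ, 0 < X ω := by
  have h1 := ae_pos_ricianLaw K θ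
  rw [← h] at h1
  exact ae_of_ae_map hX h1

/-- The probability of `X < g(Z)`, for independent `X` and `Z`, as an integral over `Z`. -/
lemma measureReal_lt_of_indepFun {Ω β : Type*} [MeasurableSpace Ω] [MeasurableSpace β]
    {μ : Measure Ω} [IsProbabilityMeasure μ] {X : Ω → ℝ} {Z : Ω → β} (hX : AEMeasurable X μ)
    (hZ : AEMeasurable Z μ) (hXZ : IndepFun X Z μ) {g : β → ℝ} (hg : Measurable g) :
    μ.real {ω | X ω < g (Z ω)} = ∫ ω, (μ.map X).real (Set.Iio (g (Z ω))) ∂μ := by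
  have hp : IsProbabilityMeasure (μ.map X) := Measure.isProbabilityMeasure_map hX
  have hs : MeasurableSet {p : β × ℝ | p.2 < g p.1} :=
    measurableSet_lt measurable_snd (hg.comp measurable_fst)
  have h1 : μ {ω | X ω < g (Z ω)} = ∫⁻ z, (μ.map X) (Set.Iio (g z)) ∂(μ.map Z) := by
    have h2 : μ {ω | X ω < g (Z ω)} = (μ.map fun ω => (Z ω, X ω)) {p : β × ℝ | p.2 < g p.1} := by
      rw [Measure.map_apply_of_aemeasurable (hZ.prodMk hX) hs]
      rfl
    rw [h2, (indepFun_iff_map_prod_eq_prod_map_map hZ hX).mp hXZ.symm, Measure.prod_apply hs]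
    rfl
  have hm : Measurable fun z => (μ.map X) (Set.Iio (g z)) := measurable_measure_prodMk_left hs
  rw [measureReal_def, h1, lintegral_map' hm.aemeasurable hZ]
  simp only [measureReal_def]
  exact (integral_toReal (f := fun ω => (μ.map X) (Set.Iio (g (Z ω))))
    (hm.comp_aemeasurable hZ) (ae_of_all _ fun ω => measure_lt_top _ _)).symm

/-- Given the other factors, the event fixes `X_i` to at most one value, which has probability 0.
Mellin inversion needs this, as it recovers the tail only at continuity points. -/
lemma measure_prod_eq_zero {ι Ω : Type*} [Fintype ι] [MeasurableSpace Ω] {μ : Measure Ω}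
    [IsProbabilityMeasure μ] {X : ι → Ω → ℝ} {K θ : ι → ℝ} (hX : ∀ n, AEMeasurable (X n) μ)
    (hlaw : ∀ n, μ.map (X n) = ricianLaw (K n) (θ n)) (hindep : iIndepFun X μ) (i : ι)
    {z : ℝ} (hz : z ≠ 0) : μ {ω | ∏ n, X n ω = z} = 0 := by
  classical
  have hI := hindep.indepFun_finsetProd_of_notMem₀ hX (Finset.notMem_erase i Finset.univ)
  have hR : AEMeasurable (∏ j ∈ Finset.univ.erase i, X j) μ :=
    Finset.aemeasurable_prod _ fun j _ => hX j
  have hs : MeasurableSet {p : ℝ × ℝ | p.1 * p.2 = z} :=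
    measurableSet_eq_fun (measurable_fst.mul measurable_snd) measurable_const
  have hp : IsProbabilityMeasure (μ.map (X i)) := Measure.isProbabilityMeasure_map (hX i)
  have h2 : μ {ω | ∏ n, X n ω = z} =
      (μ.map fun ω => ((∏ j ∈ Finset.univ.erase i, X j) ω, X i ω)) {p : ℝ × ℝ | p.1 * p.2 = z} := by
    rw [Measure.map_apply_of_aemeasurable (hR.prodMk (hX i)) hs]
    congr 1
    ext ω
    simp only [Set.mem_ofPred_eq, Set.mem_preimage, Finset.prod_apply]
    rw [Finset.prod_erase_mul _ _ (Finset.mem_univ i)]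
  rw [h2, (indepFun_iff_map_prod_eq_prod_map_map hR (hX i)).mp hI, Measure.prod_apply hs,
    lintegral_eq_zero_of_ae_eq_zero]
  refine ae_of_all _ fun r => ?_
  rw [hlaw i]
  refine measure_mono_null (t := {z / r}) ?_ (noAtoms_ricianLaw _ _ _)
  intro x hx
  simp only [Set.mem_preimage, Set.mem_ofPred_eq] at hx
  have hr : r ≠ 0 := fun h => hz (by rw [← hx, h, zero_mul])
  rw [Set.mem_singleton_iff, ← hx]
  field_simp

lemma ofReal_prod_cpow {ι : Type*} (t : Finset ι) (x : ι → ℝ) (hx : ∀ i ∈ t, 0 ≤ x i) (s : ℂ) :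
    ((∏ i ∈ t, x i : ℝ) : ℂ) ^ s = ∏ i ∈ t, (x i : ℂ) ^ s := by
  classical
  induction t using Finset.induction_on with
  | empty => simp
  | insert a t ha ih =>
    rw [Finset.prod_insert ha, Finset.prod_insert ha, Complex.ofReal_mul,
      Complex.mul_cpow_ofReal_nonneg (hx a (Finset.mem_insert_self _ _))
        (Finset.prod_nonneg fun i hi => hx i (Finset.mem_insert_of_mem hi)),
      ih fun i hi => hx i (Finset.mem_insert_of_mem hi)]

lemma integral_prod_cpow {ι Ω : Type*} [Fintype ι] [MeasurableSpace Ω] {μ : Measure Ω}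
    [IsProbabilityMeasure μ] {X : ι → Ω → ℝ} {K θ : ι → ℝ} (hK : ∀ n, 0 ≤ K n) (hθ : ∀ n, 0 < θ n)
    (hX : ∀ n, AEMeasurable (X n) μ)
    (hlaw : ∀ n, μ.map (X n) = ricianLaw (K n) (θ n)) (hindep : iIndepFun X μ) (s : ℂ) :
    ∫ ω, ((∏ n, X n ω : ℝ) : ℂ) ^ s ∂μ =
      ∏ n, mellin (fun x => (ricianPDF (K n) (θ n) x : ℂ)) (1 + s) := by
  have hmeas : Measurable fun x : ℝ => (x : ℂ) ^ s := by fun_prop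
  have h1 := hindep.integral_fun_prod_comp (f := fun _ (x : ℝ) => (x : ℂ) ^ s) hX
    (fun n => hmeas.aestronglyMeasurable)
  have h2 : ∀ n, ∫ ω, (X n ω : ℂ) ^ s ∂μ =
      mellin (fun x => (ricianPDF (K n) (θ n) x : ℂ)) (1 + s) := by
    intro n
    rw [← integral_cpow_ricianLaw (hK n) (hθ n), ← hlaw n,
      integral_map (hX n) hmeas.aestronglyMeasurable]
  rw [← Finset.prod_congr rfl fun n _ => h2 n, ← h1]
  refine integral_congr_ae ?_
  filter_upwards [ae_all_iff.mpr fun n => ae_pos_of_map_eq_ricianLaw (hX n) (hlaw n)] with ω hω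
  exact ofReal_prod_cpow _ _ (fun n _ => (hω n).le) s

/-! ### The distribution of a product of independent Rician powers -/

lemma contourIntegrand_zero_neg {M : ℕ} {K θ ρ : Fin (M + 1) → ℝ} {γth γ : ℝ} {s : ℂ}
    (hs : 0 < s.re) : contourIntegrand K θ ρ γth (0 : Fin M → ℕ) γ (-s) =
      ((ρ (Fin.last M) * γth / γ : ℝ) : ℂ) ^ (-s) *
        ((∏ n, mellin (fun x => (ricianPDF (K n) (θ n) x : ℂ)) (1 + s)) / s) := by
  have hs0 : s ≠ 0 := fun h => by simp [h] at hs
  have h1 := Complex.Gamma_add_one s hs0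
  have h2 := Complex.Gamma_ne_zero_of_re_pos hs
  rw [contourIntegrand]
  simp only [lam_zero_fun, Nat.cast_zero, zero_add, add_zero, sub_neg_eq_add]
  rw [add_comm 1 s, h1]
  field_simp

/-- Mellin inversion of the tail of the product, whose transform is the product of the moments over
`s`. For `ℓ = 0` the contour integrand is this transform at `-s`, since `Γ(s)/Γ(1 + s) = 1/s`. -/
lemma measureReal_prod_lt_eq_contourOutage {M : ℕ} {Ω : Type*} [MeasurableSpace Ω] {μ : Measure Ω}
    [IsProbabilityMeasure μ] {X : Fin (M + 1) → Ω → ℝ} {K θ ρ : Fin (M + 1) → ℝ} {γth γ : ℝ}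
    (hK : ∀ n, 0 ≤ K n) (hθ : ∀ n, 0 < θ n) (hρ : ∀ n, 0 < ρ n) (hγth : 0 < γth) (hγ : 0 < γ)
    (hlaw : ∀ n, μ.map (X n) = ricianLaw (K n) (θ n)) (hindep : iIndepFun X μ)
    {κ : (Fin M → ℕ) → ℝ} (hκ : 0 < κ 0) :
    (μ.real {ω | ∏ n, X n ω < ρ (Fin.last M) * γth / γ} : ℂ) =
      contourOutage K θ ρ γth (fun _ => 1) κ γ := by
  have hX := fun n => aemeasurable_of_map_eq_ricianLaw (hK n) (hθ n) (hlaw n)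
  have hY : AEMeasurable (fun ω => ∏ n, X n ω) μ := by fun_prop
  set z := ρ (Fin.last M) * γth / γ with hz
  have hz0 : 0 < z := by
    have := hρ (Fin.last M)
    positivity
  set ν := μ.map (fun ω => ∏ n, X n ω) with hν
  have hνp : IsProbabilityMeasure ν := Measure.isProbabilityMeasure_map hY
  have hpos : ∀ᵐ y ∂ν, 0 < y := by
    rw [hν, ae_map_iff hY measurableSet_Ioi]
    filter_upwards [ae_all_iff.mpr fun n => ae_pos_of_map_eq_ricianLaw (hX n) (hlaw n)] with ω hω
    exact Finset.prod_pos fun n _ => hω n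
  have hE : ∀ s : ℂ, ∫ y : ℝ, (y : ℂ) ^ s ∂ν =
      ∏ n, mellin (fun x => (ricianPDF (K n) (θ n) x : ℂ)) (1 + s) := fun s => by
    have hmeas : Measurable fun x : ℝ => (x : ℂ) ^ s := by fun_prop
    rw [hν, integral_map hY hmeas.aestronglyMeasurable, integral_prod_cpow hK hθ hX hlaw hindep]
  have hM : ∀ s : ℂ, 0 < s.re → MellinConvergent (fun z => (ν.real (Set.Ici z) : ℂ)) s ∧
      mellin (fun z => (ν.real (Set.Ici z) : ℂ)) s =
        (∏ n, mellin (fun x => (ricianPDF (K n) (θ n) x : ℂ)) (1 + s)) / s := by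
    intro s hs
    rw [← hE s]
    -- A real moment that is nonzero is in particular finite.
    refine mellin_measureReal_Ici hpos hs (Integrable.of_integral_ne_zero ?_)
    rw [hE, Finset.prod_ne_zero_iff]
    intro n _
    have := mellin_ricianPDF_ne_zero (hK n) (hθ n) (σ := 1 + s.re) (by linarith)
    simpa using this
  set σ := κ 0 with hσ
  have hre : ∀ t : ℝ, 0 < ((σ : ℂ) + t * Complex.I).re := fun t => by simpa using hκ
  have hneg : ∀ γ' t : ℝ, contourIntegrand K θ ρ γth (0 : Fin M → ℕ) γ'
      (((-σ : ℝ) : ℂ) + (-t : ℝ) * Complex.I) =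
      ((ρ (Fin.last M) * γth / γ' : ℝ) : ℂ) ^ (-((σ : ℂ) + t * Complex.I)) *
        mellin (fun z => (ν.real (Set.Ici z) : ℂ)) ((σ : ℂ) + t * Complex.I) := by
    intro γ' t
    rw [(hM _ (hre t)).2, ← contourIntegrand_zero_neg (hre t)]
    congr 1
    push_cast
    ring
  have hVI : Complex.VerticalIntegrable (mellin fun z => (ν.real (Set.Ici z) : ℂ)) σ := by
    -- At `γ = ρ_N γ_th` the power in the contour integrand has base 1, which leaves the bare Mellin
    -- transform.
    have hg1 : 0 < ρ (Fin.last M) * γth := mul_pos (hρ _) hγth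
    have h1 := (integrable_contourIntegrand hK hθ hρ hγth hg1 (0 : Fin M → ℕ)
      (neg_lt_zero.mpr hκ)).comp_neg
    refine h1.congr (ae_of_all _ fun t => ?_)
    have h2 := hneg (ρ (Fin.last M) * γth) t
    rw [div_self hg1.ne', Complex.ofReal_one, Complex.one_cpow, one_mul] at h2
    exact h2
  have hinv := mellinInv_mellin_eq σ (fun z => (ν.real (Set.Ici z) : ℂ)) hz0
    (hM σ (by simpa using hκ)).1 hVI (continuousAt_measureReal_Ici (by
      rw [hν, Measure.map_apply_of_aemeasurable hY (measurableSet_singleton z)]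
      exact measure_prod_eq_zero hX hlaw hindep 0 hz0.ne'))
  have hVI2 : verticalIntegral (contourIntegrand K θ ρ γth (0 : Fin M → ℕ) γ) (-σ) =
      mellinInv σ (mellin fun z => (ν.real (Set.Ici z) : ℂ)) z := by
    rw [verticalIntegral, mellinInv, ← integral_neg_eq_self, Complex.real_smul]
    simp only [smul_eq_mul, hneg γ, ← hz]
    push_cast
    rfl
  have hbox : box (fun _ : Fin M => 1) = {0} := by
    ext ℓ
    simp [box, funext_iff]
  rw [contourOutage, hbox, Finset.sum_singleton, ← hσ, hVI2, hinv]
  have h3 : μ.real {ω | ∏ n, X n ω < z} = 1 - ν.real (Set.Ici z) := by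
    rw [← Set.compl_Iio, probReal_compl_eq_one_sub measurableSet_Iio, sub_sub_cancel, hν,
      measureReal_def, measureReal_def, Measure.map_apply_of_aemeasurable hY measurableSet_Iio]
    rfl
  rw [h3]
  simp [lam_zero_fun]

/-! ### Small-ball asymptotics of products of independent Rician powers -/

lemma isLittleO_inv_log_pow_div {m : ℕ} (hm : 0 < m) :
    (fun γ : ℝ => γ⁻¹) =o[atTop] (fun γ : ℝ => Real.log γ ^ m / γ) := by
  simpa using isLittleO_log_pow_div hm

lemma isBigO_inv_log_pow_div (m : ℕ) :
    (fun γ : ℝ => γ⁻¹) =O[atTop] (fun γ : ℝ => Real.log γ ^ m / γ) := by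
  rcases Nat.eq_zero_or_pos m with rfl | hm
  · simpa using isBigO_refl (fun γ : ℝ => γ⁻¹) atTop
  · exact (isLittleO_inv_log_pow_div hm).isBigO

lemma isLittleO_ofReal_left {f : ℝ → ℝ} {g : ℝ → ℝ} {l : Filter ℝ} :
    (fun x => (f x : ℂ)) =o[l] g ↔ f =o[l] g := by
  rw [← isLittleO_norm_left, ← isLittleO_norm_left (f' := f)]
  simp

lemma isLittleO_measureReal_prod_lt_sub_riceExpansion {M : ℕ} {Ω : Type*} [MeasurableSpace Ω]
    {μ : Measure Ω}
    [IsProbabilityMeasure μ] {X : Fin (M + 1) → Ω → ℝ} {K θ ρ : Fin (M + 1) → ℝ} {γth : ℝ}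
    (hK : ∀ n, 0 ≤ K n) (hθ : ∀ n, 0 < θ n) (hρ : ∀ n, 0 < ρ n) (hγth : 0 < γth)
    (hlaw : ∀ n, μ.map (X n) = ricianLaw (K n) (θ n)) (hindep : iIndepFun X μ) :
    (fun γ : ℝ => μ.real {ω | ∏ n, X n ω < ρ (Fin.last M) * γth / γ} -
      riceExpansion K θ ρ γth (fun _ => 1) γ) =o[atTop] (fun γ : ℝ => γ⁻¹) := by
  have h1 := isLittleO_contourOutage_sub_riceExpansion hK hθ hρ hγth (L := fun _ => 1)
    (fun _ => le_rfl) (κ := fun ℓ => lam ℓ M + 1) (fun ℓ _ => by linarith)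
  rw [← isLittleO_ofReal_left]
  refine h1.congr' ?_ EventuallyEq.rfl
  filter_upwards [eventually_gt_atTop 0] with γ hγ
  rw [← measureReal_prod_lt_eq_contourOutage hK hθ hρ hγth hγ hlaw hindep (by
    positivity)]
  push_cast
  rfl

lemma isLittleO_measureReal_prod_lt_sub_riceLeading {M : ℕ} {Ω : Type*} [MeasurableSpace Ω]
    {μ : Measure Ω}
    [IsProbabilityMeasure μ] {X : Fin (M + 1) → Ω → ℝ} {K θ ρ : Fin (M + 1) → ℝ} {γth : ℝ}
    (hK : ∀ n, 0 ≤ K n) (hθ : ∀ n, 0 < θ n) (hρ : ∀ n, 0 < ρ n) (hγth : 0 < γth)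
    (hlaw : ∀ n, μ.map (X n) = ricianLaw (K n) (θ n)) (hindep : iIndepFun X μ) :
    (fun γ : ℝ => μ.real {ω | ∏ n, X n ω < ρ (Fin.last M) * γth / γ} -
      riceLeading K θ ρ γth γ) =o[atTop] (fun γ : ℝ => Real.log γ ^ M / γ) := by
  have h1 := (isLittleO_measureReal_prod_lt_sub_riceExpansion hK hθ hρ hγth hlaw
    hindep).trans_isBigO (isBigO_inv_log_pow_div M)
  have h2 := isLittleO_riceExpansion_sub_riceLeading hK hθ hρ hγth (L := fun _ => 1) fun _ => le_rfl
  simpa using h1.add h2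

lemma isBigO_riceLeading {M : ℕ} (K θ ρ : Fin (M + 1) → ℝ) (γth : ℝ) :
    riceLeading K θ ρ γth =O[atTop] (fun γ : ℝ => Real.log γ ^ M / γ) :=
  (isBigO_refl _ _).const_mul_left _

lemma isBigO_measureReal_prod_lt {M : ℕ} {Ω : Type*} [MeasurableSpace Ω] {μ : Measure Ω}
    [IsProbabilityMeasure μ] {X : Fin (M + 1) → Ω → ℝ} {K θ : Fin (M + 1) → ℝ}
    (hK : ∀ n, 0 ≤ K n) (hθ : ∀ n, 0 < θ n)
    (hlaw : ∀ n, μ.map (X n) = ricianLaw (K n) (θ n)) (hindep : iIndepFun X μ) {c : ℝ} (hc : 0 < c) :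
    (fun γ : ℝ => μ.real {ω | ∏ n, X n ω < c / γ}) =O[atTop] (fun γ : ℝ => Real.log γ ^ M / γ) := by
  have h1 := (isLittleO_measureReal_prod_lt_sub_riceLeading hK hθ (ρ := fun _ => 1)
    (fun _ => one_pos) hc hlaw hindep).isBigO.add (isBigO_riceLeading K θ (fun _ => 1) c)
  simpa using h1

lemma isLittleO_measureReal_prod_lt {m : ℕ} {Ω : Type*} [MeasurableSpace Ω] {μ : Measure Ω}
    [IsProbabilityMeasure μ] {X : Fin m → Ω → ℝ} {K θ : Fin m → ℝ}
    (hK : ∀ n, 0 ≤ K n) (hθ : ∀ n, 0 < θ n)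
    (hlaw : ∀ n, μ.map (X n) = ricianLaw (K n) (θ n)) (hindep : iIndepFun X μ) {c : ℝ} (hc : 0 < c) :
    (fun γ : ℝ => μ.real {ω | ∏ n, X n ω < c / γ}) =o[atTop] (fun γ : ℝ => Real.log γ ^ m / γ) := by
  cases m with
  | zero =>
    -- The empty product is 1, so the event is empty once `γ ≥ c`.
    refine (isLittleO_zero _ _).congr' ?_ EventuallyEq.rfl
    filter_upwards [eventually_gt_atTop 0, eventually_ge_atTop c] with γ hγ hγc
    have h1 : ¬ 1 < c / γ := not_lt.mpr ((div_le_one hγ).mpr hγc)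
    simp [h1]
  | succ m =>
    exact (isBigO_measureReal_prod_lt hK hθ hlaw hindep hc).trans_isLittleO
      (isLittleO_log_pow_div (Nat.lt_succ_self m))

/-! ### The distribution function of the Rician power law -/

/-- Each Gamma density of the mixture is at most its rate, as `y^k e^{-y}/k! ≤ 1`. This makes the
distribution function Lipschitz. -/
lemma ricianPDF_le {K θ : ℝ} (hK : 0 ≤ K) (hθ : 0 < θ) {x : ℝ} (hx : 0 ≤ x) :
    ricianPDF K θ x ≤ (K + 1) / θ := by
  have hb : 0 < (K + 1) / θ := by positivity
  have h1 : HasSum (fun k : ℕ => Real.exp (-K) * ((K + 1) / θ) * (K ^ k / (k.factorial : ℝ)))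
      (Real.exp (-K) * ((K + 1) / θ) * Real.exp K) := by
    have := NormedSpace.expSeries_div_hasSum_exp K
    rw [← Real.exp_eq_exp_ℝ] at this
    exact this.mul_left _
  have h2 := hasSum_le (fun k => ?_) (hasSum_ricianPDF hK hθ hx) h1
  · refine h2.trans (le_of_eq ?_)
    rw [mul_right_comm, ← Real.exp_add]
    simp
  · have h3 : ((K + 1) / θ * x) ^ k / (k.factorial : ℝ) * Real.exp (-((K + 1) / θ * x)) ≤ 1 := by
      rw [Real.exp_neg, ← div_eq_mul_inv, div_le_one (Real.exp_pos _)]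
      exact Real.pow_div_factorial_le_exp _ (by positivity) k
    calc _ = Real.exp (-K) * ((K + 1) / θ) * (K ^ k / (k.factorial : ℝ)) *
          (((K + 1) / θ * x) ^ k / (k.factorial : ℝ) * Real.exp (-((K + 1) / θ * x))) := by
          ring
      _ ≤ _ := mul_le_of_le_one_right (by positivity) h3

lemma ricianPDF_zero (K θ : ℝ) : ricianPDF K θ 0 = θ⁻¹ * (K + 1) * Real.exp (-K) := by
  have h1 : besselI0 0 = 1 := by
    rw [besselI0, tsum_eq_single 0]
    · simp
    · intro k hk
      simp [hk]
  simp [ricianPDF, h1]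

/-- The distribution function of the Rician power law, strict version. -/
def ricianCDF (K θ t : ℝ) : ℝ := (ricianLaw K θ).real (Set.Iio t)

lemma ricianCDF_nonneg (K θ t : ℝ) : 0 ≤ ricianCDF K θ t := measureReal_nonneg

lemma ricianCDF_le_one {K θ : ℝ} (hK : 0 ≤ K) (hθ : 0 < θ) (t : ℝ) : ricianCDF K θ t ≤ 1 := by
  have := isProbabilityMeasure_ricianLaw hK hθ
  exact measureReal_le_one

lemma ricianCDF_mono {K θ : ℝ} (hK : 0 ≤ K) (hθ : 0 < θ) : Monotone (ricianCDF K θ) := by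
  have := isProbabilityMeasure_ricianLaw hK hθ
  exact fun s t hst => measureReal_mono (Set.Iio_subset_Iio hst)

lemma ricianCDF_zero (K θ : ℝ) : ricianCDF K θ 0 = 0 := by
  have h1 := ae_pos_ricianLaw K θ
  rw [ae_iff] at h1
  rw [ricianCDF, measureReal_def, measure_mono_null (fun x hx => ?_) h1, ENNReal.toReal_zero]
  simpa using le_of_lt hx

lemma ricianCDF_sub {K θ : ℝ} (hK : 0 ≤ K) (hθ : 0 < θ) {x y : ℝ} (hxy : x ≤ y) :
    ricianCDF K θ y - ricianCDF K θ x = (ricianLaw K θ).real (Set.Ico x y) := by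
  have := isProbabilityMeasure_ricianLaw hK hθ
  rw [ricianCDF, ricianCDF, ← Set.Iio_union_Ico_eq_Iio hxy, measureReal_union _ measurableSet_Ico]
  · ring
  · exact Set.disjoint_left.mpr fun t h1 h2 => not_lt.mpr h2.1 h1

lemma ricianCDF_sub_le {K θ : ℝ} (hK : 0 ≤ K) (hθ : 0 < θ) {x y B : ℝ} (hxy : x ≤ y)
    (hB : ∀ t ∈ Set.Ico x y, ricianPDF K θ t ≤ B) (hB0 : 0 ≤ B) :
    ricianCDF K θ y - ricianCDF K θ x ≤ B * (y - x) := by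
  rw [ricianCDF_sub hK hθ hxy, measureReal_def]
  refine ENNReal.toReal_le_of_le_ofReal (mul_nonneg hB0 (by linarith)) ?_
  rw [ricianLaw_eq_setLIntegral _ _ _ measurableSet_Ico, ENNReal.ofReal_mul hB0, ← Real.volume_Ico,
    ← setLIntegral_const]
  exact setLIntegral_mono measurable_const fun t ht => ENNReal.ofReal_le_ofReal (hB t ht)

lemma le_ricianCDF_sub {K θ : ℝ} (hK : 0 ≤ K) (hθ : 0 < θ) {x y B : ℝ} (hxy : x ≤ y)
    (hB : ∀ t ∈ Set.Ico x y, B ≤ ricianPDF K θ t) (hB0 : 0 ≤ B) :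
    B * (y - x) ≤ ricianCDF K θ y - ricianCDF K θ x := by
  have := isProbabilityMeasure_ricianLaw hK hθ
  rw [ricianCDF_sub hK hθ hxy, measureReal_def]
  refine (ENNReal.ofReal_le_iff_le_toReal (measure_ne_top _ _)).mp ?_
  rw [ricianLaw_eq_setLIntegral _ _ _ measurableSet_Ico, ENNReal.ofReal_mul hB0, ← Real.volume_Ico,
    ← setLIntegral_const]
  exact setLIntegral_mono (measurable_ricianPDF K θ).ennreal_ofReal
    fun t ht => ENNReal.ofReal_le_ofReal (hB t ht)

lemma exists_abs_ricianPDF_sub_le (K θ : ℝ) {η : ℝ} (hη : 0 < η) :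
    ∃ δ > 0, ∀ t, 0 ≤ t → t ≤ δ → |ricianPDF K θ t - ricianPDF K θ 0| ≤ η := by
  have h1 := (continuousOn_ricianPDF K θ) 0 (Set.mem_Ici.mpr le_rfl)
  obtain ⟨δ, hδ, h2⟩ := Metric.continuousWithinAt_iff.mp h1 η hη
  refine ⟨δ / 2, by positivity, fun t ht ht' => ?_⟩
  have := h2 (Set.mem_Ici.mpr ht) (by rw [Real.dist_eq, sub_zero, abs_of_nonneg ht]; linarith)
  exact this.le

lemma exists_mul_min_le_ricianCDF {K θ : ℝ} (hK : 0 ≤ K) (hθ : 0 < θ) :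
    ∃ c > 0, ∀ y, 0 ≤ y → c * min 1 y ≤ ricianCDF K θ y := by
  have hf0 : 0 < ricianPDF K θ 0 := by
    rw [ricianPDF_zero]
    positivity
  obtain ⟨δ, hδ, h1⟩ := exists_abs_ricianPDF_sub_le K θ (half_pos hf0)
  refine ⟨ricianPDF K θ 0 / 2 * min 1 δ, by positivity, fun y hy => ?_⟩
  have h2 := le_ricianCDF_sub hK hθ (x := 0) (y := min δ y) (B := ricianPDF K θ 0 / 2)
    (le_min hδ.le hy) (fun t ht => ?_) (by positivity)
  · rw [ricianCDF_zero, sub_zero, sub_zero] at h2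
    refine le_trans ?_ (h2.trans (ricianCDF_mono hK hθ (min_le_right _ _)))
    rw [mul_assoc]
    refine mul_le_mul_of_nonneg_left ?_ (by positivity)
    refine le_min ?_ ?_
    · exact (mul_le_of_le_one_right (le_min zero_le_one hδ.le) (min_le_left _ _)).trans
        (min_le_right _ _)
    · exact (mul_le_of_le_one_left (le_min zero_le_one hy) (min_le_left _ _)).trans
        (min_le_right _ _)
  · have := (abs_le.mp (h1 t ht.1 (ht.2.le.trans (min_le_left _ _)))).1
    linarith

lemma exists_abs_ricianCDF_add_sub_le {K θ : ℝ} (hK : 0 ≤ K) (hθ : 0 < θ) {η : ℝ} (hη : 0 < η) :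
    ∃ δ > 0, ∀ x y, 0 ≤ x → 0 ≤ y → x ≤ δ → y ≤ δ →
      |ricianCDF K θ (x + y) - ricianCDF K θ x - ricianCDF K θ y| ≤ η * y := by
  have hf0 : 0 < ricianPDF K θ 0 := by
    rw [ricianPDF_zero]
    positivity
  -- Half of `η` each for the increment at `x` and the one at 0; the cap keeps the lower bound `f(0)
  -- - η'` on the density nonnegative.
  set η' := min (η / 2) (ricianPDF K θ 0) with hη'
  have hη0 : 0 < η' := lt_min (half_pos hη) hf0
  obtain ⟨δ, hδ, h1⟩ := exists_abs_ricianPDF_sub_le K θ hη0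
  have hle : η' ≤ ricianPDF K θ 0 := min_le_right _ _
  have hle2 : η' ≤ η / 2 := min_le_left _ _
  have key : ∀ x y, 0 ≤ x → x ≤ y → y ≤ δ →
      (ricianPDF K θ 0 - η') * (y - x) ≤ ricianCDF K θ y - ricianCDF K θ x ∧
      ricianCDF K θ y - ricianCDF K θ x ≤ (ricianPDF K θ 0 + η') * (y - x) := by
    intro x y hx hxy hy
    have h2 : ∀ t ∈ Set.Ico x y, |ricianPDF K θ t - ricianPDF K θ 0| ≤ η' := fun t ht =>
      h1 t (hx.trans ht.1) (ht.2.le.trans hy)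
    exact ⟨le_ricianCDF_sub hK hθ hxy (fun t ht => by linarith [(abs_le.mp (h2 t ht)).1])
        (by linarith), ricianCDF_sub_le hK hθ hxy
        (fun t ht => by linarith [(abs_le.mp (h2 t ht)).2]) (by linarith)⟩
  refine ⟨δ / 2, by positivity, fun x y hx hy hxδ hyδ => ?_⟩
  have k1 := key x (x + y) hx (by linarith) (by linarith)
  have k2 := key 0 y le_rfl hy (by linarith)
  rw [ricianCDF_zero] at k2
  have k3 : η' * y ≤ η / 2 * y := mul_le_mul_of_nonneg_right hle2 hy
  rw [abs_le]
  constructor <;> nlinarith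

/-- The distribution function is additive up to small errors. -/
lemma exists_abs_ricianCDF_sum_sub_le {K θ : ℝ} (hK : 0 ≤ K) (hθ : 0 < θ) :
    ∃ C > 0, ∀ η > 0, ∃ δ > 0, ∀ x y : ℝ, ∀ (m : ℕ) (a : Fin m → ℝ), 0 ≤ x → 0 ≤ y → (∀ i, 0 ≤ a i) →
      |ricianCDF K θ (∑ i, a i + y + x) - ricianCDF K θ x - ricianCDF K θ y| ≤
        C * ∑ i, ricianCDF K θ (a i) + η * ricianCDF K θ y +
          C * (if δ < x then ricianCDF K θ y else 0) + (if δ < y then 1 else 0) := by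
  obtain ⟨c, hc, hcF⟩ := exists_mul_min_le_ricianCDF hK hθ
  set b := (K + 1) / θ with hb
  have hb0 : 0 < b := by positivity
  have hlip : ∀ x y, 0 ≤ x → 0 ≤ y → ricianCDF K θ (x + y) - ricianCDF K θ x ≤ (1 + b) * min 1 y := by
    intro x y hx hy
    have h1 := ricianCDF_sub_le hK hθ (x := x) (y := x + y) (B := b) (by linarith)
      (fun t ht => ricianPDF_le hK hθ (hx.trans ht.1)) hb0.le
    have h2 := ricianCDF_le_one hK hθ (x + y)
    have h3 := ricianCDF_nonneg K θ x
    rcases le_total 1 y with h | h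
    · rw [min_eq_left h]; linarith
    · rw [min_eq_right h]; nlinarith
  -- An increment over length `y` is at most `(1 + b) min(1, y)`, while `F(y) ≥ c min(1, y)`, so
  -- increments are controlled by `F(y)` itself.
  set C := (1 + b) / c with hC
  have hC0 : 0 < C := by positivity
  have hlipF : ∀ x y, 0 ≤ x → 0 ≤ y →
      ricianCDF K θ (x + y) - ricianCDF K θ x ≤ C * ricianCDF K θ y := by
    intro x y hx hy
    refine (hlip x y hx hy).trans ?_
    rw [hC, div_mul_eq_mul_div, le_div_iff₀ hc]
    have := hcF y hy
    nlinarith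
  have hsum : ∀ (m : ℕ) (a : Fin m → ℝ) (x : ℝ), 0 ≤ x → (∀ i, 0 ≤ a i) →
      ricianCDF K θ (x + ∑ i, a i) - ricianCDF K θ x ≤ C * ∑ i, ricianCDF K θ (a i) := by
    intro m
    induction m with
    | zero => intro a x _ _; simp
    | succ m ih =>
      intro a x hx ha
      rw [Fin.sum_univ_succ, Fin.sum_univ_succ, ← add_assoc]
      have h1 := ih (fun i => a i.succ) (x + a 0) (add_nonneg hx (ha 0)) fun i => ha _
      have h2 := hlipF x (a 0) hx (ha 0)
      linarith
  refine ⟨C + 1, by positivity, fun η hη => ?_⟩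
  -- For `y ≤ 1` the error `η c y` is at most `η F(y)`; hence the threshold `min δ 1` below.
  obtain ⟨δ, hδ, hadd⟩ := exists_abs_ricianCDF_add_sub_le hK hθ (mul_pos hη hc)
  refine ⟨min δ 1, lt_min hδ one_pos, fun x y m a hx hy ha => ?_⟩
  have hFx := ricianCDF_nonneg K θ x
  have hFy := ricianCDF_nonneg K θ y
  have h1 := hsum m a (y + x) (by linarith) ha
  have h1' := ricianCDF_mono hK hθ (show y + x ≤ y + x + ∑ i, a i by
    linarith [Finset.sum_nonneg fun i (_ : i ∈ Finset.univ) => ha i])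
  have hS : 0 ≤ ∑ i, ricianCDF K θ (a i) := Finset.sum_nonneg fun i _ => ricianCDF_nonneg K θ _
  rw [show ∑ i, a i + y + x = y + x + ∑ i, a i by ring]
  have h2 : |ricianCDF K θ (y + x) - ricianCDF K θ x - ricianCDF K θ y| ≤ η * ricianCDF K θ y +
      (C + 1) * (if min δ 1 < x then ricianCDF K θ y else 0) + (if min δ 1 < y then 1 else 0) := by
    have h3 := hlipF x y hx hy
    have h4 := ricianCDF_mono hK hθ (show x ≤ x + y by linarith)
    have h5 := ricianCDF_le_one hK hθ (x + y)
    have h6 := ricianCDF_le_one hK hθ y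
    have h7 : 0 ≤ η * ricianCDF K θ y := by positivity
    have h8 : 0 ≤ C * ricianCDF K θ y := by positivity
    rw [add_comm y x]
    split_ifs with i1 i2 i2
    · rw [abs_le]; constructor <;> linarith
    · rw [abs_le]; constructor <;> linarith
    · rw [abs_le]; constructor <;> linarith
    · push Not at i1 i2
      refine (hadd x y hx hy (i1.trans (min_le_left _ _)) (i2.trans (min_le_left _ _))).trans ?_
      have h9 := hcF y hy
      rw [min_eq_right (i2.trans (min_le_right _ _))] at h9
      nlinarith
  calc |ricianCDF K θ (y + x + ∑ i, a i) - ricianCDF K θ x - ricianCDF K θ y|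
      ≤ |ricianCDF K θ (y + x + ∑ i, a i) - ricianCDF K θ (y + x)| +
        |ricianCDF K θ (y + x) - ricianCDF K θ x - ricianCDF K θ y| := by
        refine le_trans (le_of_eq ?_) (abs_add_le _ _)
        congr 1
        ring
    _ ≤ _ := by
        rw [abs_of_nonneg (by linarith)]
        nlinarith

/-! ### The outage event -/

/-- The `n`-th summand of the end-to-end noise, as a function of the powers of the later hops. -/
def noiseTerm {m : ℕ} (ρ : Fin (m + 2) → ℝ) (n : Fin (m + 2)) (z : Fin (m + 1) → ℝ) : ℝ :=
  ρ n / ∏ j : Fin n, z (Fin.castLE (Nat.lt_succ_iff.mp n.2) j)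

lemma measurable_noiseTerm {m : ℕ} (ρ : Fin (m + 2) → ℝ) (n : Fin (m + 2)) :
    Measurable (noiseTerm ρ n) := by
  unfold noiseTerm
  fun_prop

lemma noiseTerm_pos {m : ℕ} {ρ : Fin (m + 2) → ℝ} (hρ : ∀ n, 0 < ρ n) (n : Fin (m + 2))
    {z : Fin (m + 1) → ℝ} (hz : ∀ i, 0 < z i) : 0 < noiseTerm ρ n z :=
  div_pos (hρ n) (Finset.prod_pos fun _ _ => hz _)

lemma prod_Ioi_mul_prod_castLE {m : ℕ} (n : Fin (m + 2)) (x : Fin (m + 2) → ℝ) :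
    (∏ j ∈ Finset.Ioi n, x j) * ∏ j : Fin n, x (Fin.castLE (Nat.lt_succ_iff.mp n.2) j).succ =
      ∏ i : Fin (m + 1), x i.succ := by
  have h1 : ∏ j ∈ Finset.Ioi n, x j = ∏ i : Fin (m + 1), if (n : ℕ) ≤ i then x i.succ else 1 := by
    rw [show Finset.Ioi n = Finset.univ.filter fun j => n < j by ext; simp, Finset.prod_filter,
      Fin.prod_univ_succ, if_neg (by simp), one_mul]
    refine Finset.prod_congr rfl fun i _ => ?_
    simp only [Fin.lt_def, Fin.val_succ, Nat.lt_succ_iff]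
  have h2 : ∏ j : Fin n, x (Fin.castLE (Nat.lt_succ_iff.mp n.2) j).succ =
      ∏ i : Fin (m + 1), if (n : ℕ) ≤ i then 1 else x i.succ := by
    have h3 : (Finset.univ : Finset (Fin n)).map
        (Fin.castLEEmb (Nat.lt_succ_iff.mp n.2) : Fin n ↪ Fin (m + 1)) =
        Finset.univ.filter fun i : Fin (m + 1) => (i : ℕ) < n := by
      ext i
      simp only [Finset.mem_map, Finset.mem_univ, true_and, Finset.mem_filter]
      constructor
      · rintro ⟨j, rfl⟩
        exact j.2
      · intro hi
        exact ⟨⟨i, hi⟩, rfl⟩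
    have h4 := Finset.prod_map (Finset.univ : Finset (Fin n))
      (Fin.castLEEmb (Nat.lt_succ_iff.mp n.2) : Fin n ↪ Fin (m + 1)) (fun i => x i.succ)
    rw [h3, Finset.prod_filter] at h4
    refine Eq.trans h4.symm (Finset.prod_congr rfl fun i _ => ?_)
    by_cases hi : (i : ℕ) < n
    · rw [if_pos hi, if_neg (not_le.mpr hi)]
    · rw [if_neg hi, if_pos (not_lt.mp hi)]
  rw [h1, h2, ← Finset.prod_mul_distrib]
  refine Finset.prod_congr rfl fun i _ => ?_
  split_ifs <;> simp

/-- Divide numerator and denominator of the SNR by the product of all hops but the first. -/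
lemma snr_lt_iff {m : ℕ} {ρ x : Fin (m + 2) → ℝ} (hρ : ∀ n, 0 < ρ n) (hx : ∀ n, 0 < x n)
    {γth γ : ℝ} (hγ : 0 < γ) :
    (∏ n, x n) / (∑ n, ρ n * ∏ j ∈ Finset.Ioi n, x j) * γ < γth ↔
      x 0 < γth / γ * ∑ n, noiseTerm ρ n (fun i => x i.succ) := by
  have hD : 0 < ∏ i : Fin (m + 1), x i.succ := Finset.prod_pos fun i _ => hx _
  have hS : 0 < ∑ n, noiseTerm ρ n (fun i => x i.succ) :=
    Finset.sum_pos (fun n _ => noiseTerm_pos hρ n fun i => hx _) Finset.univ_nonempty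
  have h1 : ∑ n, ρ n * ∏ j ∈ Finset.Ioi n, x j =
      (∏ i : Fin (m + 1), x i.succ) * ∑ n, noiseTerm ρ n (fun i => x i.succ) := by
    rw [Finset.mul_sum]
    refine Finset.sum_congr rfl fun n _ => ?_
    have h2 : ∏ j : Fin n, x (Fin.castLE (Nat.lt_succ_iff.mp n.2) j).succ ≠ 0 :=
      (Finset.prod_pos fun j _ => hx _).ne'
    rw [noiseTerm, ← prod_Ioi_mul_prod_castLE n x]
    field_simp
  rw [h1, Fin.prod_univ_succ, mul_comm (x 0), mul_div_mul_left _ _ hD.ne', div_mul_eq_mul_div,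
    div_lt_iff₀ hS, div_mul_eq_mul_div, lt_div_iff₀ hγ]

/-- With only one noise source the outage event concerns a product of consecutive hops, whose law is
known by Mellin inversion. -/
lemma lt_noiseTerm_iff {m : ℕ} {ρ x : Fin (m + 2) → ℝ} (hx : ∀ n, 0 < x n) {ε : ℝ}
    (n : Fin (m + 2)) : x 0 < ε * noiseTerm ρ n (fun i => x i.succ) ↔
      ∏ j : Fin (n + 1), x (Fin.castLE n.2 j) < ρ n * ε := by
  have h2 : 0 < ∏ j : Fin n, x (Fin.castLE (Nat.lt_succ_iff.mp n.2) j).succ :=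
    Finset.prod_pos fun j _ => hx _
  rw [noiseTerm, ← mul_div_assoc, lt_div_iff₀ h2, mul_comm ε, Fin.prod_univ_succ]
  rfl

lemma indepFun_comp_of_notMem_range {ι κ Ω : Type*} [Fintype κ] [MeasurableSpace Ω]
    {μ : Measure Ω} {X : ι → Ω → ℝ} (hindep : iIndepFun X μ) (hX : ∀ n, AEMeasurable (X n) μ)
    (e : κ → ι) {i : ι} (hi : ∀ k, e k ≠ i) : IndepFun (X i) (fun ω k => X (e k) ω) μ := by
  classical
  have h1 := hindep.indepFun_finset₀ {i} (Finset.univ.image e)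
    (by
      rw [Finset.disjoint_singleton_left, Finset.mem_image]
      rintro ⟨k, -, hk⟩
      exact hi k hk) hX
  have h2 : Measurable fun v : ({i} : Finset ι) → ℝ => v ⟨i, Finset.mem_singleton_self i⟩ :=
    measurable_pi_apply _
  have h3 : Measurable fun (v : (↥(Finset.univ.image e)) → ℝ) (k : κ) =>
      v ⟨e k, Finset.mem_image_of_mem e (Finset.mem_univ k)⟩ :=
    measurable_pi_lambda _ fun k => measurable_pi_apply _
  exact h1.comp h2 h3

lemma ae_forall_pos {ι Ω : Type*} [Countable ι] [MeasurableSpace Ω] {μ : Measure Ω}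
    {X : ι → Ω → ℝ} {K θ : ι → ℝ} (hX : ∀ n, AEMeasurable (X n) μ)
    (hlaw : ∀ n, μ.map (X n) = ricianLaw (K n) (θ n)) : ∀ᵐ ω ∂μ, ∀ n, 0 < X n ω :=
  ae_all_iff.mpr fun n => ae_pos_of_map_eq_ricianLaw (hX n) (hlaw n)

lemma measureReal_lt_noiseTerm_castSucc {m : ℕ} {Ω : Type*} [MeasurableSpace Ω] {μ : Measure Ω}
    {X : Fin (m + 2) → Ω → ℝ} {K θ ρ : Fin (m + 2) → ℝ} (hX : ∀ n, AEMeasurable (X n) μ)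
    (hlaw : ∀ n, μ.map (X n) = ricianLaw (K n) (θ n)) {ε δ : ℝ} (hδ : 0 < δ) :
    μ.real {ω | δ < ε * noiseTerm ρ (Fin.last m).castSucc (fun i => X i.succ ω)} =
      μ.real {ω | ∏ j : Fin m, X j.castSucc.succ ω < ρ (Fin.last m).castSucc * ε / δ} := by
  refine measureReal_congr ?_
  filter_upwards [ae_forall_pos hX hlaw] with ω hω
  refine propext ?_
  change δ < ε * (ρ (Fin.last m).castSucc / ∏ j : Fin m, X j.castSucc.succ ω) ↔
    ∏ j : Fin m, X j.castSucc.succ ω < ρ (Fin.last m).castSucc * ε / δ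
  have h2 : 0 < ∏ j : Fin m, X j.castSucc.succ ω := Finset.prod_pos fun j _ => hω _
  rw [← mul_div_assoc, lt_div_iff₀ h2, lt_div_iff₀ hδ, mul_comm δ, mul_comm ε]

/-! ### The outage probability as an expectation over the later hops -/

section Outage

variable {m : ℕ} {Ω : Type*} [MeasurableSpace Ω] {μ : Measure Ω} [IsProbabilityMeasure μ]
  {X : Fin (m + 2) → Ω → ℝ} {K θ ρ : Fin (m + 2) → ℝ}

lemma measureReal_lt_noise (hX : ∀ n, AEMeasurable (X n) μ)
    (hlaw : ∀ n, μ.map (X n) = ricianLaw (K n) (θ n)) (hindep : iIndepFun X μ)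
    {g : (Fin (m + 1) → ℝ) → ℝ} (hg : Measurable g) :
    μ.real {ω | X 0 ω < g (fun i => X i.succ ω)} =
      ∫ ω, ricianCDF (K 0) (θ 0) (g (fun i => X i.succ ω)) ∂μ := by
  rw [measureReal_lt_of_indepFun (Z := fun ω i => X (Fin.succ i) ω) (hX 0)
    (aemeasurable_pi_lambda _ fun i => hX _)
    (indepFun_comp_of_notMem_range hindep hX Fin.succ fun k => Fin.succ_ne_zero k) hg, hlaw 0]
  rfl

lemma integral_ricianCDF_noiseTerm (hX : ∀ n, AEMeasurable (X n) μ)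
    (hlaw : ∀ n, μ.map (X n) = ricianLaw (K n) (θ n)) (hindep : iIndepFun X μ) (ε : ℝ)
    (n : Fin (m + 2)) :
    ∫ ω, ricianCDF (K 0) (θ 0) (ε * noiseTerm ρ n (fun i => X i.succ ω)) ∂μ =
      μ.real {ω | ∏ j : Fin (n + 1), X (Fin.castLE n.2 j) ω < ρ n * ε} := by
  rw [← measureReal_lt_noise hX hlaw hindep (g := fun z => ε * noiseTerm ρ n z)
    ((measurable_noiseTerm ρ n).const_mul ε)]
  refine measureReal_congr ?_
  filter_upwards [ae_forall_pos hX hlaw] with ω hω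
  exact propext (lt_noiseTerm_iff (x := fun n => X n ω) hω n)

lemma measureReal_snr_lt (hX : ∀ n, AEMeasurable (X n) μ) (hρ : ∀ n, 0 < ρ n)
    (hlaw : ∀ n, μ.map (X n) = ricianLaw (K n) (θ n)) (hindep : iIndepFun X μ) {γth γ : ℝ}
    (hγ : 0 < γ) :
    μ.real {ω | (∏ n, X n ω) / (∑ n, ρ n * ∏ j ∈ Finset.Ioi n, X j ω) * γ < γth} =
      ∫ ω, ricianCDF (K 0) (θ 0) (γth / γ * ∑ n, noiseTerm ρ n (fun i => X i.succ ω)) ∂μ := by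
  rw [← measureReal_lt_noise hX hlaw hindep (g := fun z => γth / γ * ∑ n, noiseTerm ρ n z)
    ((Finset.measurable_sum _ fun n _ => measurable_noiseTerm ρ n).const_mul _)]
  refine measureReal_congr ?_
  filter_upwards [ae_forall_pos hX hlaw] with ω hω
  exact propext (snr_lt_iff (x := fun n => X n ω) hρ hω hγ)

lemma noiseTerm_last {ρ : Fin (m + 2) → ℝ} (hρ : ∀ n, 0 < ρ n) {z : Fin (m + 1) → ℝ} :
    noiseTerm ρ (Fin.last (m + 1)) z = noiseTerm ρ (Fin.last m).castSucc z *
      (ρ (Fin.last (m + 1)) / ρ (Fin.last m).castSucc) / z (Fin.last m) := by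
  have h1 : ∏ j : Fin (Fin.last (m + 1)), z (Fin.castLE (Nat.lt_succ_iff.mp (Fin.last (m + 1)).2) j) =
      (∏ j : Fin m, z j.castSucc) * z (Fin.last m) := Fin.prod_univ_castSucc z
  have h2 : ∏ j : Fin (Fin.last m).castSucc,
      z (Fin.castLE (Nat.lt_succ_iff.mp (Fin.last m).castSucc.2) j) = ∏ j : Fin m, z j.castSucc := rfl
  have h3 := (hρ (Fin.last m).castSucc).ne'
  rw [noiseTerm, noiseTerm, h1, h2]
  field_simp

lemma integrable_ricianCDF_comp {K θ : ℝ} (hK : 0 ≤ K) (hθ : 0 < θ) {f : Ω → ℝ}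
    (hf : AEMeasurable f μ) : Integrable (fun ω => ricianCDF K θ (f ω)) μ :=
  Integrable.of_bound ((ricianCDF_mono hK hθ).measurable.comp_aemeasurable hf).aestronglyMeasurable 1
    (ae_of_all _ fun ω => by
      rw [Real.norm_of_nonneg (ricianCDF_nonneg _ _ _)]
      exact ricianCDF_le_one hK hθ _)

/-- Integrate the near-additivity of `F` with `x` the last noise term, `y` the penultimate one and
`a` the others. The delicate error is `F(y)` on `{x > δ}`. As `x = r y / X_N`, a large `x` forces
`y` large or `X_N < τ`. The former is an event on the `m` middle hops, the latter is independent of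
`y` and has small probability. -/
lemma exists_abs_measureReal_snr_lt_sub_le (hK : ∀ n, 0 ≤ K n) (hθ : ∀ n, 0 < θ n)
    (hρ : ∀ n, 0 < ρ n)
    (hlaw : ∀ n, μ.map (X n) = ricianLaw (K n) (θ n)) (hindep : iIndepFun X μ) {γth : ℝ}
    (hγth : 0 < γth) :
    ∃ C > 0, ∀ η > 0, ∃ δ₁ > 0, ∃ δ₂ > 0, ∀ γ > 0,
      |μ.real {ω | (∏ n, X n ω) / (∑ n, ρ n * ∏ j ∈ Finset.Ioi n, X j ω) * γ < γth} -
        μ.real {ω | ∏ n, X n ω < ρ (Fin.last (m + 1)) * γth / γ} -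
        μ.real {ω | ∏ n : Fin (m + 1), X n.castSucc ω < ρ (Fin.last m).castSucc * γth / γ}| ≤
      C * ∑ i : Fin m, μ.real {ω | ∏ j : Fin (i + 1),
          X (Fin.castLE i.castSucc.castSucc.2 j) ω < ρ i.castSucc.castSucc * γth / γ} +
        η * μ.real {ω | ∏ n : Fin (m + 1), X n.castSucc ω < ρ (Fin.last m).castSucc * γth / γ} +
        C * μ.real {ω | ∏ j : Fin m, X j.castSucc.succ ω <
          ρ (Fin.last m).castSucc * γth / δ₁ / γ} +
        μ.real {ω | ∏ j : Fin m, X j.castSucc.succ ω <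
          ρ (Fin.last m).castSucc * γth / δ₂ / γ} := by
  have hX := fun n => aemeasurable_of_map_eq_ricianLaw (hK n) (hθ n) (hlaw n)
  obtain ⟨C, hC, hsum⟩ := exists_abs_ricianCDF_sum_sub_le (hK 0) (hθ 0)
  refine ⟨C, hC, fun η hη => ?_⟩
  obtain ⟨δ, hδ, hbound⟩ := hsum (η / 2) (half_pos hη)
  set r := ρ (Fin.last (m + 1)) / ρ (Fin.last m).castSucc with hr
  have hr0 : 0 < r := div_pos (hρ _) (hρ _)
  set b := (K (Fin.last (m + 1)) + 1) / θ (Fin.last (m + 1)) with hb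
  have hb0 : 0 < b := div_pos (by linarith [hK (Fin.last (m + 1))]) (hθ _)
  -- The last hop has density at most `b`, so `C · P(X_N < τ) ≤ C b τ = η/2`; the other half of `η`
  -- is spent on near-additivity.
  set τ := η / 2 / (C * b) with hτ
  have hτ0 : 0 < τ := by positivity
  refine ⟨τ * δ / r, by positivity, δ, hδ, fun γ hγ => ?_⟩
  set ε := γth / γ with hε
  have hε0 : 0 < ε := div_pos hγth hγ
  set F := ricianCDF (K 0) (θ 0) with hF
  set T : Fin (m + 2) → Ω → ℝ := fun n ω => ε * noiseTerm ρ n (fun i => X i.succ ω) with hT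
  have hTm : ∀ n, AEMeasurable (T n) μ := fun n =>
    ((measurable_noiseTerm ρ n).comp_aemeasurable
      (aemeasurable_pi_lambda _ fun i => hX (Fin.succ i))).const_mul ε
  have hG : ∀ n : Fin (m + 2), ∫ ω, F (T n ω) ∂μ =
      μ.real {ω | ∏ j : Fin (n + 1), X (Fin.castLE n.2 j) ω < ρ n * γth / γ} := fun n => by
    rw [mul_div_assoc, ← hε, ← integral_ricianCDF_noiseTerm hX hlaw hindep]
  have hP : ∀ δ' > 0, μ.real {ω | δ' < T (Fin.last m).castSucc ω} =
      μ.real {ω | ∏ j : Fin m, X j.castSucc.succ ω < ρ (Fin.last m).castSucc * γth / δ' / γ} := by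
    intro δ' hδ'
    simp only [hT]
    have h1 : ρ (Fin.last m).castSucc * ε / δ' = ρ (Fin.last m).castSucc * γth / δ' / γ := by
      rw [hε]
      ring
    rw [measureReal_lt_noiseTerm_castSucc hX hlaw hδ', h1]
  have hFi : ∀ n, Integrable (fun ω => F (T n ω)) μ := fun n =>
    integrable_ricianCDF_comp (hK 0) (hθ 0) (hTm n)
  set Xl := X (Fin.last (m + 1)) with hXl
  -- The penultimate noise term does not involve the last hop, so the expectation factors.
  have hind : ∫ ω, F (T (Fin.last m).castSucc ω) * Set.indicator (Set.Iio τ) (fun _ => (1 : ℝ)) (Xl ω) ∂μ =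
      (∫ ω, F (T (Fin.last m).castSucc ω) ∂μ) * ricianCDF (K (Fin.last (m + 1))) (θ (Fin.last (m + 1))) τ := by
    have hi : IndepFun (X (Fin.last (m + 1))) (fun ω (k : Fin m) => X k.castSucc.succ ω) μ :=
      indepFun_comp_of_notMem_range hindep hX (fun k : Fin m => k.castSucc.succ)
        fun k h => by
          have := congrArg Fin.val h
          simp at this
          omega
    have hmI : Measurable (Set.indicator (Set.Iio τ) (fun _ => (1 : ℝ))) :=
      measurable_const.indicator measurableSet_Iio
    have hmF : Measurable fun u : Fin m → ℝ =>
        F (ε * (ρ (Fin.last m).castSucc / ∏ j : Fin m, u j)) :=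
      (ricianCDF_mono (hK 0) (hθ 0)).measurable.comp (by fun_prop)
    have hi2 := hi.symm.comp hmF hmI
    have h1 := hi2.integral_fun_mul_eq_mul_integral
      (hmF.comp_aemeasurable (aemeasurable_pi_lambda _ fun k => hX _)).aestronglyMeasurable
      (hmI.comp_aemeasurable (hX _)).aestronglyMeasurable
    have h2 : ∫ ω, Set.indicator (Set.Iio τ) (fun _ => (1 : ℝ)) (Xl ω) ∂μ =
        ricianCDF (K (Fin.last (m + 1))) (θ (Fin.last (m + 1))) τ := by
      rw [← integral_map (f := Set.indicator (Set.Iio τ) (fun _ => (1 : ℝ))) (hX _)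
        hmI.aestronglyMeasurable, hlaw, integral_indicator measurableSet_Iio, setIntegral_const,
        smul_eq_mul, mul_one, ricianCDF]
    rw [← h2]
    exact h1
  have hFτ : C * ricianCDF (K (Fin.last (m + 1))) (θ (Fin.last (m + 1))) τ ≤ η / 2 := by
    have h1 := ricianCDF_sub_le (hK (Fin.last (m + 1))) (hθ (Fin.last (m + 1))) (x := 0) (y := τ) (B := b)
      hτ0.le (fun t ht => ricianPDF_le (hK _) (hθ _) ht.1) hb0.le
    rw [ricianCDF_zero, sub_zero, sub_zero] at h1
    calc _ ≤ C * (b * τ) := mul_le_mul_of_nonneg_left h1 hC.le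
      _ = η / 2 := by rw [hτ]; field_simp
  set y := T (Fin.last m).castSucc with hy
  have hptw : ∀ᵐ ω ∂μ, |F (ε * ∑ n, noiseTerm ρ n (fun i => X i.succ ω)) -
      F (T (Fin.last (m + 1)) ω) - F (y ω)| ≤
      C * ∑ i : Fin m, F (T i.castSucc.castSucc ω) + η / 2 * F (y ω) +
        C * (Set.indicator {ω | τ * δ / r < y ω} (fun _ => (1 : ℝ)) ω +
          F (y ω) * Set.indicator (Set.Iio τ) (fun _ => (1 : ℝ)) (Xl ω)) +
        Set.indicator {ω | δ < y ω} (fun _ => (1 : ℝ)) ω := by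
    filter_upwards [ae_forall_pos hX hlaw] with ω hω
    have hTpos : ∀ n, 0 < T n ω := fun n =>
      mul_pos hε0 (noiseTerm_pos hρ n fun i => hω _)
    have h1 := hbound (T (Fin.last (m + 1)) ω) (y ω) m (fun i => T i.castSucc.castSucc ω)
      (hTpos _).le (hTpos _).le fun i => (hTpos _).le
    have h2 : ε * ∑ n, noiseTerm ρ n (fun i => X i.succ ω) =
        ∑ i : Fin m, T i.castSucc.castSucc ω + y ω + T (Fin.last (m + 1)) ω := by
      rw [Finset.mul_sum, Fin.sum_univ_castSucc, Fin.sum_univ_castSucc]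
    rw [h2]
    refine h1.trans (add_le_add (add_le_add le_rfl (mul_le_mul_of_nonneg_left ?_ hC.le)) ?_)
    · have hFy := ricianCDF_nonneg (K 0) (θ 0) (y ω)
      have hFy1 := ricianCDF_le_one (hK 0) (hθ 0) (y ω)
      split_ifs with hx
      · by_cases hyl : τ * δ / r < y ω
        · rw [Set.indicator_of_mem (s := {ω | τ * δ / r < y ω}) hyl]
          have : 0 ≤ F (y ω) * Set.indicator (Set.Iio τ) (fun _ => (1 : ℝ)) (Xl ω) :=
            mul_nonneg hFy (Set.indicator_nonneg (fun _ _ => zero_le_one) _)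
          linarith
        · have hXlω : Xl ω ∈ Set.Iio τ := by
            have h3 : T (Fin.last (m + 1)) ω = y ω * r / Xl ω := by
              simp only [hT, hy]
              rw [noiseTerm_last hρ, Fin.succ_last]
              ring
            have hXp : 0 < Xl ω := hω _
            rw [h3, lt_div_iff₀ hXp] at hx
            have h4 : y ω * r ≤ τ * δ := (le_div_iff₀ hr0).mp (not_lt.mp hyl)
            rw [Set.mem_Iio]
            nlinarith
          rw [Set.indicator_of_notMem (s := {ω | τ * δ / r < y ω}) hyl,
            Set.indicator_of_mem hXlω]
          simp [hF]
      · exact add_nonneg (Set.indicator_nonneg (fun _ _ => zero_le_one) _)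
          (mul_nonneg hFy (Set.indicator_nonneg (fun _ _ => zero_le_one) _))
    · exact le_of_eq (by simp [Set.indicator])
  have hym : AEMeasurable y μ := hTm _
  have hset : ∀ δ' : ℝ, NullMeasurableSet {ω | δ' < y ω} μ := fun δ' =>
    nullMeasurableSet_lt aemeasurable_const hym
  have hIi : ∀ δ' : ℝ, Integrable (Set.indicator {ω | δ' < y ω} (fun _ => (1 : ℝ))) μ := fun δ' =>
    (integrable_const 1).indicator₀ (hset δ')
  have hII : ∀ δ' : ℝ, ∫ ω, Set.indicator {ω | δ' < y ω} (fun _ => (1 : ℝ)) ω ∂μ =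
      μ.real {ω | δ' < y ω} := fun δ' => by
    rw [integral_indicator₀ (hset δ'), setIntegral_const, smul_eq_mul, mul_one]
  have hPi : Integrable (fun ω => F (y ω) * Set.indicator (Set.Iio τ) (fun _ => (1 : ℝ)) (Xl ω)) μ := by
    refine (hFi _).mul_bdd (c := 1) ?_ (ae_of_all _ fun ω => ?_)
    · exact ((measurable_const.indicator measurableSet_Iio).comp_aemeasurable (hX _)).aestronglyMeasurable
    · simp only [Set.indicator]
      split_ifs <;> simp
  have hSm : AEMeasurable (fun ω => ε * ∑ n, noiseTerm ρ n (fun i => X i.succ ω)) μ :=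
    ((Finset.measurable_sum _ fun n _ => measurable_noiseTerm ρ n).comp_aemeasurable
      (aemeasurable_pi_lambda _ fun i => hX (Fin.succ i))).const_mul ε
  have hSi := integrable_ricianCDF_comp (hK 0) (hθ 0) hSm
  have hSF : Integrable (fun ω => F (ε * ∑ n, noiseTerm ρ n (fun i => X i.succ ω)) -
      F (T (Fin.last (m + 1)) ω)) μ := hSi.sub (hFi _)
  have e1 : μ.real {ω | ∏ n, X n ω < ρ (Fin.last (m + 1)) * γth / γ} =
      ∫ ω, F (T (Fin.last (m + 1)) ω) ∂μ := (hG (Fin.last (m + 1))).symm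
  have e2 : μ.real {ω | ∏ n : Fin (m + 1), X n.castSucc ω < ρ (Fin.last m).castSucc * γth / γ} =
      ∫ ω, F (y ω) ∂μ := (hG (Fin.last m).castSucc).symm
  have e3 : ∀ i : Fin m, μ.real {ω | ∏ j : Fin (i + 1),
          X (Fin.castLE i.castSucc.castSucc.2 j) ω < ρ i.castSucc.castSucc * γth / γ} =
      ∫ ω, F (T i.castSucc.castSucc ω) ∂μ := fun i => (hG i.castSucc.castSucc).symm
  rw [measureReal_snr_lt hX hρ hlaw hindep hγ, e1, e2, Finset.sum_congr rfl fun i _ => e3 i,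
    ← hP _ (by positivity), ← hP _ hδ, ← integral_sub hSi (hFi _), ← integral_sub hSF (hFi _)]
  have hsumi : Integrable (fun ω => ∑ i : Fin m, F (T i.castSucc.castSucc ω)) μ :=
    integrable_finsetSum _ fun i _ => hFi _
  have hA : Integrable (fun ω => C * ∑ i : Fin m, F (T i.castSucc.castSucc ω) +
      η / 2 * F (y ω)) μ := (hsumi.const_mul C).add ((hFi _).const_mul _)
  have hB : Integrable (fun ω => C * (Set.indicator {ω | τ * δ / r < y ω} (fun _ => (1 : ℝ)) ω +
      F (y ω) * Set.indicator (Set.Iio τ) (fun _ => (1 : ℝ)) (Xl ω))) μ :=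
    ((hIi _).add hPi).const_mul C
  have hAB : Integrable (fun ω => C * ∑ i : Fin m, F (T i.castSucc.castSucc ω) +
      η / 2 * F (y ω) + C * (Set.indicator {ω | τ * δ / r < y ω} (fun _ => (1 : ℝ)) ω +
      F (y ω) * Set.indicator (Set.Iio τ) (fun _ => (1 : ℝ)) (Xl ω))) μ := hA.add hB
  refine (abs_integral_le_integral_abs).trans ((integral_mono_ae ?_ ?_ hptw).trans ?_)
  · exact (hSF.sub (hFi _)).abs
  · exact hAB.add (hIi _)
  · rw [integral_add hAB (hIi _), integral_add hA hB,
      integral_add (hsumi.const_mul C) ((hFi _).const_mul _), integral_const_mul, integral_const_mul,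
      integral_const_mul, integral_add (hIi _) hPi, hII, hII, hind,
      integral_finsetSum _ fun i _ => hFi _]
    have h0 : 0 ≤ ∫ ω, F (y ω) ∂μ := integral_nonneg fun ω => ricianCDF_nonneg _ _ _
    nlinarith [mul_le_mul_of_nonneg_right hFτ h0]

end Outage

/-! ### Asymptotics of the outage probability -/

section OutageAsymptotics

variable {m : ℕ} {Ω : Type*} [MeasurableSpace Ω] {μ : Measure Ω} [IsProbabilityMeasure μ]
  {X : Fin (m + 2) → Ω → ℝ} {K θ ρ : Fin (m + 2) → ℝ} {γth : ℝ}

/-- The outage probability splits, up to lower order, into the contributions of the noise of the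
last two hops. -/
lemma isLittleO_measureReal_snr_lt_sub (hK : ∀ n, 0 ≤ K n) (hθ : ∀ n, 0 < θ n)
    (hρ : ∀ n, 0 < ρ n) (hγth : 0 < γth)
    (hlaw : ∀ n, μ.map (X n) = ricianLaw (K n) (θ n)) (hindep : iIndepFun X μ) :
    (fun γ : ℝ =>
      μ.real {ω | (∏ n, X n ω) / (∑ n, ρ n * ∏ j ∈ Finset.Ioi n, X j ω) * γ < γth} -
        μ.real {ω | ∏ n, X n ω < ρ (Fin.last (m + 1)) * γth / γ} -
        μ.real {ω | ∏ n : Fin (m + 1), X n.castSucc ω < ρ (Fin.last m).castSucc * γth / γ})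
      =o[atTop] (fun γ : ℝ => Real.log γ ^ m / γ) := by
  obtain ⟨C, hC, hbound⟩ := exists_abs_measureReal_snr_lt_sub_le hK hθ hρ hlaw hindep hγth
  have h2 : (fun γ : ℝ => μ.real {ω | ∏ n : Fin (m + 1), X n.castSucc ω <
      ρ (Fin.last m).castSucc * γth / γ}) =O[atTop] (fun γ : ℝ => Real.log γ ^ m / γ) :=
    isBigO_measureReal_prod_lt (X := fun n : Fin (m + 1) => X n.castSucc)
      (fun n => hK n.castSucc) (fun n => hθ n.castSucc) (fun n => hlaw n.castSucc)
      (hindep.precomp (Fin.castSucc_injective _)) (mul_pos (hρ _) hγth)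
  have h1 : (fun γ : ℝ => ∑ i : Fin m, μ.real {ω | ∏ j : Fin (i + 1),
      X (Fin.castLE i.castSucc.castSucc.2 j) ω < ρ i.castSucc.castSucc * γth / γ})
      =o[atTop] (fun γ : ℝ => Real.log γ ^ m / γ) :=
    IsLittleO.fun_sum fun (i : Fin m) _ =>
      (isBigO_measureReal_prod_lt
        (X := fun j : Fin (i + 1) => X (Fin.castLE i.castSucc.castSucc.2 j))
        (fun _ => hK _) (fun _ => hθ _) (fun _ => hlaw _)
        (hindep.precomp (Fin.castLE_injective _)) (mul_pos (hρ _) hγth)).trans_isLittleO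
        (isLittleO_log_pow_div i.2)
  have h3 : ∀ δ : ℝ, 0 < δ → (fun γ : ℝ => μ.real {ω | ∏ j : Fin m, X j.castSucc.succ ω <
      ρ (Fin.last m).castSucc * γth / δ / γ}) =o[atTop] (fun γ : ℝ => Real.log γ ^ m / γ) :=
    fun δ hδ => isLittleO_measureReal_prod_lt (X := fun j : Fin m => X j.castSucc.succ)
      (fun _ => hK _) (fun _ => hθ _) (fun _ => hlaw _)
      (hindep.precomp ((Fin.succ_injective _).comp (Fin.castSucc_injective _)))
      (div_pos (mul_pos (hρ _) hγth) hδ)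
  obtain ⟨B, hB, h2⟩ := h2.exists_pos
  refine isLittleO_iff.mpr fun c hc => ?_
  -- This `η` makes the `η` term at most half the allowed error; the rest is little-o for the fixed
  -- `δ₁`, `δ₂`.
  obtain ⟨δ₁, hδ₁, δ₂, hδ₂, hle⟩ := hbound (c / 2 / B) (by positivity)
  have h4 := (((h1.const_mul_left C).add ((h3 δ₁ hδ₁).const_mul_left C)).add (h3 δ₂ hδ₂)).def
    (half_pos hc)
  filter_upwards [h4, h2.bound, eventually_gt_atTop 0] with γ h5 h6 hγ
  refine (hle γ hγ).trans ?_
  have h7 := mul_le_mul_of_nonneg_left ((Real.le_norm_self _).trans h6)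
    (by positivity : (0 : ℝ) ≤ c / 2 / B)
  have h8 := (Real.le_norm_self _).trans h5
  have h9 : c / 2 / B * (B * ‖Real.log γ ^ m / γ‖) = c / 2 * ‖Real.log γ ^ m / γ‖ := by
    field_simp
  linarith

lemma isLittleO_measureReal_snr_lt_sub_riceLeading (hK : ∀ n, 0 ≤ K n) (hθ : ∀ n, 0 < θ n)
    (hρ : ∀ n, 0 < ρ n) (hγth : 0 < γth)
    (hlaw : ∀ n, μ.map (X n) = ricianLaw (K n) (θ n)) (hindep : iIndepFun X μ) :
    (fun γ : ℝ =>
      μ.real {ω | (∏ n, X n ω) / (∑ n, ρ n * ∏ j ∈ Finset.Ioi n, X j ω) * γ < γth} -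
        riceLeading K θ ρ γth γ) =o[atTop] (fun γ : ℝ => Real.log γ ^ (m + 1) / γ) := by
  have h1 := (isLittleO_measureReal_snr_lt_sub hK hθ hρ hγth hlaw hindep).trans
    (isLittleO_log_pow_div (Nat.lt_succ_self m))
  have h2 := isLittleO_measureReal_prod_lt_sub_riceLeading hK hθ hρ hγth hlaw hindep
  have h3 := (isBigO_measureReal_prod_lt (X := fun n : Fin (m + 1) => X n.castSucc)
    (fun n => hK n.castSucc) (fun n => hθ n.castSucc) (fun n => hlaw n.castSucc)
    (hindep.precomp (Fin.castSucc_injective _))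
    (mul_pos (hρ (Fin.last m).castSucc) hγth)).trans_isLittleO
    (isLittleO_log_pow_div (Nat.lt_succ_self m))
  refine ((h1.add h2).add h3).congr_left fun γ => ?_
  ring

/-- The product of all hops accounts for the `ℓ = 0` part of the expansion. The product without the
last hop has the leading term that the larger box adds, so the two cancel. -/
lemma isLittleO_measureReal_snr_lt_sub_riceExpansion (hK : ∀ n, 0 ≤ K n) (hθ : ∀ n, 0 < θ n)
    (hρ : ∀ n, 0 < ρ n) (hγth : 0 < γth)
    (hlaw : ∀ n, μ.map (X n) = ricianLaw (K n) (θ n)) (hindep : iIndepFun X μ)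
    {L : Fin (m + 1) → ℕ} (hL : ∀ k, 2 ≤ L k) :
    (fun γ : ℝ =>
      μ.real {ω | (∏ n, X n ω) / (∑ n, ρ n * ∏ j ∈ Finset.Ioi n, X j ω) * γ < γth} -
        riceExpansion K θ ρ γth L γ) =o[atTop] (fun γ : ℝ => Real.log γ ^ m / γ) := by
  have h1 := isLittleO_measureReal_snr_lt_sub hK hθ hρ hγth hlaw hindep
  have h2 := (isLittleO_measureReal_prod_lt_sub_riceExpansion hK hθ hρ hγth hlaw
    hindep).trans_isBigO (isBigO_inv_log_pow_div m)
  have h3 := isLittleO_measureReal_prod_lt_sub_riceLeading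
    (X := fun n : Fin (m + 1) => X n.castSucc) (ρ := fun n => ρ n.castSucc)
    (fun n => hK n.castSucc) (fun n => hθ n.castSucc) (fun n => hρ n.castSucc) hγth
    (fun n => hlaw n.castSucc) (hindep.precomp (Fin.castSucc_injective _))
  have h4 := isLittleO_riceExpansion_sub_riceExpansion_one hK hθ hρ hγth hL
  refine (((h1.add h2).add h3).sub h4).congr_left fun γ => ?_
  ring

end OutageAsymptotics

/-! ### Equivalence with the leading term -/

lemma isBigO_log_pow_div_riceLeading {M : ℕ} {K θ ρ : Fin (M + 1) → ℝ} {γth : ℝ}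
    (hK : ∀ n, 0 ≤ K n) (hθ : ∀ n, 0 < θ n) (hρ : ∀ n, 0 < ρ n) (hγth : 0 < γth) :
    (fun γ : ℝ => Real.log γ ^ M / γ) =O[atTop] riceLeading K θ ρ γth := by
  have h1 : 0 < ρ (Fin.last M) * γth / (M.factorial : ℝ) *
      ∏ n, (K n + 1) / (θ n * Real.exp (K n)) :=
    mul_pos (div_pos (mul_pos (hρ _) hγth) (by positivity)) (Finset.prod_pos fun n _ =>
      div_pos (by linarith [hK n]) (mul_pos (hθ n) (Real.exp_pos _)))
  exact (isBigO_refl _ _).const_mul_right h1.ne'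

lemma isEquivalent_of_isLittleO_sub_riceLeading {M : ℕ} {K θ ρ : Fin (M + 1) → ℝ} {γth : ℝ}
    (hK : ∀ n, 0 ≤ K n) (hθ : ∀ n, 0 < θ n) (hρ : ∀ n, 0 < ρ n) (hγth : 0 < γth) {f : ℝ → ℝ}
    (hf : (fun γ : ℝ => f γ - riceLeading K θ ρ γth γ) =o[atTop]
      (fun γ : ℝ => Real.log γ ^ M / γ)) :
    IsEquivalent atTop f (riceLeading K θ ρ γth) :=
  hf.trans_isBigO (isBigO_log_pow_div_riceLeading hK hθ hρ hγth)

lemma isEquivalent_contourOutage {M : ℕ} {K θ ρ : Fin (M + 1) → ℝ} {γth : ℝ}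
    (hK : ∀ n, 0 ≤ K n) (hθ : ∀ n, 0 < θ n) (hρ : ∀ n, 0 < ρ n) (hγth : 0 < γth)
    {L : Fin M → ℕ} (hL : ∀ k, 1 ≤ L k)
    {κ : (Fin M → ℕ) → ℝ} (hκ : ∀ ℓ ∈ box L, (lam ℓ M : ℝ) < κ ℓ) :
    IsEquivalent atTop (contourOutage K θ ρ γth L κ)
      (fun γ => (riceLeading K θ ρ γth γ : ℂ)) := by
  have h1 := (isLittleO_contourOutage_sub_riceExpansion hK hθ hρ hγth hL hκ).trans_isBigO
    (isBigO_inv_log_pow_div M)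
  have h2 := isLittleO_ofReal_left.mpr
    (isLittleO_riceExpansion_sub_riceLeading hK hθ hρ hγth hL)
  have h3 := (h1.add h2).trans_isBigO (isBigO_log_pow_div_riceLeading hK hθ hρ hγth)
  have h4 := h3.trans_isBigO (g := riceLeading K θ ρ γth)
    (k := fun γ => (riceLeading K θ ρ γth γ : ℂ)) 
    (IsBigO.of_norm_right (by simpa using (isBigO_refl _ _).norm_right))
  refine h4.congr_left fun γ => ?_
  push_cast
  simp

end MultihopRelay

end

/-- High-SNR expansion of the outage probability of a fixed-gain amplify-and-forward link with
`N = M + 1 ≥ 2` independent Rician hops. -/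
theorem mainTheorem5 {M : ℕ} (hM : 1 ≤ M)
    {Ω : Type*} [MeasurableSpace Ω] (μ : Measure Ω) [IsProbabilityMeasure μ]
    (A : Fin (M + 1) → ℝ) (h : Fin (M + 1) → Ω → ℂ)
    (K θ ρ : Fin (M + 1) → ℝ) (γth : ℝ)
    (hK : ∀ n, 0 ≤ K n) (hθ : ∀ n, 0 < θ n) (hρ : ∀ n, 0 < ρ n) (hγth : 0 < γth)
    (hlaw : ∀ n, μ.map (MultihopRelay.channelPower A h n) = MultihopRelay.ricianLaw (K n) (θ n))
    (hindep : iIndepFun (MultihopRelay.channelPower A h) μ)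
    (L : Fin M → ℕ) (hL : ∀ k, 1 ≤ L k)
    (κ : (Fin M → ℕ) → ℝ) (hκ : ∀ ℓ ∈ MultihopRelay.box L, (MultihopRelay.lam ℓ M : ℝ) < κ ℓ) :
    -- the contour integrals converge absolutely
    (∀ ℓ ∈ MultihopRelay.box L, ∀ γ : ℝ, 0 < γ →
      Integrable fun t : ℝ =>
        MultihopRelay.contourIntegrand K θ ρ γth ℓ γ (((-κ ℓ : ℝ) : ℂ) + t * Complex.I)) ∧
    -- the outage probability is asymptotically equivalent to the contour-integral expression
    IsEquivalent atTop
      (fun γ : ℝ => (MultihopRelay.outageProb μ A h ρ γth γ : ℂ))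
      (MultihopRelay.contourOutage K θ ρ γth L κ) ∧
    -- which equals the expansion up to `o(1 / γ)`
    (fun γ : ℝ => MultihopRelay.contourOutage K θ ρ γth L κ γ -
        (MultihopRelay.riceExpansion K θ ρ γth L γ : ℂ)) =o[atTop] (fun γ : ℝ => γ⁻¹) ∧
    -- so the outage probability is asymptotically equivalent to the expansion
    IsEquivalent atTop
      (MultihopRelay.outageProb μ A h ρ γth) (MultihopRelay.riceExpansion K θ ρ γth L) ∧
    -- with an additive remainder `o((log γ) ^ (N - 2) / γ)` as soon as all orders are at least two
    ((∀ k, 2 ≤ L k) →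
      (fun γ : ℝ => MultihopRelay.outageProb μ A h ρ γth γ -
          MultihopRelay.riceExpansion K θ ρ γth L γ)
        =o[atTop] (fun γ : ℝ => Real.log γ ^ (M - 1) / γ)) ∧
    -- the leading order
    IsEquivalent atTop
      (MultihopRelay.outageProb μ A h ρ γth) (MultihopRelay.riceLeading K θ ρ γth) := by
  obtain ⟨m, rfl⟩ : ∃ m, M = m + 1 := ⟨M - 1, by omega⟩
  have hP : IsEquivalent atTop (MultihopRelay.outageProb μ A h ρ γth)
      (MultihopRelay.riceLeading K θ ρ γth) :=
    MultihopRelay.isEquivalent_of_isLittleO_sub_riceLeading hK hθ hρ hγth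
      (MultihopRelay.isLittleO_measureReal_snr_lt_sub_riceLeading hK hθ hρ hγth hlaw hindep)
  refine ⟨fun ℓ hℓ γ hγ => MultihopRelay.integrable_contourIntegrand hK hθ hρ hγth hγ ℓ ?_, ?_,
    MultihopRelay.isLittleO_contourOutage_sub_riceExpansion hK hθ hρ hγth hL hκ,
    hP.trans (MultihopRelay.isEquivalent_of_isLittleO_sub_riceLeading hK hθ hρ hγth
      (MultihopRelay.isLittleO_riceExpansion_sub_riceLeading hK hθ hρ hγth hL)).symm,
    MultihopRelay.isLittleO_measureReal_snr_lt_sub_riceExpansion hK hθ hρ hγth hlaw hindep, hP⟩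
  · linarith [hκ ℓ hℓ, Nat.cast_nonneg (α := ℝ) (MultihopRelay.lam ℓ (m + 1))]
  -- The probability and the contour expression are compared only through their common leading term.
  · refine IsEquivalent.trans ?_
      (MultihopRelay.isEquivalent_contourOutage hK hθ hρ hγth hL hκ).symm
    have h1 := MultihopRelay.isLittleO_ofReal_left.mpr hP.isLittleO
    refine IsLittleO.congr_left (f₁ := fun γ => ((MultihopRelay.outageProb μ A h ρ γth γ -
      MultihopRelay.riceLeading K θ ρ γth γ : ℝ) : ℂ)) (h1.trans_isBigO ?_) fun γ => by simp
    exact IsBigO.of_norm_right (by simpa using (isBigO_refl _ _).norm_right)
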